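/- **Servers.** All fluid is continuous and moves between servers without delay. A FIFO server with service rate $\mu$ has a height $h(t)$ (stored fluid divided by $\mu$) and, for each class $i$ of fluid, arrival and departure rates $a_i(t),d_i(t)$, where $$\dot h(t)=\tfrac1\mu\sum_i a_i(t)-1\ \text{ if } h(t)>0,\qquad \dot h(t)=\max\Big\{\tfrac1\mu\sum_i a_i(t)-1,\,0\Big\}\ \text{ if } h(t)=0,\qquad d_i(t+h(t))=\frac{a_i(t)}{\dot h(t)+1},$$ so that fluid arriving at time $t$ departs at time $t+h(t)$ (the equations are understood in time-integrated form). **The gadget.** There are four FIFO servers $Q_1,Q_2,Q_3,Q_4$ with service rates $1,\,1-\mu_2,\,1-\mu_3,\,1$, where $0<\mu_2<\mu_3$. The path of the horizontal session $H$ goes $K$ times through $Q_1,Q_2,Q_3,Q_4$ in this order and then $K'$ more times through $Q_4$ only. The simple session $S$ goes once through $Q_4$. Fresh fluid is $H$-fluid at the beginning of its path (at its first stop $Q_1$); processed fluid is $H$-fluid that has exactly its last pass through $Q_4$ to go. The injection rate of $H$ is $0$ at all times. The injection rate $\varepsilon(t)$ of $S$ is continuous, lies in $[0,\varepsilon_s]$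 with maximal rate $\varepsilon_s<1$, and is governed as follows. $S$ is *blocked* when $Q_4$ stores a positive amount of $S$-fluid; it is *happy* when $Q_4$ stores no $S$-fluid and the bandwidth of $Q_4$ not used by $H$ is strictly larger than $\varepsilon(t)$; otherwise it is *stable*. If $S$ becomes blocked at time $a$ and stays blocked until time $t$, then $\varepsilon(t)=f_{\delta_s}(\varepsilon(a),t-a)$; $\varepsilon$ stays constant while $S$ is stable and does not decrease while $S$ is happy. **Flow decrease.** $(f_\delta)_{\delta\in S_{\mathrm{del}}}$, $S_{\mathrm{del}}\subset\mathbb R$, is a family of functions $f_\delta(\varepsilon,t)$ of $\varepsilon,t\ge 0$ with $f_\delta(\varepsilon,0)=\varepsilon$ such that: (A2) for fixed $\delta,\varepsilon$ the function $f_\delta(\varepsilon,\cdot)$ becomes $0$ at some positive time and then stays $0$; (A3) $f_\delta(\varepsilon,t)$ is nondecreasing in $\varepsilon$ and nonincreasing in $\delta$ and in $t$; (A4) for all $0<\varepsilon'<\varepsilon$ and $t>0$ there is $\delta\in S_{\mathrm{del}}$ with $f_\delta(\varepsilon,t)>\varepsilon'$ and there is $\delta\in S_{\mathrm{del}}$ with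 $f_\delta(\varepsilon,t)<\varepsilon'$; (A5) each $f_\delta$ is continuous in $(\varepsilon,t)$. **Lemma.** Let such a family $(f_\delta)$ and an integer $K\ge 20$ be given. Then there are $\varepsilon_s\in\left(\frac{5}{3K},\frac{20}{K}\right)$ with $\varepsilon_s<1$, $\delta_s\in S_{\mathrm{del}}$, $\mu_3=\frac{2\varepsilon_s}{5}$, $\mu_2\in(0,\mu_3)$, an integer $K'\ge0$ and times $0<T_1<T_2<T_3<T_P$ with $T_3=\frac{K}{1-\mu_3}$ such that the following holds. Suppose that at time $0$ server $Q_1$ contains one unit of fresh fluid, the other three servers are empty, and $\varepsilon(0)=\varepsilon_s$. Then the gadget has an evolution on $[0,T_P]$ from this state, and every such evolution, with $h_i$ the height of $Q_i$, satisfies: * on $[0,T_1]$: $h_1$ is strictly decreasing and $h_2,h_3,h_4$ are strictly increasing, from $(h_1,h_2,h_3,h_4)(0)=(1,0,0,0)$; * on $[T_1,T_2]$: $h_1=0$, $h_2$ is strictly decreasing, $h_3,h_4$ are strictly increasing; * on $[T_2,T_3]$: $h_1=h_2=0$, $h_3$ is strictly decreasing, $h_4$ is strictly increasing; and $\varepsilon(T_3)\ge\varepsilon_s/2$;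 * on $[T_3,T_P]$: $h_1=h_2=h_3=0$ and $h_4\ge1$; * at $t=T_P$: $(h_1,h_2,h_3,h_4)=(0,0,0,1)$, the only fluid in the gadget is one unit of processed fluid (in $Q_4$), and $\varepsilon(T_P)=0$; * session $H$ arrives at $Q_2$ at rate at most $1-\mu_3$ between times $T_1$ and $T_3$, and at rate $0$ between times $T_3$ and $T_P$ (for almost every time). -/

import Mathlib

open Set MeasureTheory

namespace BasicGadget

/-- A family of flow decrease functions. `f δ ε t` is the injection rate of a session (with
damping parameter `δ ∈ Sdel`) that became blocked `t` time units ago, when its injection rate was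
`ε`, and that has been blocked ever since. Rates `ε` and times `t` are nonnegative. -/
structure IsFlowDecrease (Sdel : Set ℝ) (f : ℝ → ℝ → ℝ → ℝ) : Prop where
  /-- meaning of `ε`: it is the rate at the moment of blocking -/
  initial : ∀ δ ∈ Sdel, ∀ ε, 0 ≤ ε → f δ ε 0 = ε
  /-- decrease to `0` -/
  decrease : ∀ δ ∈ Sdel, ∀ ε, 0 ≤ ε → ∃ t₀, 0 < t₀ ∧ ∀ t, t₀ ≤ t → f δ ε t = 0
  /-- monotonicity in the initial rate -/
  mono_rate : ∀ δ ∈ Sdel, ∀ t, 0 ≤ t → MonotoneOn (fun ε => f δ ε t) (Ici 0)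
  /-- monotonicity in the damping parameter -/
  anti_damping : ∀ ε, 0 ≤ ε → ∀ t, 0 ≤ t → AntitoneOn (fun δ => f δ ε t) Sdel
  /-- monotonicity in time -/
  anti_time : ∀ δ ∈ Sdel, ∀ ε, 0 ≤ ε → AntitoneOn (fun t => f δ ε t) (Ici 0)
  /-- damping -/
  damping : ∀ ε' ε t, 0 < ε' → ε' < ε → 0 < t →
    (∃ δ ∈ Sdel, ε' < f δ ε t) ∧ (∃ δ ∈ Sdel, f δ ε t < ε')
  /-- continuity -/
  continuity : ∀ δ ∈ Sdel,
    ContinuousOn (fun x : ℝ × ℝ => f δ x.1 x.2) (Ici (0 : ℝ) ×ˢ Ici (0 : ℝ))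

/-- Rate of change of the height of a server of service rate `μ` when its current height is `x`
and the total arrival rate is `a`. -/
noncomputable def heightRate (μ x a : ℝ) : ℝ :=
  if 0 < x then a / μ - 1 else max (a / μ - 1) 0

/-- The FIFO fluid dynamics of one server on the time interval `[0, T]`. `C` is the set of fluid
classes served, `μ` the service rate, `x₀` the initial height, `ρ c u` the initial density of
class `c` at height `u` (the rate at which class `c` leaves the server at time `u ≤ x₀`), `a c`
and `d c` are the arrival and departure rates of class `c`, and `h` is the height.

`height` is the equation `h' = (∑ a) / μ - 1` if `h > 0`, `h' = max ((∑ a) / μ - 1) 0` if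
`h = 0`, and `fifo` is the equation `d c (t + h t) = a c t / (h' t + 1)`, both integrated in time:
the fluid that arrives at time `t` departs at time `t + h t`. -/
structure IsFIFOServer {ι : Type} (C : Finset ι) (μ x₀ T : ℝ) (ρ a d : ι → ℝ → ℝ)
    (h : ℝ → ℝ) : Prop where
  continuous : ContinuousOn h (Icc 0 T)
  nonneg : ∀ t ∈ Icc 0 T, 0 ≤ h t
  height : ∀ t ∈ Icc 0 T, h t = x₀ + ∫ s in (0 : ℝ)..t, heightRate μ (h s) (∑ c ∈ C, a c s)
  initial : ∀ c ∈ C, ∀ u ∈ Icc 0 T, u ≤ x₀ →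
    ∫ s in (0 : ℝ)..u, d c s = ∫ s in (0 : ℝ)..u, ρ c s
  fifo : ∀ c ∈ C, ∀ t ∈ Icc 0 T, t + h t ≤ T →
    ∫ s in (0 : ℝ)..(t + h t), d c s =
      (∫ u in (0 : ℝ)..x₀, ρ c u) + ∫ s in (0 : ℝ)..t, a c s

/-- The parameters of the gadget: `K` big loops, `K'` small loops, maximal injection rate `εs` of
the simple session, and service rates `1 - μ₂`, `1 - μ₃` of the second and third server. -/
structure Params where
  K : ℕ
  K' : ℕ
  εs : ℝ
  μ₂ : ℝ
  μ₃ : ℝ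

/-- Service rates. The servers `Q₁, Q₂, Q₃, Q₄` are numbered `0, 1, 2, 3`. -/
noncomputable def Params.serviceRate (p : Params) : Fin 4 → ℝ :=
  ![1, 1 - p.μ₂, 1 - p.μ₃, 1]

/-- Length of the path of the horizontal session. -/
def Params.visits (p : Params) : ℕ := 4 * p.K + p.K'

/-- Fluid classes: `some k` is horizontal fluid at the `k`-th stop (`k = 0, 1, …`) of its path,
`none` is fluid of the simple session. The horizontal path goes `K` times through
`Q₁, Q₂, Q₃, Q₄` and then `K'` times through `Q₄`; the simple session visits `Q₄` only. -/
def Params.serverOf (p : Params) : Option ℕ → Fin 4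
  | none => 3
  | some k => if k < 4 * p.K then Fin.ofNat 4 k else 3

/-- All fluid classes of the gadget. -/
def Params.classes (p : Params) : Finset (Option ℕ) :=
  Finset.insertNone (Finset.range p.visits)

/-- The fluid classes that are served by the server `q`. -/
def Params.classesAt (p : Params) (q : Fin 4) : Finset (Option ℕ) :=
  p.classes.filter (fun c => p.serverOf c = q)

/-- Initial heights: one unit of fluid in `Q₁`, the other servers are empty. -/
def initialHeight : Fin 4 → ℝ := ![1, 0, 0, 0]

/-- Initial composition of the queues: `Q₁` contains fresh horizontal fluid only. -/
noncomputable def initialDensity (c : Option ℕ) (_u : ℝ) : ℝ :=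
  if c = some 0 then 1 else 0

/-- A candidate time evolution: heights `h` of the servers, departure rates `dep` of all fluid
classes, and injection rates of the two sessions. -/
structure Evolution where
  h : Fin 4 → ℝ → ℝ
  dep : Option ℕ → ℝ → ℝ
  injH : ℝ → ℝ
  injS : ℝ → ℝ

/-- Arrival rates: fluid is injected at the first stop of its path and passes without delay from
each stop to the next one. -/
def Evolution.arr (e : Evolution) : Option ℕ → ℝ → ℝ
  | none => e.injS
  | some 0 => e.injH
  | some (k + 1) => e.dep (some k)

/-- The amount of fluid of class `c` that is stored at time `t`. -/
noncomputable def Evolution.stored (e : Evolution) (p : Params) (c : Option ℕ) (t : ℝ) : ℝ :=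
  (∫ u in (0 : ℝ)..(initialHeight (p.serverOf c)), initialDensity c u)
    + (∫ s in (0 : ℝ)..t, e.arr c s) - ∫ s in (0 : ℝ)..t, e.dep c s

/-- The simple session is blocked: some of its fluid is stored in `Q₄`. (No fluid has priority
over it there.) -/
def Evolution.Blocked (e : Evolution) (p : Params) (t : ℝ) : Prop :=
  0 < e.stored p none t

/-- The bandwidth of `Q₄` that is left to the simple session by the horizontal session. -/
noncomputable def Evolution.available (e : Evolution) (p : Params) (t : ℝ) : ℝ :=
  p.serviceRate 3 - ∑ c ∈ (p.classesAt 3).erase none, e.dep c t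

/-- The simple session is happy: none of its fluid is stored, and the available bandwidth exceeds
its injection rate. -/
def Evolution.Happy (e : Evolution) (p : Params) (t : ℝ) : Prop :=
  ¬ e.Blocked p t ∧ e.injS t < e.available p t

/-- The simple session is stable: neither blocked nor happy. -/
def Evolution.Stable (e : Evolution) (p : Params) (t : ℝ) : Prop :=
  ¬ e.Blocked p t ∧ ¬ e.Happy p t

/-- The flow control of the simple session on `[0, T]`, with flow decrease function `φ`
(`φ ε t` for a fixed damping parameter) and maximal rate `εs`, starting at the maximal rate. The
flow increase function is arbitrary. Rates of departure matter only up to null sets of times, so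
being happy or stable during an interval is understood almost everywhere. -/
structure Evolution.FlowControl (e : Evolution) (p : Params) (φ : ℝ → ℝ → ℝ) (T : ℝ) :
    Prop where
  continuous : ContinuousOn e.injS (Icc 0 T)
  initial : e.injS 0 = p.εs
  range : ∀ t ∈ Icc 0 T, e.injS t ∈ Icc 0 p.εs
  /-- if the session becomes blocked at time `a` and stays blocked, its rate follows `φ` -/
  blocked : ∀ a b, 0 ≤ a → a < b → b ≤ T → ¬ e.Blocked p a →
    (∀ t ∈ Ioo a b, e.Blocked p t) → ∀ t ∈ Icc a b, e.injS t = φ (e.injS a) (t - a)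
  /-- the rate is constant while the session is stable -/
  stable : ∀ a b, 0 ≤ a → a < b → b ≤ T →
    (∀ᵐ t ∂(volume.restrict (Ioo a b)), e.Stable p t) → ∀ t ∈ Icc a b, e.injS t = e.injS a
  /-- the rate does not decrease while the session is happy -/
  happy : ∀ a b, 0 ≤ a → a < b → b ≤ T →
    (∀ᵐ t ∂(volume.restrict (Ioo a b)), e.Happy p t) → MonotoneOn e.injS (Icc a b)

/-- `e` is an evolution on `[0, T]` of the gadget with parameters `p` that starts with one unit of
fresh fluid in `Q₁`, the other servers empty, and the simple session at its maximal rate, where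
the injection rate of the horizontal session is `0`. -/
structure IsEvolution (p : Params) (φ : ℝ → ℝ → ℝ) (T : ℝ) (e : Evolution) : Prop where
  dep_nonneg : ∀ c ∈ p.classes, ∀ t ∈ Icc 0 T, 0 ≤ e.dep c t
  dep_integrable : ∀ c ∈ p.classes, IntervalIntegrable (e.dep c) volume 0 T
  injH_zero : ∀ t ∈ Icc 0 T, e.injH t = 0
  server : ∀ q, IsFIFOServer (p.classesAt q) (p.serviceRate q) (initialHeight q) T
    initialDensity e.arr e.dep (e.h q)
  control : e.FlowControl p φ T

/-- The course of events in one phase of the gadget. -/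
structure PhaseTable (p : Params) (T₁ T₂ T₃ TP : ℝ) (e : Evolution) : Prop where
  /-- `t = 0` -/
  start_height : ∀ q, e.h q 0 = initialHeight q
  start_stored : ∀ c ∈ p.classes, e.stored p c 0 = if c = some 0 then 1 else 0
  start_rate : e.injS 0 = p.εs
  /-- `t ∈ [0, T₁]` -/
  first₁ : StrictAntiOn (e.h 0) (Icc 0 T₁)
  first₂ : StrictMonoOn (e.h 1) (Icc 0 T₁)
  first₃ : StrictMonoOn (e.h 2) (Icc 0 T₁)
  first₄ : StrictMonoOn (e.h 3) (Icc 0 T₁)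
  /-- `t ∈ [T₁, T₂]` -/
  second₁ : ∀ t ∈ Icc T₁ T₂, e.h 0 t = 0
  second₂ : StrictAntiOn (e.h 1) (Icc T₁ T₂)
  second₃ : StrictMonoOn (e.h 2) (Icc T₁ T₂)
  second₄ : StrictMonoOn (e.h 3) (Icc T₁ T₂)
  /-- `t ∈ [T₂, T₃]` -/
  third₁ : ∀ t ∈ Icc T₂ T₃, e.h 0 t = 0
  third₂ : ∀ t ∈ Icc T₂ T₃, e.h 1 t = 0
  third₃ : StrictAntiOn (e.h 2) (Icc T₂ T₃)
  third₄ : StrictMonoOn (e.h 3) (Icc T₂ T₃)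
  rate_T₃ : p.εs / 2 ≤ e.injS T₃
  /-- `t ∈ [T₃, TP]` -/
  fourth₁ : ∀ t ∈ Icc T₃ TP, e.h 0 t = 0
  fourth₂ : ∀ t ∈ Icc T₃ TP, e.h 1 t = 0
  fourth₃ : ∀ t ∈ Icc T₃ TP, e.h 2 t = 0
  fourth₄ : ∀ t ∈ Icc T₃ TP, 1 ≤ e.h 3 t
  /-- `t = TP`: the only fluid is one unit of processed fluid, which has exactly its last stop
  (at `Q₄`) to go -/
  end_height : e.h 3 TP = 1
  end_stored : ∀ c ∈ p.classes, e.stored p c TP = if c = some (p.visits - 1) then 1 else 0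
  end_rate : e.injS TP = 0
  /-- arrival rate of the horizontal session at `Q₂` -/
  arrival₂_le : ∀ᵐ t ∂(volume.restrict (Ioo T₁ T₃)),
    ∑ c ∈ p.classesAt 1, e.arr c t ≤ 1 - p.μ₃
  arrival₂_zero : ∀ᵐ t ∂(volume.restrict (Ioo T₃ TP)),
    ∑ c ∈ p.classesAt 1, e.arr c t = 0

end BasicGadget

open BasicGadget

/-! Label horizontal fluid by its position `x`: the amount of horizontal fluid that reaches `Q₄`
before it, counting every visit. As the gadget holds one unit of it, positions `x` and `x + 1` are
consecutive visits of the same particle. Put `c = 1 - μ₃` and let the simple session inject at rate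
`g t = f δ ε t`. If `Q₃` does not run dry before time `K / c`, position `x ≤ K` reaches `Q₄` at `τ x
= x / c`. If `Q₄` is always busy, then by FIFO this position leaves at `η x = x + ∫ g` over `[0, τ
x]`. From position `K - 1` on, departing fluid returns directly to `Q₄`, so `τ (x + 1) = η x`. The
two rules for `τ K` agree exactly when `K - 1 + ∫ g = K / c`, the integral being over `[0, (K - 1) /
c]`. This is the balance equation. `exists_balance` solves it for `ε` by the intermediate value
theorem, with `δ` so slow that `g` hardly decreases in the relevant time; `exists_course` then
constructs `τ` and the cumulative arrivals `A = τ⁻¹` and departures `D = η⁻¹`.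

Until `K / c` we have `g ≥ ε / 2 > μ₃`, so `Q₄` receives more than it can serve, and horizontal
fluid gets a share below `c` of its output. The flow back to `Q₁` is therefore slower than each of
the first three servers: once empty, each of them stays empty, and its cumulative output is the
minimum of a line and `feed`. The times `T₁`, `T₂`, `T₃` are where the lines meet `feed`. Afterwards
the unit loops in `Q₄`; `K'` is taken so large that `g` has vanished one loop before the end, and
the last loop flushes out the simple session.

For an arbitrary evolution only integrated consequences of the server equations are used
(`conservation`, `total_departure_eq_min`). There is a circularity: the injection follows `g` only
while `Q₄` is busy, and `Q₄` is busy only if the injection is large and `Q₃` is fed through `Q₄`. It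
is broken by continuation in time (`early_main`) up to `T₃`, and by induction over the small loops
(`evolution_until`) after that. Existence is shown by `canonical`, whose rates are derivatives of
explicit cumulative flows. -/

namespace BasicGadget

/-! ### Cumulative flows and the arrival times at `Q₄` -/

/-- The amount injected up to time `t` at rate `g`. -/
noncomputable def cumul (g : ℝ → ℝ) (t : ℝ) : ℝ := ∫ s in (0 : ℝ)..t, g s

/-- The part of a cumulative flow `x` that belongs to the `k`-th unit of fluid. -/
noncomputable def level (k : ℕ) (x : ℝ) : ℝ := max 0 (min 1 (x - k))

/-- Turns a map from positions to times into a cumulative flow. Expansion of `φ` expresses that the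
flow has rate at most one. Working on all of `ℝ` avoids tracking domains. -/
theorem exists_monotone_inverse (φ : ℝ → ℝ) (hc : Continuous φ)
    (h : ∀ x y, x ≤ y → y - x ≤ φ y - φ x) :
    ∃ ψ : ℝ → ℝ, (∀ x, ψ (φ x) = x) ∧ (∀ t, φ (ψ t) = t) ∧
      (∀ s t, s ≤ t → 0 ≤ ψ t - ψ s) ∧ (∀ s t, s ≤ t → ψ t - ψ s ≤ t - s) := by
  have hm : StrictMono φ := fun x y hxy => by linarith [h x y hxy.le]
  have hs : Function.Surjective φ := by
    refine hc.surjective ?_ ?_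
    · refine Filter.tendsto_atTop_mono' _ ?_ (Filter.tendsto_atTop_add_const_left _ (φ 0) Filter.tendsto_id)
      filter_upwards [Filter.eventually_ge_atTop 0] with x hx
      have := h 0 x hx
      simp only [id]; linarith
    · refine Filter.tendsto_atBot_mono' _ ?_ (Filter.tendsto_atBot_add_const_left _ (φ 0) Filter.tendsto_id)
      filter_upwards [Filter.eventually_le_atBot 0] with x hx
      have := h x 0 hx
      simp only [id]; linarith
  choose ψ hψ using hs
  have hinv : ∀ x, ψ (φ x) = x := fun x => hm.injective (hψ _)
  have hmono : ∀ s t, s ≤ t → ψ s ≤ ψ t := fun s t hst => by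
    rw [← hm.le_iff_le, hψ, hψ]; exact hst
  refine ⟨ψ, hinv, hψ, fun s t hst => sub_nonneg.2 (hmono s t hst), fun s t hst => ?_⟩
  have := h _ _ (hmono s t hst)
  rwa [hψ, hψ] at this

/-- Arrival time at `Q₄` of the horizontal fluid at position `x`, for at most `n` small loops. -/
noncomputable def arrivalTime (K : ℕ) (c : ℝ) (g : ℝ → ℝ) : ℕ → ℝ → ℝ
  | 0, x => x / c
  -- Beyond `K`, position `x` is what left `Q₄` as position `x - 1`; `n` is fuel for this recursion.
  | n + 1, x => if x ≤ K then x / c else (x - 1) + cumul g (arrivalTime K c g n (x - 1))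

theorem cumul_zero (g : ℝ → ℝ) : cumul g 0 = 0 := by simp [cumul]

theorem cumul_sub {g : ℝ → ℝ} (hg : Continuous g) (s t : ℝ) :
    cumul g t - cumul g s = ∫ u in s..t, g u :=
  intervalIntegral.integral_interval_sub_left (hg.intervalIntegrable _ _) (hg.intervalIntegrable _ _)

theorem cumul_hasDerivAt {g : ℝ → ℝ} (hg : Continuous g) (t : ℝ) : HasDerivAt (cumul g) (g t) t :=
  intervalIntegral.integral_hasDerivAt_right (hg.intervalIntegrable _ _)
    hg.stronglyMeasurable.stronglyMeasurableAtFilter hg.continuousAt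

theorem cumul_continuous {g : ℝ → ℝ} (hg : Continuous g) : Continuous (cumul g) :=
  continuous_iff_continuousAt.2 fun t => (cumul_hasDerivAt hg t).continuousAt

theorem cumul_mono {g : ℝ → ℝ} (hg : Continuous g) (h0 : ∀ t, 0 ≤ g t) : Monotone (cumul g) := by
  intro s t hst
  have := cumul_sub hg s t
  have h2 : 0 ≤ ∫ u in s..t, g u := intervalIntegral.integral_nonneg hst fun u _ => h0 u
  linarith

/-- A lower bound for the rate gives a lower bound for the amount. -/
theorem le_cumul_sub {g : ℝ → ℝ} (hg : Continuous g) {s t m : ℝ} (hst : s ≤ t)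
    (h : ∀ u ∈ Icc s t, m ≤ g u) : m * (t - s) ≤ cumul g t - cumul g s := by
  rw [cumul_sub hg]
  have := intervalIntegral.integral_mono_on hst (f := fun _ => m) (g := g) (μ := volume)
    (by simp) (hg.intervalIntegrable _ _) h
  simpa [mul_comm] using this

theorem cumul_lt_of_pos {g : ℝ → ℝ} (hg : Continuous g)
    (h0 : ∀ t, 0 ≤ g t) {s t : ℝ} (hst : s < t) (hs : 0 < g s) : cumul g s < cumul g t := by
  rw [← sub_pos, cumul_sub hg]
  refine intervalIntegral.integral_pos hst hg.continuousOn (fun u _ => h0 u) ⟨s, by simp [hst.le], hs⟩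

theorem cumul_eq_of_antitone {g : ℝ → ℝ} (hg : Continuous g) (ha : Antitone g)
    (h0 : ∀ t, 0 ≤ g t) {s t : ℝ} (hst : s ≤ t) (hs : g s = 0) : cumul g s = cumul g t := by
  symm
  rw [← sub_eq_zero, cumul_sub hg]
  refine (intervalIntegral.integral_congr (g := fun _ => 0) fun u hu => ?_).trans (by simp)
  rw [uIcc_of_le hst] at hu
  exact le_antisymm (hs ▸ ha hu.1) (h0 u)

section arrivalTime

variable {K : ℕ} {c : ℝ} {g : ℝ → ℝ}

theorem arrivalTime_of_le (n : ℕ) {x : ℝ} (hx : x ≤ K) : arrivalTime K c g n x = x / c := by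
  cases n with
  | zero => rfl
  | succ n => simp [arrivalTime, hx]

/-- The balance equation `hbal` is the gluing condition of the two branches at `x = K`. -/
theorem arrivalTime_continuous (hg : Continuous g)
    (hbal : (K - 1 : ℝ) + cumul g ((K - 1 : ℝ) / c) = K / c) (n : ℕ) :
    Continuous (arrivalTime K c g n) := by
  induction n with
  | zero => exact continuous_id.div_const c
  | succ n ih =>
    refine Continuous.if_le (f := fun x : ℝ => x) (g := fun _ => (K : ℝ)) (by fun_prop) ?_
      continuous_id continuous_const ?_
    · exact (continuous_id.sub continuous_const).add
        ((cumul_continuous hg).comp (ih.comp (continuous_id.sub continuous_const)))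
    · intro x hx
      subst hx
      rw [arrivalTime_of_le n (by simp), hbal]

/-- Both branches have slope at least one: `1 / c ≥ 1`, and a shift by one followed by adding a
nondecreasing term. -/
theorem arrivalTime_expanding (hg : Continuous g) (h0 : ∀ t, 0 ≤ g t) (hc : 0 < c) (hc1 : c ≤ 1)
    (hbal : (K - 1 : ℝ) + cumul g ((K - 1 : ℝ) / c) = K / c) (n : ℕ) (x y : ℝ) (hxy : x ≤ y) :
    y - x ≤ arrivalTime K c g n y - arrivalTime K c g n x := by
  have key : ∀ x y : ℝ, x ≤ y → y - x ≤ y / c - x / c := fun x y hxy => by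
    rw [← sub_div, le_div_iff₀ hc]; nlinarith
  induction n generalizing x y with
  | zero => exact key x y hxy
  | succ n ih =>
    have key2 : ∀ x y : ℝ, x ≤ y → y - x ≤ (y - 1 + cumul g (arrivalTime K c g n (y - 1))) -
        (x - 1 + cumul g (arrivalTime K c g n (x - 1))) := fun x y hxy => by
      have h1 := ih (x - 1) (y - 1) (by linarith)
      have := cumul_mono hg h0 (show arrivalTime K c g n (x - 1) ≤ arrivalTime K c g n (y - 1) by
        linarith)
      linarith
    by_cases hy : y ≤ K
    · rw [arrivalTime_of_le _ hy, arrivalTime_of_le _ (hxy.trans hy)]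
      exact key x y hxy
    · by_cases hx : x ≤ K
      · have h1 := key x K hx
        have h2 := key2 K y (le_of_not_ge hy)
        rw [arrivalTime_of_le n (show (K : ℝ) - 1 ≤ K by linarith), hbal] at h2
        rw [arrivalTime_of_le _ hx]
        simp only [arrivalTime, hy, if_false]
        linarith
      · simp only [arrivalTime, hy, hx, if_false]
        exact key2 x y hxy

/-- Position `x ≤ K + n` needs at most `n` recursive calls, so more fuel changes nothing. -/
theorem arrivalTime_succ (n : ℕ) {x : ℝ} (hx : x ≤ K + n) :
    arrivalTime K c g (n + 1) x = arrivalTime K c g n x := by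
  induction n generalizing x with
  | zero => rw [arrivalTime_of_le _ (by simpa using hx), arrivalTime_of_le _ (by simpa using hx)]
  | succ n ih =>
    by_cases h : x ≤ K
    · rw [arrivalTime_of_le _ h, arrivalTime_of_le _ h]
    · have := ih (x := x - 1) (by push_cast at hx; linarith)
      simp only [arrivalTime, h, if_false] at this ⊢
      rw [this]

theorem arrivalTime_add_one (hbal : (K - 1 : ℝ) + cumul g ((K - 1 : ℝ) / c) = K / c) (n : ℕ)
    {x : ℝ} (h1 : K - 1 ≤ x) (h2 : x ≤ K + n - 1) :
    arrivalTime K c g n (x + 1) = x + cumul g (arrivalTime K c g n x) := by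
  rcases h1.eq_or_lt with h1 | h1
  · subst h1
    rw [arrivalTime_of_le _ (by linarith), arrivalTime_of_le _ (by linarith), hbal]
    simp
  · cases n with
    | zero => simp at h2; linarith
    | succ n =>
      have h3 : ¬ x + 1 ≤ K := by linarith
      rw [arrivalTime_succ n (x := x) (by push_cast at h2; linarith)]
      simp [arrivalTime, h3]

end arrivalTime

/-! ### The expected course of events -/

/-- The course of events: `g` is the injection rate of the simple session, horizontal fluid at
position `x` arrives at `Q₄` at time `τ x` and leaves it at time `x + cumul g (τ x)`; `A` and `D`
are the amounts of horizontal fluid that have arrived at and departed from `Q₄`. -/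
structure Course (K K' : ℕ) (c : ℝ) (g τ A D : ℝ → ℝ) : Prop where
  two_le : 2 ≤ K
  one_le : 1 ≤ K'
  c_pos : 0 < c
  c_lt : c < 1
  g_cont : Continuous g
  g_anti : Antitone g
  g_nonneg : ∀ t, 0 ≤ g t
  g_large : 1 - c < g (K / c)
  g_zero : g (τ (K + K' - 1)) = 0
  tau_lin : ∀ x : ℝ, x ≤ K → τ x = x / c
  tau_step : ∀ x : ℝ, K - 1 ≤ x → x ≤ K + K' - 1 → τ (x + 1) = x + cumul g (τ x)
  A_tau : ∀ x, A (τ x) = x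
  tau_A : ∀ t, τ (A t) = t
  A_mono : ∀ s t, s ≤ t → 0 ≤ A t - A s
  A_lip : ∀ s t, s ≤ t → A t - A s ≤ t - s
  D_eta : ∀ x, D (x + cumul g (τ x)) = x
  eta_D : ∀ t, D t + cumul g (τ (D t)) = t
  D_mono : ∀ s t, s ≤ t → 0 ≤ D t - D s
  D_lip : ∀ s t, s ≤ t → D t - D s ≤ t - s

theorem exists_course {K : ℕ} {c : ℝ} {g : ℝ → ℝ} (hK : 2 ≤ K) (hc : 0 < c) (hc1 : c < 1)
    (hg : Continuous g) (ha : Antitone g) (h0 : ∀ t, 0 ≤ g t) (hl : 1 - c < g (K / c))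
    (hz : ∃ t₀, ∀ t, t₀ ≤ t → g t = 0)
    (hbal : (K - 1 : ℝ) + cumul g ((K - 1 : ℝ) / c) = K / c) :
    ∃ K' τ A D, Course K K' c g τ A D := by
  obtain ⟨t₀, ht₀⟩ := hz
  obtain ⟨n, hn⟩ := exists_nat_ge t₀
  have hK0 : (2 : ℝ) ≤ K := by exact_mod_cast hK
  have hτc := arrivalTime_continuous hg hbal (n + 1)
  have hτe := arrivalTime_expanding hg h0 hc hc1.le hbal (n + 1)
  obtain ⟨A, hA1, hA2, hA3, hA4⟩ := exists_monotone_inverse _ hτc hτe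
  obtain ⟨D, hD1, hD2, hD3, hD4⟩ := exists_monotone_inverse
    (fun x => x + cumul g (arrivalTime K c g (n + 1) x))
    (continuous_id.add ((cumul_continuous hg).comp hτc)) (fun x y hxy => by
      have := cumul_mono hg h0 (show arrivalTime K c g (n + 1) x ≤ arrivalTime K c g (n + 1) y by
        linarith [hτe x y hxy])
      linarith)
  refine ⟨n + 1, arrivalTime K c g (n + 1), A, D, hK, by omega, hc, hc1, hg, ha, h0, hl, ?_,
    fun x hx => arrivalTime_of_le _ hx, fun x h1 h2 => arrivalTime_add_one hbal _ h1 h2,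
    hA1, hA2, hA3, hA4, hD1, hD2, hD3, hD4⟩
  -- Here `K' = n + 1`. Since `τ` expands and `τ 0 = 0`, we get `τ (K + K' - 1) ≥ K + n ≥ t₀`, when
  -- the injection is already extinct.
  refine ht₀ _ ?_
  have h1 := hτe 0 (K + (n + 1 : ℕ) - 1) (by push_cast; linarith)
  rw [arrivalTime_of_le (x := 0) _ (by linarith), zero_div] at h1
  push_cast at h1 ⊢
  linarith

/-- The amount of horizontal fluid that has entered `Q₁`, counting every visit. -/
noncomputable def feed (K : ℕ) (D : ℝ → ℝ) (t : ℝ) : ℝ := min (1 + D t) K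

namespace Course

variable {K K' : ℕ} {c : ℝ} {g τ A D : ℝ → ℝ}

theorem two_le_cast (C : Course K K' c g τ A D) : (2 : ℝ) ≤ K := by exact_mod_cast C.two_le

theorem one_le_cast (C : Course K K' c g τ A D) : (1 : ℝ) ≤ K' := by exact_mod_cast C.one_le

theorem tau_expanding (C : Course K K' c g τ A D) {x y : ℝ} (h : x ≤ y) : y - x ≤ τ y - τ x := by
  have hle : τ x ≤ τ y := by
    by_contra! hlt
    have := C.A_mono _ _ hlt.le
    rw [C.A_tau, C.A_tau] at this
    have : x = y := by linarith
    subst this; exact lt_irrefl _ hlt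
  have := C.A_lip _ _ hle
  rwa [C.A_tau, C.A_tau] at this

theorem tau_strictMono (C : Course K K' c g τ A D) : StrictMono τ := fun x y h => by
  linarith [C.tau_expanding h.le]

theorem tau_zero (C : Course K K' c g τ A D) : τ 0 = 0 := by
  rw [C.tau_lin 0 (by positivity), zero_div]

theorem A_zero (C : Course K K' c g τ A D) : A 0 = 0 := by
  have := C.A_tau 0
  rwa [C.tau_zero] at this

theorem D_zero (C : Course K K' c g τ A D) : D 0 = 0 := by
  have := C.D_eta 0
  rwa [C.tau_zero, cumul_zero, add_zero] at this

theorem D_nonneg (C : Course K K' c g τ A D) {t : ℝ} (ht : 0 ≤ t) : 0 ≤ D t := by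
  have := C.D_mono 0 t ht
  rw [C.D_zero] at this; linarith

theorem cumul_mono (C : Course K K' c g τ A D) : Monotone (cumul g) :=
  BasicGadget.cumul_mono C.g_cont C.g_nonneg

theorem T₃_pos (C : Course K K' c g τ A D) : 0 < (K : ℝ) / c := div_pos (by linarith [C.two_le_cast]) C.c_pos

/-- `Q₄` is overloaded until `K / c`: it gets `c` from `Q₃` and more than `1 - c` from the simple
session. -/
theorem lt_cumul_sub (C : Course K K' c g τ A D) {s t : ℝ} (hst : s < t) (ht : t ≤ K / c) :
    (1 - c) * (t - s) < cumul g t - cumul g s := by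
  have h1 := le_cumul_sub C.g_cont hst.le (m := g (K / c)) fun u hu => C.g_anti (hu.2.trans ht)
  have := mul_lt_mul_of_pos_right C.g_large (sub_pos.2 hst)
  linarith

theorem tau_K (C : Course K K' c g τ A D) : τ K = K / c := C.tau_lin _ le_rfl

theorem T₃_lt (C : Course K K' c g τ A D) : (K : ℝ) / c < τ (K + K') := by
  rw [← C.tau_K]
  exact C.tau_strictMono (by linarith [C.one_le_cast])

theorem TP_pos (C : Course K K' c g τ A D) : 0 < τ (K + K') := C.T₃_pos.trans C.T₃_lt

theorem D_tau (C : Course K K' c g τ A D) {x : ℝ} (h1 : K ≤ x) (h2 : x ≤ K + K') :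
    D (τ x) = x - 1 := by
  have := C.tau_step (x - 1) (by linarith) (by linarith)
  rw [sub_add_cancel] at this
  rw [this, C.D_eta]

/-- This is the balance equation in terms of `D`: the first `K - 1` loops end exactly when `Q₃` runs
empty. -/
theorem D_T₃ (C : Course K K' c g τ A D) : D (K / c) = K - 1 := by
  rw [← C.tau_K, C.D_tau le_rfl (by linarith [C.one_le_cast])]

theorem D_le_of_le (C : Course K K' c g τ A D) {t : ℝ} (ht : t ≤ K / c) : D t ≤ K - 1 := by
  have := C.D_mono _ _ ht
  rw [C.D_T₃] at this; linarith

theorem le_D_of_le (C : Course K K' c g τ A D) {t : ℝ} (ht : K / c ≤ t) : K - 1 ≤ D t := by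
  have := C.D_mono _ _ ht
  rw [C.D_T₃] at this; linarith

theorem eta_D_of_le (C : Course K K' c g τ A D) {t : ℝ} (ht : t ≤ K / c) :
    D t + cumul g (D t / c) = t := by
  have := C.eta_D t
  rwa [C.tau_lin _ (by linarith [C.D_le_of_le ht])] at this

theorem feed_of_le (C : Course K K' c g τ A D) {t : ℝ} (ht : t ≤ K / c) :
    feed K D t = 1 + D t := min_eq_left (by linarith [C.D_le_of_le ht])

theorem feed_of_ge (C : Course K K' c g τ A D) {t : ℝ} (ht : K / c ≤ t) :
    feed K D t = K := min_eq_right (by linarith [C.le_D_of_le ht])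

theorem feed_mono (C : Course K K' c g τ A D) : Monotone (feed K D) := fun s t h =>
  min_le_min (by linarith [C.D_mono s t h]) le_rfl

theorem feed_zero (C : Course K K' c g τ A D) : feed K D 0 = 1 := by
  rw [C.feed_of_le C.T₃_pos.le, C.D_zero, add_zero]

theorem one_le_feed (C : Course K K' c g τ A D) {t : ℝ} (ht : 0 ≤ t) : 1 ≤ feed K D t :=
  C.feed_zero ▸ C.feed_mono ht

/-- FIFO preserves the mixture: what leaves `Q₄` arrived in the ratio `c : g`, so its horizontal
share is `c / (c + g)`, which is below `c` as `c + g > 1`. -/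
theorem feed_sub_lt (C : Course K K' c g τ A D) {s t : ℝ} (hst : s < t) (ht : t ≤ K / c) :
    feed K D t - feed K D s < c * (t - s) := by
  have hs := hst.le.trans ht
  rw [C.feed_of_le ht, C.feed_of_le hs]
  have h1 := C.eta_D_of_le ht
  have h2 := C.eta_D_of_le hs
  have h3 := C.D_mono _ _ hst.le
  have hc := C.c_pos
  rcases h3.eq_or_lt with h | h
  · nlinarith
  · have hK : D t / c ≤ K / c := by gcongr; linarith [C.D_le_of_le ht]
    have := C.lt_cumul_sub (s := D s / c) (t := D t / c) (by gcongr; linarith) hK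
    have h4 : (1 - c) * (D t / c - D s / c) = (D t - D s) / c - (D t - D s) := by
      field_simp
    rw [h4] at this
    have h5 : (D t - D s) / c < t - s := by linarith
    rw [div_lt_iff₀ hc] at h5
    linarith

theorem feed_sub_le (C : Course K K' c g τ A D) {s t : ℝ} (hst : s ≤ t) :
    feed K D t - feed K D s ≤ c * (t - s) := by
  have hc := C.c_pos
  have key : ∀ s t, s ≤ t → t ≤ K / c → feed K D t - feed K D s ≤ c * (t - s) := by
    intro s t hst ht
    rcases hst.eq_or_lt with rfl | hst
    · simp
    · exact (C.feed_sub_lt hst ht).le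
  rcases le_total t (K / c) with ht | ht
  · exact key s t hst ht
  rcases le_total s (K / c) with hs | hs
  · have := key s _ hs le_rfl
    rw [C.feed_of_ge le_rfl] at this
    rw [C.feed_of_ge ht]
    nlinarith
  · rw [C.feed_of_ge ht, C.feed_of_ge hs]
    nlinarith

/-- `feed` equals `K` at time `K / c`, like the line, and grows no faster than it; hence it lies
above the line before. So `Q₃` is not starved before `K / c`. -/
theorem line_le_feed (C : Course K K' c g τ A D) {t : ℝ} (ht : t ≤ K / c) : c * t ≤ feed K D t := by
  have h1 := C.feed_sub_le ht
  rw [C.feed_of_ge le_rfl, mul_sub, mul_div_cancel₀ _ C.c_pos.ne'] at h1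
  linarith

theorem le_line (C : Course K K' c g τ A D) {t : ℝ} (ht : K / c ≤ t) : K ≤ c * t := by
  rwa [div_le_iff₀' C.c_pos] at ht

theorem min_line_feed (C : Course K K' c g τ A D) {t : ℝ} (ht : t ≤ K / c) :
    min (c * t) (feed K D t) = c * t := min_eq_left (C.line_le_feed ht)

theorem min_line_feed' (C : Course K K' c g τ A D) {t : ℝ} (ht : K / c ≤ t) :
    min (c * t) (feed K D t) = K := by
  rw [C.feed_of_ge ht]
  exact min_eq_right (C.le_line ht)

theorem A_of_le (C : Course K K' c g τ A D) {t : ℝ} (ht : t ≤ K / c) : A t = c * t := by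
  have h : c * t ≤ K := by rwa [le_div_iff₀' C.c_pos] at ht
  have := C.A_tau (c * t)
  rwa [C.tau_lin _ h, mul_div_cancel_left₀ _ C.c_pos.ne'] at this

theorem A_of_ge (C : Course K K' c g τ A D) {t : ℝ} (ht : K / c ≤ t) (ht' : t ≤ τ (K + K')) :
    A t = 1 + D t := by
  have h1 : K ≤ A t := by
    rw [← C.tau_strictMono.le_iff_le, C.tau_A, C.tau_K]; exact ht
  have h2 : A t ≤ K + K' := by
    rw [← C.tau_strictMono.le_iff_le, C.tau_A]; exact ht'
  have := C.D_tau h1 h2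
  rw [C.tau_A] at this
  linarith

theorem A_nonneg (C : Course K K' c g τ A D) {t : ℝ} (ht : 0 ≤ t) : 0 ≤ A t := by
  have := C.A_mono 0 t ht
  rw [C.A_zero] at this; linarith

theorem A_le (C : Course K K' c g τ A D) {t : ℝ} (ht : t ≤ τ (K + K')) : A t ≤ K + K' := by
  rw [← C.tau_strictMono.le_iff_le, C.tau_A]; exact ht

/-- Before `K / c` this is the overload of `Q₄`; after it, exactly one unit of horizontal fluid is
stored there. -/
theorem D_lt_A (C : Course K K' c g τ A D) {t : ℝ} (ht : 0 < t) (ht' : t ≤ τ (K + K')) :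
    D t < A t := by
  rcases le_total t (K / c) with h | h
  · rw [C.A_of_le h]
    have h1 := C.eta_D_of_le h
    have hc := C.c_pos
    rcases (C.D_nonneg ht.le).eq_or_lt with h0 | h0
    · rw [← h0]; positivity
    · have hK : D t / c ≤ K / c := by gcongr; linarith [C.D_le_of_le h]
      have := C.lt_cumul_sub (s := 0) (t := D t / c) (by positivity) hK
      rw [cumul_zero] at this
      have h4 : (1 - c) * (D t / c - 0) = D t / c - D t := by field_simp; ring
      rw [h4] at this
      rw [← div_lt_iff₀' hc]
      linarith
  · linarith [C.A_of_ge h ht']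

theorem tau_D_lt (C : Course K K' c g τ A D) {t : ℝ} (ht : 0 < t) (ht' : t ≤ τ (K + K')) :
    τ (D t) < t := by
  have := C.tau_strictMono (C.D_lt_A ht ht')
  rwa [C.tau_A] at this

/-- The height of `Q₄`. -/
theorem height₄_of_le (C : Course K K' c g τ A D) {t : ℝ} (ht : t ≤ K / c) :
    A t + cumul g t - t = cumul g t - (1 - c) * t := by
  rw [C.A_of_le ht]; ring

/-- The height is `A t - D t = 1` plus the stored simple fluid, the latter injected between `τ (D
t)` and `t`. -/
theorem one_le_height₄ (C : Course K K' c g τ A D) {t : ℝ} (ht : K / c ≤ t)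
    (ht' : t ≤ τ (K + K')) : 1 ≤ A t + cumul g t - t := by
  have h1 := C.eta_D t
  have h2 := C.A_of_ge ht ht'
  have h3 := C.cumul_mono (C.tau_D_lt (C.T₃_pos.trans_le ht) ht').le
  linarith

theorem height₄_pos (C : Course K K' c g τ A D) {t : ℝ} (ht : 0 < t) (ht' : t ≤ τ (K + K')) :
    0 < A t + cumul g t - t := by
  rcases le_total t (K / c) with h | h
  · have := C.lt_cumul_sub ht h
    rw [cumul_zero] at this
    rw [C.height₄_of_le h]; linarith
  · linarith [C.one_le_height₄ h ht']

theorem height₄_zero (C : Course K K' c g τ A D) : A 0 + cumul g 0 - 0 = 0 := by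
  rw [C.A_zero, cumul_zero]; simp

/-- Nothing is injected after `τ (K + K' - 1)`, and the last loop takes the fluid injected before
out of `Q₄`. -/
theorem height₄_TP (C : Course K K' c g τ A D) :
    A (τ (K + K')) + cumul g (τ (K + K')) - τ (K + K') = 1 := by
  have h1 := C.tau_step (K + K' - 1) (by linarith [C.one_le_cast]) (by linarith)
  rw [sub_add_cancel] at h1
  have h2 := cumul_eq_of_antitone C.g_cont C.g_anti C.g_nonneg
    (C.tau_strictMono.monotone (show (K + K' - 1 : ℝ) ≤ K + K' by linarith)) C.g_zero
  rw [C.A_tau]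
  linarith

theorem D_departure (C : Course K K' c g τ A D) (t : ℝ) : D (A t + cumul g t) = A t := by
  have := C.D_eta (A t)
  rwa [C.tau_A] at this

theorem g_TP (C : Course K K' c g τ A D) : g (τ (K + K')) = 0 := by
  have h := C.g_anti (C.tau_strictMono.monotone (show (K + K' - 1 : ℝ) ≤ K + K' by linarith))
  rw [C.g_zero] at h
  exact le_antisymm h (C.g_nonneg _)

theorem lipschitz_of_sub {φ : ℝ → ℝ} (h0 : ∀ s t, s ≤ t → 0 ≤ φ t - φ s)
    (h1 : ∀ s t, s ≤ t → φ t - φ s ≤ t - s) : LipschitzWith 1 φ := by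
  refine LipschitzWith.of_le_add fun x y => ?_
  rcases le_total x y with h | h
  · linarith [h0 _ _ h, dist_nonneg (x := x) (y := y)]
  · have := h1 _ _ h
    rw [Real.dist_eq]
    linarith [le_abs_self (x - y)]

theorem D_lipschitz (C : Course K K' c g τ A D) : LipschitzWith 1 D :=
  lipschitz_of_sub C.D_mono C.D_lip

theorem A_lipschitz (C : Course K K' c g τ A D) : LipschitzWith 1 A :=
  lipschitz_of_sub C.A_mono C.A_lip

theorem feed_continuous (C : Course K K' c g τ A D) : Continuous (feed K D) :=
  (continuous_const.add C.D_lipschitz.continuous).min continuous_const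

/-- A server of rate `c'` between `c` and `1` is busy up to some time before `K / c`. -/
theorem exists_crossing (C : Course K K' c g τ A D) {c' : ℝ} (hc : c < c') :
    ∃ T, 0 < T ∧ T < K / c ∧ feed K D T = c' * T ∧ (∀ t, t ≤ T → c' * t ≤ feed K D t) ∧
      ∀ t, T ≤ t → feed K D t ≤ c' * t := by
  have h3 := C.T₃_pos
  -- The difference is `1` at time `0` and `K - c' * (K / c) < 0` at `K / c`. Since `feed` has slope
  -- at most `c < c'`, the sign changes only once.
  obtain ⟨T, hT, hT0⟩ := intermediate_value_Icc' h3.le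
    (f := fun t => feed K D t - c' * t) (C.feed_continuous.sub (by fun_prop)).continuousOn
    (show (0 : ℝ) ∈ _ from ⟨by
      rw [C.feed_of_ge le_rfl]
      have : (K : ℝ) = c * (K / c) := by rw [mul_div_cancel₀ _ C.c_pos.ne']
      nlinarith, by rw [C.feed_zero]; simp⟩)
  have hT0 : feed K D T = c' * T := by linarith [show feed K D T - c' * T = 0 from hT0]
  refine ⟨T, hT.1.lt_of_ne ?_, hT.2.lt_of_ne ?_, hT0, fun t ht => ?_, fun t ht => ?_⟩
  · rintro rfl
    rw [C.feed_zero] at hT0; simp at hT0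
  · rintro rfl
    rw [C.feed_of_ge le_rfl] at hT0
    have : (K : ℝ) = c * (K / c) := by rw [mul_div_cancel₀ _ C.c_pos.ne']
    nlinarith
  · have := C.feed_sub_le ht
    nlinarith
  · have := C.feed_sub_le ht
    nlinarith

end Course

/-! ### Integrated laws of a single FIFO server -/

theorem cumul_sub_of_integrable {f : ℝ → ℝ} {T s t : ℝ} (hf : IntervalIntegrable f volume 0 T)
    (hs : s ∈ Icc 0 T) (ht : t ∈ Icc 0 T) : cumul f t - cumul f s = ∫ u in s..t, f u := by
  have h0 : (0 : ℝ) ∈ Icc 0 T := ⟨le_rfl, hs.1.trans hs.2⟩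
  exact intervalIntegral.integral_interval_sub_left
    (hf.mono_set (by rw [uIcc_of_le ht.1, uIcc_of_le h0.2]; exact Icc_subset_Icc_right ht.2))
    (hf.mono_set (by rw [uIcc_of_le hs.1, uIcc_of_le h0.2]; exact Icc_subset_Icc_right hs.2))

theorem intervalIntegrable_sub {f : ℝ → ℝ} {T s t : ℝ} (hf : IntervalIntegrable f volume 0 T)
    (hs : s ∈ Icc 0 T) (ht : t ∈ Icc 0 T) : IntervalIntegrable f volume s t := by
  refine hf.mono_set ?_
  rw [uIcc_of_le (hs.1.trans hs.2)]
  exact uIcc_subset_Icc hs ht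

theorem cumul_monotoneOn {f : ℝ → ℝ} {T : ℝ} (hf : IntervalIntegrable f volume 0 T)
    (h0 : ∀ t ∈ Icc 0 T, 0 ≤ f t) : MonotoneOn (cumul f) (Icc 0 T) := by
  intro s hs t ht hst
  rw [← sub_nonneg, cumul_sub_of_integrable hf hs ht]
  exact intervalIntegral.integral_nonneg hst fun u hu => h0 u ⟨hs.1.trans hu.1, hu.2.trans ht.2⟩

theorem cumul_nonneg {f : ℝ → ℝ} {T t : ℝ} (hf : IntervalIntegrable f volume 0 T)
    (h0 : ∀ t ∈ Icc 0 T, 0 ≤ f t) (ht : t ∈ Icc 0 T) : 0 ≤ cumul f t := by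
  have := cumul_monotoneOn hf h0 (left_mem_Icc.2 (ht.1.trans ht.2)) ht ht.1
  rwa [cumul_zero] at this

theorem cumul_continuousOn {f : ℝ → ℝ} {T : ℝ} (hT : 0 ≤ T)
    (hf : IntervalIntegrable f volume 0 T) : ContinuousOn (cumul f) (Icc 0 T) := by
  have := intervalIntegral.continuousOn_primitive_interval' (a := 0) hf (by simp)
  rwa [uIcc_of_le hT] at this

/-- Regularity of the data of a server. -/
structure IsServerData {ι : Type} (C : Finset ι) (μ x₀ T : ℝ) (ρ a d : ι → ℝ → ℝ) : Prop where
  T_nonneg : 0 ≤ T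
  μ_pos : 0 < μ
  x₀_nonneg : 0 ≤ x₀
  a_int : ∀ c ∈ C, IntervalIntegrable (a c) volume 0 T
  a_nonneg : ∀ c ∈ C, ∀ t ∈ Icc 0 T, 0 ≤ a c t
  d_int : ∀ c ∈ C, IntervalIntegrable (d c) volume 0 T
  d_nonneg : ∀ c ∈ C, ∀ t ∈ Icc 0 T, 0 ≤ d c t
  density : ∀ u, 0 ≤ u → u ≤ x₀ → ∑ c ∈ C, cumul (ρ c) u = μ * u
  density_mono : ∀ c ∈ C, ∀ u, 0 ≤ u → u ≤ x₀ → cumul (ρ c) u ≤ cumul (ρ c) x₀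

/-- Total cumulative flow of the classes in `C`. -/
noncomputable def total {ι : Type} (C : Finset ι) (a : ι → ℝ → ℝ) (t : ℝ) : ℝ :=
  ∑ c ∈ C, cumul (a c) t

theorem heightRate_measurable (μ : ℝ) : Measurable fun p : ℝ × ℝ => heightRate μ p.1 p.2 := by
  unfold heightRate
  refine Measurable.ite (measurableSet_lt measurable_const measurable_fst) (by fun_prop) (by fun_prop)

theorem le_heightRate (μ x a : ℝ) : a / μ - 1 ≤ heightRate μ x a := by
  unfold heightRate
  split_ifs
  · exact le_rfl
  · exact le_max_left _ _

theorem abs_heightRate_le (μ x a : ℝ) : |heightRate μ x a| ≤ |a / μ - 1| := by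
  unfold heightRate
  split_ifs
  · exact le_rfl
  · rw [abs_of_nonneg (le_max_right _ _)]
    exact max_le (le_abs_self _) (abs_nonneg _)

namespace IsFIFOServer

variable {ι : Type} {C : Finset ι} {μ x₀ T : ℝ} {ρ a d : ι → ℝ → ℝ} {h : ℝ → ℝ}

theorem total_int (hd : IsServerData C μ x₀ T ρ a d) :
    IntervalIntegrable (fun t => ∑ c ∈ C, a c t) volume 0 T := by
  have := IntervalIntegrable.sum C (f := a) (μ := volume) (a := 0) (b := T) fun c hc => hd.a_int c hc
  rwa [Finset.sum_fn] at this

theorem total_sub (hd : IsServerData C μ x₀ T ρ a d) {s t : ℝ} (hs : s ∈ Icc 0 T)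
    (ht : t ∈ Icc 0 T) : total C a t - total C a s = ∫ u in s..t, ∑ c ∈ C, a c u := by
  rw [intervalIntegral.integral_finsetSum fun c hc => intervalIntegrable_sub (hd.a_int c hc) hs ht]
  unfold total
  rw [← Finset.sum_sub_distrib]
  exact Finset.sum_congr rfl fun c hc => cumul_sub_of_integrable (hd.a_int c hc) hs ht

theorem rate_int (hS : IsFIFOServer C μ x₀ T ρ a d h) (hd : IsServerData C μ x₀ T ρ a d) :
    IntervalIntegrable (fun s => heightRate μ (h s) (∑ c ∈ C, a c s)) volume 0 T := by
  have hA := total_int hd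
  rw [intervalIntegrable_iff_integrableOn_Ioc_of_le hd.T_nonneg] at hA ⊢
  have hA2 : IntegrableOn (fun s => (∑ c ∈ C, a c s) / μ - 1) (Ioc 0 T) :=
    (hA.div_const μ).sub (integrable_const 1)
  refine Integrable.mono hA2 ?_ (Filter.Eventually.of_forall fun s => ?_)
  · have hh : AEMeasurable h (volume.restrict (Ioc 0 T)) :=
      (hS.continuous.mono Ioc_subset_Icc_self).aemeasurable measurableSet_Ioc
    exact ((heightRate_measurable μ).comp_aemeasurable
      (hh.prodMk hA.aestronglyMeasurable.aemeasurable)).aestronglyMeasurable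
  · simpa using abs_heightRate_le μ (h s) (∑ c ∈ C, a c s)

theorem height_zero (hS : IsFIFOServer C μ x₀ T ρ a d h) (hd : IsServerData C μ x₀ T ρ a d) :
    h 0 = x₀ := by
  have := hS.height 0 ⟨le_rfl, hd.T_nonneg⟩
  simpa using this

theorem height_sub (hS : IsFIFOServer C μ x₀ T ρ a d h) (hd : IsServerData C μ x₀ T ρ a d)
    {s t : ℝ} (hs : s ∈ Icc 0 T) (ht : t ∈ Icc 0 T) :
    h t - h s = ∫ u in s..t, heightRate μ (h u) (∑ c ∈ C, a c u) := by
  have := cumul_sub_of_integrable (hS.rate_int hd) hs ht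
  rw [← this, hS.height t ht, hS.height s hs]
  unfold cumul; ring

theorem integral_rate (hd : IsServerData C μ x₀ T ρ a d) {s t : ℝ} (hs : s ∈ Icc 0 T)
    (ht : t ∈ Icc 0 T) :
    ∫ u in s..t, ((∑ c ∈ C, a c u) / μ - 1) = (total C a t - total C a s) / μ - (t - s) := by
  rw [total_sub hd hs ht, intervalIntegral.integral_sub
    ((intervalIntegrable_sub (total_int hd) hs ht).div_const μ) (by simp),
    intervalIntegral.integral_div]
  simp

/-- The truncation at an empty server only increases the rate, so this holds whether or not the
server is busy. -/
theorem le_height_sub (hS : IsFIFOServer C μ x₀ T ρ a d h) (hd : IsServerData C μ x₀ T ρ a d)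
    {s t : ℝ} (hs : s ∈ Icc 0 T) (ht : t ∈ Icc 0 T) (hst : s ≤ t) :
    (total C a t - total C a s) / μ - (t - s) ≤ h t - h s := by
  rw [hS.height_sub hd hs ht, ← integral_rate hd hs ht]
  refine intervalIntegral.integral_mono_on hst
    (((intervalIntegrable_sub (total_int hd) hs ht).div_const μ).sub (by simp))
    (intervalIntegrable_sub (hS.rate_int hd) hs ht) fun u _ => le_heightRate _ _ _

theorem height_sub_of_pos (hS : IsFIFOServer C μ x₀ T ρ a d h) (hd : IsServerData C μ x₀ T ρ a d)
    {s t : ℝ} (hs : s ∈ Icc 0 T) (ht : t ∈ Icc 0 T) (hst : s ≤ t) (hp : ∀ u ∈ Ioo s t, 0 < h u) :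
    h t - h s = (total C a t - total C a s) / μ - (t - s) := by
  rw [hS.height_sub hd hs ht, ← integral_rate hd hs ht]
  refine intervalIntegral.integral_congr_ae ?_
  have : ∀ᵐ u : ℝ, u ≠ t := by simp [ae_iff, measure_singleton]
  filter_upwards [this] with u hu hmem
  rw [uIoc_of_le hst] at hmem
  simp [heightRate, hp u ⟨hmem.1, hmem.2.lt_of_ne hu⟩]

theorem total_mono (hd : IsServerData C μ x₀ T ρ a d) : MonotoneOn (total C a) (Icc 0 T) :=
  fun _ hs _ ht hst => Finset.sum_le_sum fun c hc =>
    cumul_monotoneOn (hd.a_int c hc) (hd.a_nonneg c hc) hs ht hst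

/-- The height never falls faster than at rate one, since arrivals are nonnegative. -/
theorem departure_mono (hS : IsFIFOServer C μ x₀ T ρ a d h) (hd : IsServerData C μ x₀ T ρ a d)
    {s t : ℝ} (hs : s ∈ Icc 0 T) (ht : t ∈ Icc 0 T) (hst : s ≤ t) : s + h s ≤ t + h t := by
  have h1 := hS.le_height_sub hd hs ht hst
  have h2 : 0 ≤ (total C a t - total C a s) / μ :=
    div_nonneg (sub_nonneg.2 (total_mono hd hs ht hst)) hd.μ_pos.le
  linarith

theorem exists_arrival (hS : IsFIFOServer C μ x₀ T ρ a d h) (hd : IsServerData C μ x₀ T ρ a d)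
    {u : ℝ} (hu : u ∈ Icc 0 T) (hx : x₀ ≤ u) : ∃ s ∈ Icc 0 u, s + h s = u := by
  have hc : ContinuousOn (fun s => s + h s) (Icc 0 u) :=
    continuousOn_id.add (hS.continuous.mono (Icc_subset_Icc_right hu.2))
  obtain ⟨s, hs, hs'⟩ := intermediate_value_Icc hu.1 hc (show u ∈ _ from
    ⟨by simpa [hS.height_zero hd] using hx, by simpa using hS.nonneg u hu⟩)
  exact ⟨s, hs, hs'⟩

/-- First in, first out: the fluid that leaves by time `u` is what arrived by time `s`. -/
theorem cumul_departure (hS : IsFIFOServer C μ x₀ T ρ a d h) {c : ι} (hc : c ∈ C) {s : ℝ}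
    (hs : s ∈ Icc 0 T) (hu : s + h s ≤ T) :
    cumul (d c) (s + h s) = cumul (ρ c) x₀ + cumul (a c) s := hS.fifo c hc s hs hu

theorem total_departure (hS : IsFIFOServer C μ x₀ T ρ a d h) (hd : IsServerData C μ x₀ T ρ a d)
    {s : ℝ} (hs : s ∈ Icc 0 T) (hu : s + h s ≤ T) :
    total C d (s + h s) = μ * x₀ + total C a s := by
  rw [← hd.density x₀ hd.x₀_nonneg le_rfl]
  unfold total
  rw [← Finset.sum_add_distrib]
  exact Finset.sum_congr rfl fun c hc => hS.cumul_departure hc hs hu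

theorem total_initial (hS : IsFIFOServer C μ x₀ T ρ a d h) (hd : IsServerData C μ x₀ T ρ a d)
    {t : ℝ} (ht : t ∈ Icc 0 T) (hx : t ≤ x₀) : total C d t = μ * t := by
  rw [← hd.density t ht.1 hx]
  exact Finset.sum_congr rfl fun c hc => hS.initial c hc t ht hx

/-- Conservation of fluid. -/
theorem conservation (hS : IsFIFOServer C μ x₀ T ρ a d h) (hd : IsServerData C μ x₀ T ρ a d)
    {t : ℝ} (ht : t ∈ Icc 0 T) : μ * h t = μ * x₀ + total C a t - total C d t := by
  have hμ := hd.μ_pos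
  have h0 : (0 : ℝ) ∈ Icc 0 T := ⟨le_rfl, hd.T_nonneg⟩
  have ha0 : total C a 0 = 0 := by simp [total, cumul_zero]
  rcases le_total t x₀ with hx | hx
  · have hp : ∀ u ∈ Ioo 0 t, 0 < h u := fun u hu => by
      have := hS.departure_mono hd h0 ⟨hu.1.le, hu.2.le.trans ht.2⟩ hu.1.le
      rw [hS.height_zero hd] at this
      linarith [hu.2]
    have := hS.height_sub_of_pos hd h0 ht ht.1 hp
    rw [hS.height_zero hd, ha0] at this
    rw [hS.total_initial hd ht hx, eq_add_of_sub_eq this]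
    field_simp
    ring
  -- If `s` is the arrival time of the fluid that leaves at `t`, then the server is busy on `(s,
  -- t)`, because fluid arriving there leaves no earlier than `t`. So the height equation has no
  -- truncation there.
  · obtain ⟨s, hs, hst⟩ := hS.exists_arrival hd ht hx
    have hsT : s ∈ Icc 0 T := ⟨hs.1, hs.2.trans ht.2⟩
    have hp : ∀ u ∈ Ioo s t, 0 < h u := fun u hu => by
      have := hS.departure_mono hd hsT ⟨hs.1.trans hu.1.le, hu.2.le.trans ht.2⟩ hu.1.le
      linarith [hu.2]
    have := hS.height_sub_of_pos hd hsT ht hs.2 hp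
    have h2 := hS.total_departure hd hsT (hst.le.trans ht.2)
    rw [hst] at h2
    rw [h2, show h t = (total C a t - total C a s) / μ by linarith]
    field_simp
    ring

theorem total_departure_sub_le (hS : IsFIFOServer C μ x₀ T ρ a d h)
    (hd : IsServerData C μ x₀ T ρ a d) {s t : ℝ} (hs : s ∈ Icc 0 T) (ht : t ∈ Icc 0 T)
    (hst : s ≤ t) : total C d t - total C d s ≤ μ * (t - s) := by
  have h1 := hS.le_height_sub hd hs ht hst
  have h2 := hS.conservation hd hs
  have h3 := hS.conservation hd ht
  have hμ := hd.μ_pos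
  have h4 : μ * ((total C a t - total C a s) / μ - (t - s)) ≤ μ * (h t - h s) := by gcongr
  have h5 : μ * ((total C a t - total C a s) / μ - (t - s)) =
    (total C a t - total C a s) - μ * (t - s) := by field_simp
  linarith

theorem total_departure_le (hS : IsFIFOServer C μ x₀ T ρ a d h)
    (hd : IsServerData C μ x₀ T ρ a d) {t : ℝ} (ht : t ∈ Icc 0 T) : total C d t ≤ μ * t := by
  have := hS.total_departure_sub_le hd ⟨le_rfl, hd.T_nonneg⟩ ht ht.1
  simpa [total, cumul_zero] using this

theorem total_departure_of_pos (hS : IsFIFOServer C μ x₀ T ρ a d h)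
    (hd : IsServerData C μ x₀ T ρ a d) {s t : ℝ} (hs : s ∈ Icc 0 T) (ht : t ∈ Icc 0 T)
    (hst : s ≤ t) (hp : ∀ u ∈ Ioo s t, 0 < h u) :
    total C d t - total C d s = μ * (t - s) := by
  have h1 := hS.height_sub_of_pos hd hs ht hst hp
  have h2 := hS.conservation hd hs
  have h3 := hS.conservation hd ht
  have hμ := hd.μ_pos
  have h5 : μ * (h t - h s) = (total C a t - total C a s) - μ * (t - s) := by
    rw [h1]; field_simp
  linarith

/-- Either the server has always been busy, or it was empty at some time `s` and busy since. -/
theorem total_departure_cases (hS : IsFIFOServer C μ x₀ T ρ a d h)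
    (hd : IsServerData C μ x₀ T ρ a d) {t : ℝ} (ht : t ∈ Icc 0 T) :
    total C d t = μ * t ∨
      ∃ s ∈ Icc 0 t, total C d t = μ * x₀ + total C a s + μ * (t - s) := by
  have h0 : (0 : ℝ) ∈ Icc 0 T := ⟨le_rfl, hd.T_nonneg⟩
  by_cases hz : ∃ s ∈ Icc 0 t, h s = 0
  · right
    have hcpt : IsCompact {s ∈ Icc 0 t | h s = 0} := by
      have hcl : IsClosed (Icc 0 t ∩ h ⁻¹' {0}) :=
        (hS.continuous.mono (Icc_subset_Icc_right ht.2)).preimage_isClosed_of_isClosed isClosed_Icc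
          isClosed_singleton
      exact isCompact_Icc.of_isClosed_subset hcl inter_subset_left
    obtain ⟨s, ⟨hs, hs0⟩, hmax⟩ := hcpt.exists_isGreatest hz
    have hsT : s ∈ Icc 0 T := ⟨hs.1, hs.2.trans ht.2⟩
    refine ⟨s, hs, ?_⟩
    have := hS.total_departure_of_pos hd hsT ht hs.2 fun u hu => by
      have hu' : u ∈ Icc 0 t := ⟨hs.1.trans hu.1.le, hu.2.le⟩
      refine (hS.nonneg u ⟨hu'.1, hu'.2.trans ht.2⟩).lt_of_ne' fun h' => ?_
      exact absurd (hmax ⟨hu', h'⟩) (not_le.2 hu.1)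
    have h2 := hS.conservation hd hsT
    rw [hs0, mul_zero] at h2
    linarith
  · left
    push Not at hz
    have := hS.total_departure_of_pos hd h0 ht ht.1 fun u hu =>
      (hS.nonneg u ⟨hu.1.le, hu.2.le.trans ht.2⟩).lt_of_ne' (hz u ⟨hu.1.le, hu.2.le⟩)
    simpa [total, cumul_zero] using this

/-- A lower bound by a line of slope `m ≤ μ` passes from input to output: up to the last empty time
the output equals the input, and then it has slope `μ`. -/
theorem le_total_departure (hS : IsFIFOServer C μ x₀ T ρ a d h)
    (hd : IsServerData C μ x₀ T ρ a d) {t m : ℝ} (ht : t ∈ Icc 0 T) (hm : m ≤ μ)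
    (hI : ∀ s ∈ Icc 0 t, m * s ≤ μ * x₀ + total C a s) : m * t ≤ total C d t := by
  rcases hS.total_departure_cases hd ht with h1 | ⟨s, hs, h1⟩
  · rw [h1]; nlinarith [ht.1]
  · rw [h1]; nlinarith [hI s hs, hs.2]

theorem total_departure_le_arrival (hS : IsFIFOServer C μ x₀ T ρ a d h)
    (hd : IsServerData C μ x₀ T ρ a d) {t : ℝ} (ht : t ∈ Icc 0 T) :
    total C d t ≤ μ * x₀ + total C a t := by
  have h1 := hS.conservation hd ht
  have h2 := mul_nonneg hd.μ_pos.le (hS.nonneg t ht)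
  linarith

/-- The output of a server whose input follows a slow flow `F` once the server is empty. -/
theorem total_departure_eq_min (hS : IsFIFOServer C μ x₀ T ρ a d h)
    (hd : IsServerData C μ x₀ T ρ a d) {F : ℝ → ℝ} {t : ℝ} (ht : t ∈ Icc 0 T)
    (hF : ∀ s ∈ Icc 0 t, F t - F s ≤ μ * (t - s))
    (hle : ∀ s ∈ Icc 0 t, μ * x₀ + total C a s ≤ F s)
    (heq : ∀ s ∈ Icc 0 t, μ * x₀ + total C a s < μ * s → μ * x₀ + total C a s = F s) :
    total C d t = min (μ * t) (F t) := by
  have htt : t ∈ Icc 0 t := ⟨ht.1, le_rfl⟩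
  have h1 := hS.total_departure_le hd ht
  have h2 := hS.total_departure_le_arrival hd ht
  refine le_antisymm (le_min h1 (h2.trans (hle t htt))) ?_
  rcases hS.total_departure_cases hd ht with h3 | ⟨s, hs, h3⟩
  · rw [h3]; exact min_le_left _ _
  · rw [h3]
    -- If the input at the last empty time is on or above the line `μ s`, full service since then
    -- already gives `μ t`; this is why `heq` is needed only below the line.
    by_cases hc : μ * x₀ + total C a s < μ * s
    · rw [heq s hs hc]
      exact (min_le_right _ _).trans (by linarith [hF s hs])
    · exact (min_le_left _ _).trans (by linarith)

/-- No class departs in excess of what was there. -/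
theorem cumul_departure_le (hS : IsFIFOServer C μ x₀ T ρ a d h)
    (hd : IsServerData C μ x₀ T ρ a d) {c : ι} (hc : c ∈ C) {t : ℝ} (ht : t ∈ Icc 0 T) :
    cumul (d c) t ≤ cumul (ρ c) x₀ + cumul (a c) t := by
  rcases le_total t x₀ with hx | hx
  · have h1 : cumul (d c) t = cumul (ρ c) t := hS.initial c hc t ht hx
    linarith [hd.density_mono c hc t ht.1 hx, cumul_nonneg (hd.a_int c hc) (hd.a_nonneg c hc) ht]
  · obtain ⟨s, hs, hst⟩ := hS.exists_arrival hd ht hx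
    have hsT : s ∈ Icc 0 T := ⟨hs.1, hs.2.trans ht.2⟩
    have h2 := hS.cumul_departure hc hsT (hst.le.trans ht.2)
    rw [hst] at h2
    linarith [cumul_monotoneOn (hd.a_int c hc) (hd.a_nonneg c hc) hsT ht hs.2]

end IsFIFOServer

/-! ### Stops of the path and classes at each server -/

/-- The visit of the horizontal path at which fluid passes `Q₄` for the `m`-th time. -/
def visit (K m : ℕ) : ℕ := if m < K then 4 * m + 3 else 3 * K + m

theorem mem_classes (p : Params) (j : ℕ) : some j ∈ p.classes ↔ j < p.visits := by
  simp [Params.classes]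

theorem mem_classesAt (p : Params) (q : Fin 4) (j : ℕ) :
    some j ∈ p.classesAt q ↔
      j < 4 * p.K + p.K' ∧ (if j < 4 * p.K then Fin.ofNat 4 j else 3) = q := by
  rw [Params.classesAt, Finset.mem_filter, mem_classes]
  rfl

theorem none_mem_classesAt (p : Params) : none ∈ p.classesAt 3 := by
  simp [Params.classesAt, Params.classes, Params.serverOf]

theorem mem_classesAt_serverOf (p : Params) {j : ℕ} (hj : j < p.visits) :
    some j ∈ p.classesAt (p.serverOf (some j)) := by
  simp [Params.classesAt, mem_classes, hj]

theorem serverOf_visit (p : Params) (m : ℕ) : p.serverOf (some (visit p.K m)) = 3 := by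
  unfold Params.serverOf visit
  dsimp only
  split_ifs with h1 h2 h3
  · ext; simp
  · rfl
  · omega
  · rfl

theorem serverOf_add_four (p : Params) {j : ℕ} (hj : j + 4 < 4 * p.K) :
    p.serverOf (some (j + 4)) = p.serverOf (some j) := by
  unfold Params.serverOf
  dsimp only
  rw [if_pos hj, if_pos (by omega)]
  ext; simp

theorem sum_classesAt_of_lt (p : Params) (q : Fin 4) (hq : q < 3) (φ : Option ℕ → ℝ) :
    ∑ c ∈ p.classesAt q, φ c = ∑ k ∈ Finset.range p.K, φ (some (4 * k + q)) := by
  have : p.classesAt q = (Finset.range p.K).image fun k => some (4 * k + (q : ℕ)) := by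
    ext c
    have hq' : (q : ℕ) < 3 := hq
    rcases c with _ | j
    · have : (3 : Fin 4) ≠ q := fun h => by rw [← h] at hq; exact absurd hq (lt_irrefl _)
      simp [Params.classesAt, Params.serverOf, this]
    · simp only [mem_classesAt, Finset.mem_image, Finset.mem_range, Option.some.injEq]
      constructor
      · rintro ⟨h1, h2⟩
        split_ifs at h2 with h3
        · have h4 := congrArg Fin.val h2
          rw [Fin.val_ofNat] at h4
          exact ⟨j / 4, by omega, by omega⟩
        · rw [← h2] at hq'; simp at hq'
      · rintro ⟨k, hk, rfl⟩
        refine ⟨by omega, ?_⟩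
        rw [if_pos (by omega)]
        ext
        rw [Fin.val_ofNat]; omega
  rw [this, Finset.sum_image]
  intro a _ b _ hab
  simpa using hab

theorem classesAt_three (p : Params) :
    (p.classesAt 3).erase none =
      (Finset.range (p.K + p.K')).image fun m => some (visit p.K m) := by
  ext c
  rcases c with _ | j
  · simp
  · simp only [mem_classesAt, Finset.mem_erase, Finset.mem_image, Finset.mem_range,
      Option.some.injEq]
    constructor
    · rintro ⟨-, h1, h2⟩
      split_ifs at h2 with h3
      · have h4 := congrArg Fin.val h2
        rw [Fin.val_ofNat] at h4
        refine ⟨j / 4, by omega, ?_⟩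
        unfold visit
        have : j % 4 = 3 := h4
        split_ifs <;> omega
      · refine ⟨j - 3 * p.K, by omega, ?_⟩
        unfold visit
        split_ifs <;> omega
    · rintro ⟨m, hm, rfl⟩
      refine ⟨by simp, ?_, serverOf_visit p m⟩
      unfold visit
      split_ifs <;> omega

theorem visit_injective (K : ℕ) : Function.Injective (visit K) := by
  intro a b hab
  unfold visit at hab
  split_ifs at hab <;> omega

theorem sum_classesAt_erase (p : Params) (φ : Option ℕ → ℝ) :
    ∑ c ∈ (p.classesAt 3).erase none, φ c
      = ∑ m ∈ Finset.range (p.K + p.K'), φ (some (visit p.K m)) := by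
  rw [classesAt_three, Finset.sum_image]
  intro a _ b _ hab
  exact visit_injective _ (by simpa using hab)

theorem sum_classesAt_three (p : Params) (φ : Option ℕ → ℝ) :
    ∑ c ∈ p.classesAt 3, φ c
      = φ none + ∑ m ∈ Finset.range (p.K + p.K'), φ (some (visit p.K m)) := by
  rw [← sum_classesAt_erase, Finset.add_sum_erase _ _ (none_mem_classesAt p)]

/-! ### Arbitrary evolutions: order of the fluid along the path -/

/-- The parameters of the gadget fit together with a course of events. -/
structure Setting (p : Params) (φ : ℝ → ℝ → ℝ) (g τ A D : ℝ → ℝ) : Prop where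
  course : Course p.K p.K' (1 - p.μ₃) g τ A D
  μ₂_pos : 0 < p.μ₂
  μ₂_lt : p.μ₂ < p.μ₃
  g_eq : ∀ t, 0 ≤ t → g t = φ p.εs t
  φ_le : ∀ x, 0 ≤ x → ∀ t, 0 ≤ t → φ x t ≤ x
  g_zero : g 0 = p.εs
  rate : p.εs / 2 ≤ g (p.K / (1 - p.μ₃))

theorem cumul_initialDensity (c : Option ℕ) (u : ℝ) :
    cumul (initialDensity c) u = if c = some 0 then u else 0 := by
  unfold cumul initialDensity
  split_ifs <;> simp

theorem initialHeight_nonneg (q : Fin 4) : 0 ≤ initialHeight q := by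
  fin_cases q <;> simp [initialHeight]

theorem initialHeight_pos {q : Fin 4} (h : q ≠ 0) : initialHeight q = 0 := by
  fin_cases q <;> simp [initialHeight] at h ⊢

namespace Setting

variable {p : Params} {φ : ℝ → ℝ → ℝ} {g τ A D : ℝ → ℝ} {e : Evolution}

theorem serviceRate_pos (S : Setting p φ g τ A D) (q : Fin 4) : 0 < p.serviceRate q := by
  have h1 := S.course.c_pos
  have h2 := S.μ₂_lt
  fin_cases q <;> simp [Params.serviceRate] <;> linarith

theorem dep_int (E : IsEvolution p φ (τ (p.K + p.K')) e) {j : ℕ} (hj : j < p.visits) :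
    IntervalIntegrable (e.dep (some j)) volume 0 (τ (p.K + p.K')) :=
  E.dep_integrable _ ((mem_classes p j).2 hj)

theorem dep_nonneg (E : IsEvolution p φ (τ (p.K + p.K')) e) {j : ℕ} (hj : j < p.visits) :
    ∀ t ∈ Icc 0 (τ (p.K + p.K')), 0 ≤ e.dep (some j) t :=
  E.dep_nonneg _ ((mem_classes p j).2 hj)

theorem injS_int (S : Setting p φ g τ A D) (E : IsEvolution p φ (τ (p.K + p.K')) e) :
    IntervalIntegrable e.injS volume 0 (τ (p.K + p.K')) := by
  refine ContinuousOn.intervalIntegrable ?_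
  rw [uIcc_of_le S.course.TP_pos.le]
  exact E.control.continuous

theorem serverData (S : Setting p φ g τ A D) (E : IsEvolution p φ (τ (p.K + p.K')) e)
    (q : Fin 4) : IsServerData (p.classesAt q) (p.serviceRate q) (initialHeight q)
      (τ (p.K + p.K')) initialDensity e.arr e.dep := by
  have hT := S.course.TP_pos.le
  have hsub : ∀ c ∈ p.classesAt q, c ∈ p.classes := fun c hc => (Finset.mem_filter.1 hc).1
  refine ⟨hT, S.serviceRate_pos q, initialHeight_nonneg q, fun c hc => ?_, fun c hc t ht => ?_,
    fun c hc => E.dep_integrable c (hsub c hc), fun c hc => E.dep_nonneg c (hsub c hc),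
    fun u h0 hu => ?_, fun c _ u h0 hu => ?_⟩
  · rcases c with _ | _ | j
    · exact S.injS_int E
    · refine (intervalIntegrable_const (c := (0 : ℝ))).congr fun t ht => ?_
      rw [uIoc_of_le hT] at ht
      exact (E.injH_zero t (Ioc_subset_Icc_self ht)).symm
    · have := (mem_classes p _).1 (hsub _ hc)
      exact dep_int E (by omega)
  · rcases c with _ | _ | j
    · exact (E.control.range t ht).1
    · exact (E.injH_zero t ht).ge
    · have := (mem_classes p _).1 (hsub _ hc)
      exact dep_nonneg E (by omega) t ht
  · by_cases hq : q = 0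
    · subst hq
      rw [sum_classesAt_of_lt p 0 (by decide)]
      simp only [cumul_initialDensity]
      rw [Finset.sum_eq_single_of_mem 0 (by simp; linarith [S.course.two_le])]
      · simp [Params.serviceRate]
      · intro k _ hk
        simp [hk]
    · rw [initialHeight_pos hq] at hu
      obtain rfl : u = 0 := le_antisymm hu h0
      simp [cumul_zero]
  · simp only [cumul_initialDensity]
    split_ifs
    · exact hu
    · exact le_rfl

theorem mono_dep (E : IsEvolution p φ (τ (p.K + p.K')) e) {j : ℕ} (hj : j < p.visits) :
    MonotoneOn (cumul (e.dep (some j))) (Icc 0 (τ (p.K + p.K'))) :=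
  cumul_monotoneOn (dep_int E hj) (dep_nonneg E hj)

theorem dep_nonneg' (E : IsEvolution p φ (τ (p.K + p.K')) e) {j : ℕ} (hj : j < p.visits) {t : ℝ} (ht : t ∈ Icc 0 (τ (p.K + p.K'))) :
    0 ≤ cumul (e.dep (some j)) t :=
  cumul_nonneg (dep_int E hj) (dep_nonneg E hj) ht

theorem cumul_injH (E : IsEvolution p φ (τ (p.K + p.K')) e) {t : ℝ} (ht : t ∈ Icc 0 (τ (p.K + p.K'))) : cumul (e.arr (some 0)) t = 0 := by
  unfold cumul
  refine (intervalIntegral.integral_congr (g := fun _ => 0) fun u hu => ?_).trans (by simp)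
  rw [uIcc_of_le ht.1] at hu
  exact E.injH_zero u ⟨hu.1, hu.2.trans ht.2⟩

variable (S : Setting p φ g τ A D) (E : IsEvolution p φ (τ (p.K + p.K')) e)
include S E

/-- Fluid passes the stops of its path one after the other. -/
theorem dep_succ_le {j : ℕ} (hj : j + 1 < p.visits) {t : ℝ} (ht : t ∈ Icc 0 (τ (p.K + p.K'))) :
    cumul (e.dep (some (j + 1))) t ≤ cumul (e.dep (some j)) t := by
  have := (E.server _).cumul_departure_le (S.serverData E _) (mem_classesAt_serverOf p hj) ht
  rw [cumul_initialDensity] at this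
  simpa [Evolution.arr] using this

theorem dep_zero_le {t : ℝ} (ht : t ∈ Icc 0 (τ (p.K + p.K'))) :
    cumul (e.dep (some 0)) t ≤ 1 := by
  have h0 : 0 < p.visits := by have := S.course.two_le; unfold Params.visits; omega
  have := (E.server _).cumul_departure_le (S.serverData E _) (mem_classesAt_serverOf p h0) ht
  rw [cumul_initialDensity, cumul_injH E ht] at this
  have h2 : initialHeight (p.serverOf (some 0)) = 1 := by
    have h3 : p.serverOf (some 0) = 0 := by
      unfold Params.serverOf
      dsimp only
      rw [if_pos (by have := S.course.two_le; omega)]; rfl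
    rw [h3]; rfl
  simpa [h2] using this

theorem dep_antitone {i j : ℕ} (hij : i ≤ j) (hj : j < p.visits) {t : ℝ}
    (ht : t ∈ Icc 0 (τ (p.K + p.K'))) :
    cumul (e.dep (some j)) t ≤ cumul (e.dep (some i)) t := by
  induction j, hij using Nat.le_induction with
  | base => exact le_rfl
  | succ k _ ih => exact (S.dep_succ_le E hj ht).trans (ih (by omega))

theorem dep_le_one {j : ℕ} (hj : j < p.visits) {t : ℝ} (ht : t ∈ Icc 0 (τ (p.K + p.K'))) :
    cumul (e.dep (some j)) t ≤ 1 :=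
  (S.dep_antitone E (Nat.zero_le j) hj ht).trans (S.dep_zero_le E ht)

/-- The fluid of one loop does not overtake that of the preceding loop. -/
theorem dep_order {j : ℕ} (hj : j + 4 < 4 * p.K) {t : ℝ} (ht : t ∈ Icc 0 (τ (p.K + p.K')))
    (h : 0 < cumul (e.dep (some (j + 4))) t) : cumul (e.dep (some j)) t = 1 := by
  induction j generalizing t with
  | zero =>
    have hv : 0 + 4 < p.visits := by unfold Params.visits; omega
    have hm := mem_classesAt_serverOf p hv
    have hm0 := mem_classesAt_serverOf p (j := 0) (by omega)
    rw [serverOf_add_four p hj] at hm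
    rcases le_total t (initialHeight (p.serverOf (some 0))) with hx | hx
    · have := (E.server _).initial _ hm t ht hx
      change cumul _ t = cumul _ t at this
      rw [this, cumul_initialDensity] at h
      simp at h
    -- `Q₁` needs one time unit for its initial content, so after that all of class `0` has left.
    · obtain ⟨s, hs, hst⟩ := (E.server _).exists_arrival (S.serverData E _) ht hx
      have hsT : s ∈ Icc 0 (τ (p.K + p.K')) := ⟨hs.1, hs.2.trans ht.2⟩
      have := (E.server _).cumul_departure hm0 hsT (hst.le.trans ht.2)
      rw [hst, cumul_initialDensity, cumul_injH E hsT] at this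
      have h3 : p.serverOf (some 0) = 0 := by
        unfold Params.serverOf
        dsimp only
        rw [if_pos (by have := S.course.two_le; omega)]; rfl
      rw [this, h3]
      simp [initialHeight]
  | succ j ih =>
    have hv : j + 1 + 4 < p.visits := by unfold Params.visits; omega
    have hm := mem_classesAt_serverOf p hv
    have hm0 := mem_classesAt_serverOf p (j := j + 1) (by omega)
    rw [serverOf_add_four p hj] at hm
    rcases le_total t (initialHeight (p.serverOf (some (j + 1)))) with hx | hx
    · have := (E.server _).initial _ hm t ht hx
      change cumul _ t = cumul _ t at this
      rw [this, cumul_initialDensity] at h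
      simp at h
    -- Both classes are served by the same server, so both departures up to `t` are arrivals up to
    -- the same `s`; arrivals are departures from the preceding stops, where the induction
    -- hypothesis applies.
    · obtain ⟨s, hs, hst⟩ := (E.server _).exists_arrival (S.serverData E _) ht hx
      have hsT : s ∈ Icc 0 (τ (p.K + p.K')) := ⟨hs.1, hs.2.trans ht.2⟩
      have h1 := (E.server _).cumul_departure hm0 hsT (hst.le.trans ht.2)
      have h2 := (E.server _).cumul_departure hm hsT (hst.le.trans ht.2)
      rw [hst, cumul_initialDensity] at h1 h2
      rw [h2] at h
      rw [h1]
      simp only [Evolution.arr, Option.some.injEq, Nat.add_eq_zero_iff, one_ne_zero, and_false,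
        if_false, zero_add] at h ⊢
      exact ih (by omega) hsT (by simpa [Evolution.arr, add_right_comm] using h)

end Setting

/-- Continuous induction, by the supremum of the times up to which `P` holds: `hl` includes the
supremum, `hr` goes beyond it. -/
theorem forall_Icc_of_continuation {P : ℝ → Prop} {T : ℝ} (hT : 0 ≤ T) (h0 : P 0)
    (hl : ∀ t ∈ Ioc 0 T, (∀ u ∈ Ico 0 t, P u) → P t)
    (hr : ∀ t ∈ Ico 0 T, (∀ u ∈ Icc 0 t, P u) → ∃ t' > t, ∀ u ∈ Ioc t t', u ≤ T → P u) :
    ∀ t ∈ Icc 0 T, P t := by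
  set s := {t ∈ Icc 0 T | ∀ u ∈ Icc 0 t, P u} with hs
  have hs0 : (0 : ℝ) ∈ s := ⟨⟨le_rfl, hT⟩, fun u hu => by rwa [le_antisymm hu.2 hu.1]⟩
  have hbdd : BddAbove s := ⟨T, fun t ht => ht.1.2⟩
  set b := sSup s with hb
  have hb0 : 0 ≤ b := le_csSup hbdd hs0
  have hbT : b ≤ T := csSup_le ⟨0, hs0⟩ fun t ht => ht.1.2
  have hlt : ∀ u ∈ Ico 0 b, P u := fun u hu => by
    obtain ⟨t, ht, hut⟩ := exists_lt_of_lt_csSup ⟨0, hs0⟩ hu.2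
    exact ht.2 u ⟨hu.1, hut.le⟩
  have hPb : P b := by
    rcases hb0.eq_or_lt with h | h
    · rwa [← h]
    · exact hl b ⟨h, hbT⟩ hlt
  have hle : ∀ u ∈ Icc 0 b, P u := fun u hu => by
    rcases hu.2.eq_or_lt with h | h
    · rwa [h]
    · exact hlt u ⟨hu.1, h⟩
  rcases hbT.eq_or_lt with h | h
  · rwa [h] at hle
  · obtain ⟨t', ht', hP⟩ := hr b ⟨hb0, h⟩ hle
    have hmem : min t' T ∈ s := ⟨⟨le_min (hb0.trans ht'.le) hT, min_le_right _ _⟩, fun u hu => by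
      rcases le_or_gt u b with h1 | h1
      · exact hle u ⟨hu.1, h1⟩
      · exact hP u ⟨h1, hu.2.trans (min_le_left _ _)⟩ (hu.2.trans (min_le_right _ _))⟩
    have := le_csSup hbdd hmem
    exact absurd this (not_le.2 (lt_min ht' h))

/-- Horizontal fluid that has left `Q₄` for `Q₁`. -/
noncomputable def recirculated (p : Params) (e : Evolution) (t : ℝ) : ℝ :=
  ∑ k ∈ Finset.range (p.K - 1), cumul (e.dep (some (4 * k + 3))) t

/-- Horizontal fluid that has left `Q₄` for another small loop. -/
noncomputable def relooped (p : Params) (e : Evolution) (t : ℝ) : ℝ :=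
  ∑ i ∈ Finset.range p.K', cumul (e.dep (some (4 * p.K - 1 + i))) t

theorem cumul_congr {f g : ℝ → ℝ} {t : ℝ} (ht : 0 ≤ t) (h : ∀ u ∈ Icc 0 t, f u = g u) :
    cumul f t = cumul g t :=
  intervalIntegral.integral_congr fun u hu => h u (by rwa [uIcc_of_le ht] at hu)

theorem Course.eta_sub_one {K K' : ℕ} {c : ℝ} {g τ A D : ℝ → ℝ} (C : Course K K' c g τ A D) :
    (K - 1 : ℝ) + cumul g ((K - 1) / c) = K / c := by
  have := C.tau_step (K - 1) le_rfl (by linarith [C.one_le_cast])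
  rw [sub_add_cancel, C.tau_K, C.tau_lin _ (by linarith)] at this
  exact this.symm

/-! ### Fluid balances between the servers -/

namespace Setting

variable {p : Params} {φ : ℝ → ℝ → ℝ} {g τ A D : ℝ → ℝ} {e : Evolution}

theorem εs_pos (S : Setting p φ g τ A D) : 0 < p.εs := by
  have h1 := S.course.g_large
  have h2 := S.course.g_anti S.course.T₃_pos.le
  rw [S.g_zero] at h2
  linarith [S.course.c_lt]

theorem stored_none (p : Params) (e : Evolution) (t : ℝ) :
    e.stored p none t = cumul e.injS t - cumul (e.dep none) t := by
  have := cumul_initialDensity none (initialHeight (p.serverOf none))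
  unfold cumul at this
  unfold Evolution.stored
  rw [this]
  simp [Evolution.arr, cumul]

theorem not_blocked_zero (p : Params) (e : Evolution) : ¬ e.Blocked p 0 := by
  rw [Evolution.Blocked, stored_none, cumul_zero, cumul_zero]; simp

theorem total_dep_of_lt (p : Params) (e : Evolution) (q : Fin 4) (hq : q < 3) (t : ℝ) :
    total (p.classesAt q) e.dep t
      = ∑ k ∈ Finset.range p.K, cumul (e.dep (some (4 * k + q))) t :=
  sum_classesAt_of_lt p q hq _

theorem total_arr_one (p : Params) (e : Evolution) (t : ℝ) :
    total (p.classesAt 1) e.arr t = total (p.classesAt 0) e.dep t := by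
  rw [total_dep_of_lt p e 0 (by decide), total, sum_classesAt_of_lt p 1 (by decide)]
  rfl

theorem total_arr_two (p : Params) (e : Evolution) (t : ℝ) :
    total (p.classesAt 2) e.arr t = total (p.classesAt 1) e.dep t := by
  rw [total_dep_of_lt p e 1 (by decide), total, sum_classesAt_of_lt p 2 (by decide)]
  rfl

theorem total_arr_zero (S : Setting p φ g τ A D) (E : IsEvolution p φ (τ (p.K + p.K')) e) {t : ℝ}
    (ht : t ∈ Icc 0 (τ (p.K + p.K'))) :
    total (p.classesAt 0) e.arr t = recirculated p e t := by
  rw [total, sum_classesAt_of_lt p 0 (by decide)]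
  obtain ⟨n, hn⟩ : ∃ n, p.K = n + 1 := ⟨p.K - 1, by have := S.course.two_le; omega⟩
  rw [hn, Finset.sum_range_succ', recirculated, hn]
  have := cumul_injH E ht
  simp only [Fin.val_zero, mul_zero, add_zero, this, Nat.add_sub_cancel]
  rfl

theorem visit_of_lt {K m : ℕ} (h : m < K) : visit K m = 4 * m + 3 := if_pos h

theorem visit_add {K : ℕ} (i : ℕ) : visit K (K + i) = 4 * K + i := by
  unfold visit; rw [if_neg (by omega)]; omega

theorem total_arr_three (S : Setting p φ g τ A D) (t : ℝ) :
    total (p.classesAt 3) e.arr t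
      = cumul e.injS t + (total (p.classesAt 2) e.dep t + relooped p e t) := by
  rw [total, sum_classesAt_three, Finset.sum_range_add, total_dep_of_lt p e 2 (by decide), relooped]
  congr 2
  · refine Finset.sum_congr rfl fun k hk => ?_
    rw [visit_of_lt (Finset.mem_range.1 hk)]; rfl
  · refine Finset.sum_congr rfl fun i _ => ?_
    rw [visit_add]
    obtain ⟨n, hn⟩ : ∃ n, 4 * p.K = n + 1 := ⟨4 * p.K - 1, by have := S.course.two_le; omega⟩
    rw [hn, Nat.add_sub_cancel, add_right_comm]; rfl

/-- Fluid leaving `Q₄` is simple, returns to `Q₁`, starts another small loop, or leaves the gadget.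
-/
theorem total_dep_three (S : Setting p φ g τ A D) (t : ℝ) :
    total (p.classesAt 3) e.dep t
      = cumul (e.dep none) t + (recirculated p e t + relooped p e t
        + cumul (e.dep (some (p.visits - 1))) t) := by
  have hK := S.course.two_le
  have hK' := S.course.one_le
  rw [total, sum_classesAt_three, recirculated, relooped]
  congr 1
  have h1 : p.K + p.K' = (p.K - 1) + (p.K' + 1) := by omega
  rw [h1, Finset.sum_range_add, Finset.sum_range_succ, ← add_assoc]
  have h3 : ∀ i, visit p.K (p.K - 1 + i) = 4 * p.K - 1 + i := fun i => by
    unfold visit; split_ifs <;> omega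
  congr 2
  · refine Finset.sum_congr rfl fun k hk => ?_
    rw [visit_of_lt (by have := Finset.mem_range.1 hk; omega)]
  · simp only [h3]
  · rw [h3]; congr 3; unfold Params.visits; omega

/-- First in, first out at `Q₄`. -/
theorem dep_succ_three (E : IsEvolution p φ (τ (p.K + p.K')) e) {j : ℕ}
    (hs : some (j + 1) ∈ p.classesAt 3) {s : ℝ}
    (h0 : s ∈ Icc 0 (τ (p.K + p.K'))) (h1 : s + e.h 3 s ≤ τ (p.K + p.K')) :
    cumul (e.dep (some (j + 1))) (s + e.h 3 s) = cumul (e.dep (some j)) s := by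
  have := (E.server 3).cumul_departure hs h0 h1
  rw [cumul_initialDensity] at this
  simpa [Evolution.arr] using this

theorem dep_none_three (E : IsEvolution p φ (τ (p.K + p.K')) e)
    {s : ℝ} (h0 : s ∈ Icc 0 (τ (p.K + p.K'))) (h1 : s + e.h 3 s ≤ τ (p.K + p.K')) :
    cumul (e.dep none) (s + e.h 3 s) = cumul e.injS s := by
  have := (E.server 3).cumul_departure (none_mem_classesAt p) h0 h1
  rw [cumul_initialDensity] at this
  simpa [Evolution.arr] using this

/-! ### The injection rate while `Q₄` is busy -/

section simple

variable (S : Setting p φ g τ A D) (E : IsEvolution p φ (τ (p.K + p.K')) e)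
include S E

theorem exists_arrival_three {u : ℝ} (hu : u ∈ Icc 0 (τ (p.K + p.K'))) :
    ∃ s ∈ Icc 0 u, s + e.h 3 s = u :=
  (E.server 3).exists_arrival (S.serverData E 3) hu hu.1

/-- The simple fluid stored at `t` was injected between `v` and `t`, where `v < t` is the arrival
time of what leaves at `t`. If there is none, the nonnegative continuous rate vanishes on this
interval. -/
theorem injS_eq_zero_of_not_blocked {t : ℝ} (ht : t ∈ Ioc 0 (τ (p.K + p.K')))
    (hp : ∀ u ∈ Ioc 0 t, 0 < e.h 3 u) (hb : ¬ e.Blocked p t) : e.injS t = 0 := by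
  have htT : t ∈ Icc 0 (τ (p.K + p.K')) := ⟨ht.1.le, ht.2⟩
  obtain ⟨v, hv, hvt⟩ := S.exists_arrival_three E htT
  have hvT : v ∈ Icc 0 (τ (p.K + p.K')) := ⟨hv.1, hv.2.trans ht.2⟩
  have hlt : v < t := by
    rcases hv.1.eq_or_lt with h | h
    · rw [← h]; exact ht.1
    · linarith [hp v ⟨h, hv.2⟩]
  have h1 := dep_none_three E hvT (hvt.le.trans ht.2)
  rw [hvt] at h1
  rw [Evolution.Blocked, stored_none, h1, cumul_sub_of_integrable (S.injS_int E) hvT htT] at hb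
  by_contra hne
  have hpos : 0 < e.injS t := (E.control.range t htT).1.lt_of_ne' hne
  refine hb (intervalIntegral.integral_pos hlt (E.control.continuous.mono
    (Icc_subset_Icc hv.1 ht.2)) (fun u hu => (E.control.range u
      ⟨hv.1.trans hu.1.le, hu.2.trans ht.2⟩).1) ⟨t, ⟨hlt.le, le_rfl⟩, hpos⟩)

theorem stored_continuousOn : ContinuousOn (e.stored p none) (Icc 0 (τ (p.K + p.K'))) := by
  have h1 := cumul_continuousOn S.course.TP_pos.le (S.injS_int E)
  have h2 := cumul_continuousOn S.course.TP_pos.le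
    ((S.serverData E 3).d_int none (none_mem_classesAt p))
  exact (h1.sub h2).congr fun t _ => stored_none p e t

/-- While `Q₄` is busy the simple session follows the flow decrease function. -/
theorem injS_eq {b : ℝ} (hbT : b ≤ τ (p.K + p.K')) (hp : ∀ u ∈ Ioc 0 b, 0 < e.h 3 u) :
    ∀ t ∈ Icc 0 b, e.injS t = g t := by
  have hzero : ∀ t ∈ Ioc 0 b, ¬ e.Blocked p t → e.injS t = 0 := fun t ht =>
    S.injS_eq_zero_of_not_blocked E ⟨ht.1, ht.2.trans hbT⟩ fun u hu => hp u ⟨hu.1, hu.2.trans ht.2⟩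
  have hfollow : ∀ t ∈ Ioc 0 b, (∀ u ∈ Ioo 0 t, e.Blocked p u) → e.injS t = g t := by
    intro t ht hbl
    rw [E.control.blocked 0 t le_rfl ht.1 (ht.2.trans hbT) (not_blocked_zero p e) hbl t
      ⟨ht.1.le, le_rfl⟩, E.control.initial, sub_zero, S.g_eq t ht.1.le]
  -- Before its first zero `m` the rate is positive, so the session is blocked all the time and
  -- `injS m = g m`; then `g` stays zero since it is antitone.
  have hvanish : ∀ a ∈ Ioc 0 b, e.injS a = 0 → g a = 0 := by
    intro a ha ha0
    have hcpt : IsCompact {s ∈ Icc 0 a | e.injS s = 0} :=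
      isCompact_Icc.of_isClosed_subset ((E.control.continuous.mono
        (Icc_subset_Icc_right (ha.2.trans hbT))).preimage_isClosed_of_isClosed isClosed_Icc
          (isClosed_singleton (x := 0))) inter_subset_left
    obtain ⟨m, ⟨hm, hm0⟩, hmin⟩ := hcpt.exists_isLeast ⟨a, ⟨ha.1.le, le_rfl⟩, ha0⟩
    have hmpos : 0 < m := hm.1.lt_of_ne' fun h => by
      rw [h, E.control.initial] at hm0
      exact S.εs_pos.ne' hm0
    have hgm : e.injS m = g m := hfollow m ⟨hmpos, hm.2.trans ha.2⟩ fun u hu => by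
      by_contra hu'
      have := hmin ⟨⟨hu.1.le, hu.2.le.trans hm.2⟩, hzero u ⟨hu.1, hu.2.le.trans (hm.2.trans ha.2)⟩ hu'⟩
      exact absurd this (not_le.2 hu.2)
    have := S.course.g_anti hm.2
    rw [← hgm, hm0] at this
    exact le_antisymm this (S.course.g_nonneg a)
  intro t ht
  rcases ht.1.eq_or_lt with h0 | h0
  · rw [← h0, E.control.initial, S.g_zero]
  have hcpt : IsCompact {s ∈ Icc 0 t | e.stored p none s ≤ 0} :=
    isCompact_Icc.of_isClosed_subset (((S.stored_continuousOn E).mono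
      (Icc_subset_Icc_right (ht.2.trans hbT))).preimage_isClosed_of_isClosed isClosed_Icc
        isClosed_Iic) inter_subset_left
  -- The last unblocked time. If it is positive, the rate and `g` are already zero there, and a new
  -- blocked period starting from rate zero cannot raise the rate.
  obtain ⟨a, ⟨ha, ha0⟩, hmax⟩ := hcpt.exists_isGreatest
    ⟨0, ⟨le_rfl, h0.le⟩, not_lt.1 (not_blocked_zero p e)⟩
  have hna : ¬ e.Blocked p a := not_lt.2 ha0
  have hbl : ∀ u ∈ Ioo a t, e.Blocked p u := fun u hu => by
    by_contra hu'
    exact absurd (hmax ⟨⟨ha.1.trans hu.1.le, hu.2.le⟩, not_lt.1 hu'⟩) (not_le.2 hu.1)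
  rcases ha.1.eq_or_lt with hz | hz
  · exact hfollow t ⟨h0, ht.2⟩ (by rwa [← hz] at hbl)
  · have hab : a ∈ Ioc 0 b := ⟨hz, ha.2.trans ht.2⟩
    have hia := hzero a hab hna
    have hga := hvanish a hab hia
    have hgt : g t = 0 := le_antisymm (hga ▸ S.course.g_anti ha.2) (S.course.g_nonneg t)
    rw [hgt]
    rcases ha.2.eq_or_lt with h | h
    · rw [← h, hia]
    · have h1 := E.control.blocked a t ha.1 h (ht.2.trans hbT) hna hbl t ⟨h.le, le_rfl⟩
      have h2 := S.φ_le 0 le_rfl (t - a) (by linarith)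
      rw [hia] at h1
      exact le_antisymm (h1.trans_le h2) (E.control.range t ⟨h0.le, ht.2.trans hbT⟩).1

end simple

end Setting

/-! ### Arbitrary evolutions up to `T₃` -/

namespace Setting

variable {p : Params} {φ : ℝ → ℝ → ℝ} {g τ A D : ℝ → ℝ} {e : Evolution}

theorem visits_eq (p : Params) : p.visits = 4 * p.K + p.K' := rfl

theorem mem_three (p : Params) {j : ℕ} (hj : j < p.visits) (h : 4 * p.K - 1 ≤ j) (hK : 0 < p.K) :
    some j ∈ p.classesAt 3 := by
  rw [mem_classesAt]
  refine ⟨hj, ?_⟩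
  split_ifs with h1
  · have : j = 4 * (p.K - 1) + 3 := by omega
    ext
    rw [Fin.val_ofNat]
    change j % 4 = 3
    omega
  · rfl

theorem mem_three_of_lt (p : Params) {k : ℕ} (hk : k < p.K) :
    some (4 * k + 3) ∈ p.classesAt 3 := by
  rw [mem_classesAt]
  refine ⟨by omega, ?_⟩
  rw [if_pos (by omega)]
  ext
  rw [Fin.val_ofNat]
  change (4 * k + 3) % 4 = 3
  omega

theorem recirculated_nonneg (E : IsEvolution p φ (τ (p.K + p.K')) e) {t : ℝ} (ht : t ∈ Icc 0 (τ (p.K + p.K'))) :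
    0 ≤ recirculated p e t :=
  Finset.sum_nonneg fun k hk => dep_nonneg' E (by
    have := Finset.mem_range.1 hk; rw [visits_eq]; omega) ht

theorem recirculated_mono (E : IsEvolution p φ (τ (p.K + p.K')) e) : MonotoneOn (recirculated p e) (Icc 0 (τ (p.K + p.K'))) :=
  fun s hs t ht hst => Finset.sum_le_sum fun k hk => mono_dep E (by
    have := Finset.mem_range.1 hk; rw [visits_eq]; omega) hs ht hst

/-- Fluid that leaves `Q₄` before `K / (1 - μ₃)` arrived before `(K - 1) / (1 - μ₃)`. -/
theorem arrival_le (S : Setting p φ g τ A D) {v u : ℝ} (hle : (1 - p.μ₃) * v + cumul g v ≤ u)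
    (hu : u ≤ p.K / (1 - p.μ₃)) : (1 - p.μ₃) * v ≤ p.K - 1 := by
  by_contra! h
  have hc := S.course.c_pos
  have h1 : ((p.K : ℝ) - 1) / (1 - p.μ₃) ≤ v := by
    rw [div_le_iff₀' hc]; exact h.le
  have h2 := S.course.cumul_mono h1
  have h3 := S.course.eta_sub_one
  linarith

variable (S : Setting p φ g τ A D) (E : IsEvolution p φ (τ (p.K + p.K')) e)
include S E

theorem relooped_nonneg {t : ℝ} (ht : t ∈ Icc 0 (τ (p.K + p.K'))) :
    0 ≤ relooped p e t :=
  Finset.sum_nonneg fun k hk => dep_nonneg' E (by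
    have := Finset.mem_range.1 hk; have := S.course.two_le; rw [visits_eq]; omega) ht

theorem recirculated_continuousOn : ContinuousOn (recirculated p e) (Icc 0 (τ (p.K + p.K'))) :=
  continuousOn_finsetSum _ fun k hk => cumul_continuousOn S.course.TP_pos.le
    (dep_int E (by have := Finset.mem_range.1 hk; rw [visits_eq]; omega))

theorem recirculated_le {t : ℝ} (ht : t ∈ Icc 0 (τ (p.K + p.K'))) :
    recirculated p e t ≤ p.K - 1 := by
  have hK := S.course.two_le
  calc recirculated p e t ≤ ∑ _k ∈ Finset.range (p.K - 1), (1 : ℝ) :=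
        Finset.sum_le_sum fun k hk => S.dep_le_one E (by
          have := Finset.mem_range.1 hk; rw [visits_eq]; omega) ht
    _ = p.K - 1 := by
      rw [Finset.sum_const, Finset.card_range, nsmul_one, Nat.cast_sub (by omega)]; simp

/-- As long as at most `K - 1` units have passed `Q₃`, no fluid of the last big loop has. -/
theorem dep_last_eq_zero {t : ℝ} (ht : t ∈ Icc 0 (τ (p.K + p.K')))
    (h : total (p.classesAt 2) e.dep t ≤ p.K - 1) :
    cumul (e.dep (some (4 * p.K - 2))) t = 0 := by
  have hK := S.course.two_le
  have hv := visits_eq p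
  refine le_antisymm (not_lt.1 fun hpos => ?_) (dep_nonneg' E (by omega) ht)
  have hlast : 4 * p.K - 2 = 4 * p.K - 6 + 4 := by omega
  have h1 := S.dep_order E (j := 4 * p.K - 6) (by omega) ht (by rwa [← hlast])
  rw [total_dep_of_lt p e 2 (by decide)] at h
  obtain ⟨n, hn⟩ : ∃ n, p.K = n + 1 := ⟨p.K - 1, by omega⟩
  rw [hn, Finset.sum_range_succ] at h
  have h2 : (n : ℝ) ≤ ∑ k ∈ Finset.range n, cumul (e.dep (some (4 * k + ((2 : Fin 4) : ℕ)))) t := by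
    calc (n : ℝ) = ∑ _k ∈ Finset.range n, (1 : ℝ) := by simp
      _ ≤ _ := Finset.sum_le_sum fun k hk => by
        have hk' := Finset.mem_range.1 hk
        rw [← h1]
        change _ ≤ cumul (e.dep (some (4 * k + 2))) t
        exact S.dep_antitone E (by omega) (by omega) ht
  have h3 : 4 * p.K - 2 = 4 * n + 2 := by omega
  rw [h3] at hpos
  change _ + cumul (e.dep (some (4 * n + 2))) t ≤ _ at h
  push_cast at h
  linarith

/-- Until fluid of the last big loop has passed `Q₃`, everything from `Q₃` returns to `Q₁` after its
stay in `Q₄`. -/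
theorem recirculated_departure {v : ℝ} (h0 : v ∈ Icc 0 (τ (p.K + p.K')))
    (h1 : v + e.h 3 v ≤ τ (p.K + p.K')) (h : total (p.classesAt 2) e.dep v ≤ p.K - 1) :
    recirculated p e (v + e.h 3 v) = total (p.classesAt 2) e.dep v := by
  have hz := S.dep_last_eq_zero E h0 h
  have hv := visits_eq p
  have hK := S.course.two_le
  obtain ⟨n, hn⟩ : ∃ n, p.K = n + 1 := ⟨p.K - 1, by omega⟩
  rw [recirculated, total_dep_of_lt p e 2 (by decide), hn, Finset.sum_range_succ,
    Nat.add_sub_cancel]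
  have h3 : 4 * p.K - 2 = 4 * n + 2 := by omega
  rw [h3] at hz
  change _ = _ + cumul (e.dep (some (4 * n + 2))) v
  rw [hz, add_zero]
  refine Finset.sum_congr rfl fun k hk => ?_
  have := Finset.mem_range.1 hk
  exact dep_succ_three E (mem_three_of_lt p (by omega)) h0 h1

/-- While `Q₁`, `Q₂`, `Q₃` together receive enough, `Q₃` is busy. -/
theorem total_dep_two {t : ℝ} (ht : t ∈ Icc 0 (τ (p.K + p.K')))
    (hX : ∀ u ∈ Icc 0 t, (1 - p.μ₃) * u ≤ 1 + recirculated p e u) :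
    ∀ u ∈ Icc 0 t, total (p.classesAt 2) e.dep u = (1 - p.μ₃) * u := by
  have hc := S.course.c_lt
  have h2 := S.μ₂_pos
  have h3 := S.μ₂_lt
  have hT : ∀ u ∈ Icc 0 t, u ∈ Icc 0 (τ (p.K + p.K')) := fun u hu => ⟨hu.1, hu.2.trans ht.2⟩
  have hD1 : ∀ u ∈ Icc 0 t, (1 - p.μ₃) * u ≤ total (p.classesAt 0) e.dep u := fun u hu =>
    (E.server 0).le_total_departure (S.serverData E 0) (hT u hu)
      (by simp [Params.serviceRate]; linarith) fun s hs => by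
        have hs' : s ∈ Icc 0 t := ⟨hs.1, hs.2.trans hu.2⟩
        rw [S.total_arr_zero E (hT s hs')]
        simpa [Params.serviceRate, initialHeight] using hX s hs'
  have hD2 : ∀ u ∈ Icc 0 t, (1 - p.μ₃) * u ≤ total (p.classesAt 1) e.dep u := fun u hu =>
    (E.server 1).le_total_departure (S.serverData E 1) (hT u hu)
      (by simp [Params.serviceRate]; linarith) fun s hs => by
        have hs' : s ∈ Icc 0 t := ⟨hs.1, hs.2.trans hu.2⟩
        rw [total_arr_one]
        simpa [Params.serviceRate, initialHeight] using hD1 s hs'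
  intro u hu
  refine le_antisymm ((E.server 2).total_departure_le (S.serverData E 2) (hT u hu)) ?_
  refine (E.server 2).le_total_departure (S.serverData E 2) (hT u hu)
      (by simp [Params.serviceRate]) fun s hs => ?_
  have hs' : s ∈ Icc 0 t := ⟨hs.1, hs.2.trans hu.2⟩
  rw [total_arr_two]
  simpa [Params.serviceRate, initialHeight] using hD2 s hs'

theorem height_three_eq {t : ℝ} (ht : t ∈ Icc 0 (τ (p.K + p.K'))) :
    e.h 3 t = cumul e.injS t + (total (p.classesAt 2) e.dep t + relooped p e t)
      - total (p.classesAt 3) e.dep t := by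
  have := (E.server 3).conservation (S.serverData E 3) ht
  rw [S.total_arr_three] at this
  simpa [Params.serviceRate, initialHeight] using this

theorem total_dep_three_le {t : ℝ} (ht : t ∈ Icc 0 (τ (p.K + p.K'))) :
    total (p.classesAt 3) e.dep t ≤ t := by
  have := (E.server 3).total_departure_le (S.serverData E 3) ht
  simpa [Params.serviceRate] using this

theorem total_dep_three_eq {t : ℝ} (ht : t ∈ Icc 0 (τ (p.K + p.K')))
    (hp : ∀ u ∈ Ioo 0 t, 0 < e.h 3 u) : total (p.classesAt 3) e.dep t = t := by
  have := (E.server 3).total_departure_of_pos (S.serverData E 3)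
    ⟨le_rfl, S.course.TP_pos.le⟩ ht ht.1 hp
  simpa [Params.serviceRate, total, cumul_zero] using this

/-- Dropping the small loops and bounding the output by `u` gives a bound that does not presuppose
that `Q₄` is busy or that the injection is `g`. -/
theorem le_height_three {t : ℝ} (ht : t ∈ Icc 0 (τ (p.K + p.K')))
    (hX : ∀ u ∈ Icc 0 t, (1 - p.μ₃) * u ≤ 1 + recirculated p e u) :
    ∀ u ∈ Icc 0 t, (1 - p.μ₃) * u + cumul e.injS u - u ≤ e.h 3 u := by
  intro u hu
  have huT : u ∈ Icc 0 (τ (p.K + p.K')) := ⟨hu.1, hu.2.trans ht.2⟩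
  rw [S.height_three_eq E huT, S.total_dep_two E ht hX u hu]
  linarith [S.relooped_nonneg E huT, S.total_dep_three_le E huT]

/-- The gadget before all fluid has reached `Q₄` for good. -/
theorem early {t : ℝ} (ht : t ∈ Icc 0 ((p.K : ℝ) / (1 - p.μ₃)))
    (hX : ∀ u ∈ Icc 0 t, (1 - p.μ₃) * u ≤ 1 + recirculated p e u)
    (hI : ∀ u ∈ Icc 0 t, e.injS u = g u) :
    ∀ u ∈ Icc 0 t, total (p.classesAt 2) e.dep u = (1 - p.μ₃) * u ∧
      cumul (e.dep (some (4 * p.K - 1))) u = 0 ∧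
      u + e.h 3 u = (1 - p.μ₃) * u + cumul g u := by
  have htT : t ∈ Icc 0 (τ (p.K + p.K')) := ⟨ht.1, ht.2.trans S.course.T₃_lt.le⟩
  have hT : ∀ u ∈ Icc 0 t, u ∈ Icc 0 (τ (p.K + p.K')) := fun u hu => ⟨hu.1, hu.2.trans htT.2⟩
  have hK := S.course.two_le
  have hv := visits_eq p
  have hcI : ∀ u ∈ Icc 0 t, cumul e.injS u = cumul g u := fun u hu =>
    cumul_congr hu.1 fun w hw => hI w ⟨hw.1, hw.2.trans hu.2⟩
  have hge : ∀ u ∈ Icc 0 t, (1 - p.μ₃) * u + cumul g u - u ≤ e.h 3 u := fun u hu => by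
    rw [← hcI u hu]; exact S.le_height_three E htT hX u hu
  have hpos : ∀ u ∈ Ioc 0 t, 0 < e.h 3 u := fun u hu => by
    have h1 := hge u ⟨hu.1.le, hu.2⟩
    have h2 := S.course.lt_cumul_sub hu.1 (hu.2.trans ht.2)
    rw [cumul_zero] at h2
    linarith
  intro u hu
  -- What leaves `Q₄` by `w ≤ K / c` arrived at some `v` with `c v ≤ K - 1`, when nothing of the
  -- last big loop had passed `Q₃`. The lower bound `hge` on the height suffices for this.
  have hz : ∀ w ∈ Icc 0 t, cumul (e.dep (some (4 * p.K - 1))) w = 0 := fun w hw => by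
    obtain ⟨v, hv', hvu⟩ := S.exists_arrival_three E (hT w hw)
    have hvt : v ∈ Icc 0 t := ⟨hv'.1, hv'.2.trans hw.2⟩
    have h1 := S.arrival_le (v := v) (u := w) (by linarith [hge v hvt]) (hw.2.trans ht.2)
    rw [← S.total_dep_two E htT hX v hvt] at h1
    have h2 := S.dep_last_eq_zero E (hT v hvt) h1
    have h3 : 4 * p.K - 1 = 4 * p.K - 2 + 1 := by omega
    rw [← hvu, h3, dep_succ_three E _ (hT v hvt) (hvu.le.trans (hT w hw).2), h2]
    rw [← h3]
    exact mem_three p (by omega) le_rfl (by omega)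
  refine ⟨S.total_dep_two E htT hX u hu, hz u hu, ?_⟩
  have hrel : relooped p e u = 0 := by
    refine le_antisymm ?_ (S.relooped_nonneg E (hT u hu))
    refine Finset.sum_nonpos fun i hi => ?_
    have := Finset.mem_range.1 hi
    rw [← hz u hu]
    exact S.dep_antitone E (by omega) (by omega) (hT u hu)
  have := S.height_three_eq E (hT u hu)
  rw [hrel, hcI u hu, S.total_dep_two E htT hX u hu,
    S.total_dep_three_eq E (hT u hu) fun w hw => hpos w ⟨hw.1, hw.2.le.trans hu.2⟩] at this
  linarith

/-- Because of the delay in `Q₄`, knowledge up to `t` determines its departures up to `t + h₄ t = c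
t + cumul g t`. -/
theorem early_extend {t : ℝ} (ht : t ∈ Icc 0 ((p.K : ℝ) / (1 - p.μ₃)))
    (hX : ∀ u ∈ Icc 0 t, (1 - p.μ₃) * u ≤ 1 + recirculated p e u)
    (hI : ∀ u ∈ Icc 0 t, e.injS u = g u) {u : ℝ} (hu : u ∈ Icc 0 ((p.K : ℝ) / (1 - p.μ₃)))
    (hut : u ≤ (1 - p.μ₃) * t + cumul g t) :
    ∃ v ∈ Icc 0 t, u = (1 - p.μ₃) * v + cumul g v ∧ recirculated p e u = (1 - p.μ₃) * v := by
  have hearly := S.early E ht hX hI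
  have hTP := S.course.T₃_lt.le
  have huT : u ∈ Icc 0 (τ (p.K + p.K')) := ⟨hu.1, hu.2.trans hTP⟩
  have hθ : Continuous fun v => (1 - p.μ₃) * v + cumul g v :=
    (continuous_const.mul continuous_id).add (cumul_continuous S.course.g_cont)
  obtain ⟨v, hv, hvu⟩ := intermediate_value_Icc ht.1 hθ.continuousOn
    (show u ∈ _ from ⟨by simpa [cumul_zero] using hu.1, hut⟩)
  have hvu : (1 - p.μ₃) * v + cumul g v = u := hvu
  refine ⟨v, hv, hvu.symm, ?_⟩
  obtain ⟨h1, -, h3⟩ := hearly v hv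
  have hvT : v ∈ Icc 0 (τ (p.K + p.K')) := ⟨hv.1, hv.2.trans (ht.2.trans hTP)⟩
  have h5 := S.arrival_le hvu.le hu.2
  rw [← h1] at h5
  rw [← hvu, ← h3, S.recirculated_departure E hvT (by rw [h3, hvu]; exact huT.2) h5, h1]

/-- With `1 + c v` on the right, the claim says that the delay `u - v` is at most `1 / c`. The delay
does not decrease with `v`, because `g > μ₃`, and by the balance equation it is exactly `1 / c` at
`v = (K - 1) / c`. -/
theorem line_le_recirculated {t : ℝ} (ht : t ∈ Icc 0 ((p.K : ℝ) / (1 - p.μ₃)))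
    (hX : ∀ u ∈ Icc 0 t, (1 - p.μ₃) * u ≤ 1 + recirculated p e u)
    (hI : ∀ u ∈ Icc 0 t, e.injS u = g u) {u : ℝ} (hu : u ∈ Icc 0 ((p.K : ℝ) / (1 - p.μ₃)))
    (hut : u ≤ (1 - p.μ₃) * t + cumul g t) : (1 - p.μ₃) * u ≤ 1 + recirculated p e u := by
  obtain ⟨v, hv, hvu, hX'⟩ := S.early_extend E ht hX hI hu hut
  have h5 := S.arrival_le hvu.ge hu.2
  have hc := S.course.c_pos
  rw [hX']
  have h6 : v ≤ ((p.K : ℝ) - 1) / (1 - p.μ₃) := by rwa [le_div_iff₀' hc]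
  have h7 : ((p.K : ℝ) - 1) / (1 - p.μ₃) ≤ p.K / (1 - p.μ₃) := by gcongr; linarith
  have h8 := le_cumul_sub S.course.g_cont h6 (m := p.μ₃) fun w hw => by
    have := S.course.g_anti (hw.2.trans h7)
    linarith [S.course.g_large]
  have h9 := S.course.eta_sub_one
  have h10 : (1 - p.μ₃) * (((p.K : ℝ) - 1) / (1 - p.μ₃)) = p.K - 1 := by field_simp
  have h11 : (1 - p.μ₃) * ((p.K : ℝ) / (1 - p.μ₃)) = p.K := by field_simp
  have h12 : u - v ≤ 1 / (1 - p.μ₃) := by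
    have : 1 / (1 - p.μ₃) = p.K / (1 - p.μ₃) - ((p.K : ℝ) - 1) / (1 - p.μ₃) := by ring
    linarith
  rw [le_div_iff₀' hc] at h12
  linarith

/-- Until `K / (1 - μ₃)` the evolution is the expected one. -/
theorem early_main : ∀ t ∈ Icc 0 ((p.K : ℝ) / (1 - p.μ₃)),
    (1 - p.μ₃) * t ≤ 1 + recirculated p e t ∧ e.injS t = g t := by
  have hTP := S.course.T₃_lt.le
  have hc := S.course.c_pos
  have hsub : Icc 0 ((p.K : ℝ) / (1 - p.μ₃)) ⊆ Icc 0 (τ (p.K + p.K')) := Icc_subset_Icc_right hTP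
  have hXc := (S.recirculated_continuousOn E).mono hsub
  have hIc := E.control.continuous.mono hsub
  refine forall_Icc_of_continuation S.course.T₃_pos.le ⟨?_, ?_⟩ ?_ ?_
  · have := recirculated_nonneg E ⟨le_rfl, S.course.TP_pos.le⟩
    linarith
  · rw [E.control.initial, S.g_zero]
  · intro t ht hP
    have hcl : closure (Ico 0 t) = Icc 0 t := closure_Ico ht.1.ne
    have hsub' : Icc 0 t ⊆ Icc 0 ((p.K : ℝ) / (1 - p.μ₃)) := Icc_subset_Icc_right ht.2
    have htm : t ∈ closure (Ico 0 t) := hcl ▸ ⟨ht.1.le, le_rfl⟩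
    have hg := S.course.g_cont.continuousOn (s := Icc 0 t)
    refine ⟨le_on_closure (f := fun u => (1 - p.μ₃) * u) (g := fun u => 1 + recirculated p e u)
      (fun u hu => (hP u hu).1) (by fun_prop)
      (by rw [hcl]; exact continuousOn_const.add (hXc.mono hsub')) htm, le_antisymm ?_ ?_⟩
    · exact le_on_closure (fun u hu => (hP u hu).2.le) (by rw [hcl]; exact hIc.mono hsub')
        (by rwa [hcl]) htm
    · exact le_on_closure (fun u hu => (hP u hu).2.ge) (by rwa [hcl])
        (by rw [hcl]; exact hIc.mono hsub') htm
  · intro t ht hP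
    have htm : t ∈ Icc 0 ((p.K : ℝ) / (1 - p.μ₃)) := ⟨ht.1, ht.2.le⟩
    have hX := fun u hu => (hP u hu).1
    have hI := fun u hu => (hP u hu).2
    -- the amount of fluid on its way gives a margin for the first condition
    obtain ⟨t₁, ht₁, hX₁⟩ : ∃ t₁ > t, ∀ u ∈ Ioc t t₁, u ≤ (p.K : ℝ) / (1 - p.μ₃) →
        (1 - p.μ₃) * u ≤ 1 + recirculated p e u := by
      rcases ht.1.eq_or_lt with h0 | h0
      -- At time `0` there is no delay in `Q₄` to exploit, but the initial unit lasts for one time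
      -- unit.
      · refine ⟨1, by rw [← h0]; exact one_pos, fun u hu huT => ?_⟩
        have hu0 : 0 ≤ u := ht.1.trans hu.1.le
        have := recirculated_nonneg E (hsub ⟨hu0, huT⟩)
        have hc1 := S.course.c_lt
        nlinarith [hu.2]
      · refine ⟨(1 - p.μ₃) * t + cumul g t, ?_, fun u hu huT =>
          S.line_le_recirculated E htm hX hI ⟨ht.1.trans hu.1.le, huT⟩ hu.2⟩
        have := S.course.lt_cumul_sub h0 ht.2.le
        rw [cumul_zero] at this
        linarith
    -- Beyond `t` the injection is not yet known to be `g`. By continuity it exceeds `μ₃` for a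
    -- while, which keeps `Q₄` busy, and then `injS_eq` identifies it with `g`.
    have hlarge : p.μ₃ < e.injS t := by
      have h1 := S.course.g_anti ht.2.le
      rw [(hP t ⟨ht.1, le_rfl⟩).2]
      linarith [S.course.g_large]
    obtain ⟨t₂, ht₂, hI₂⟩ : ∃ t₂ > t, ∀ u ∈ Icc t t₂, u ≤ (p.K : ℝ) / (1 - p.μ₃) →
        p.μ₃ < e.injS u := by
      have h1 : ∀ᶠ u in nhdsWithin t (Icc 0 ((p.K : ℝ) / (1 - p.μ₃))), p.μ₃ < e.injS u :=
        (hIc t htm).eventually_const_lt hlarge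
      obtain ⟨ε, hε, hball⟩ := Metric.mem_nhdsWithin_iff.1 h1
      refine ⟨t + ε / 2, by linarith, fun u hu huT => hball ⟨?_, ht.1.trans hu.1, huT⟩⟩
      rw [Metric.mem_ball, Real.dist_eq, abs_lt]
      constructor <;> linarith [hu.1, hu.2]
    refine ⟨min t₁ t₂, lt_min ht₁ ht₂, fun u hu huT => ?_⟩
    have hu0 : 0 ≤ u := ht.1.trans hu.1.le
    have hXu : ∀ w ∈ Icc 0 u, (1 - p.μ₃) * w ≤ 1 + recirculated p e w := fun w hw => by
      rcases le_or_gt w t with h | h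
      · exact hX w ⟨hw.1, h⟩
      · exact hX₁ w ⟨h, hw.2.trans (hu.2.trans (min_le_left _ _))⟩ (hw.2.trans huT)
    have hIu : ∀ w ∈ Icc 0 u, p.μ₃ < e.injS w := fun w hw => by
      rcases le_or_gt w t with h | h
      · rw [hI w ⟨hw.1, h⟩]
        have h1 := S.course.g_anti (h.trans ht.2.le)
        linarith [S.course.g_large]
      · exact hI₂ w ⟨h.le, hw.2.trans (hu.2.trans (min_le_right _ _))⟩ (hw.2.trans huT)
    have huT' := hsub ⟨hu0, huT⟩
    have hpos : ∀ w ∈ Ioc 0 u, 0 < e.h 3 w := fun w hw => by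
      have h1 := S.le_height_three E huT' hXu w ⟨hw.1.le, hw.2⟩
      have hwT : w ∈ Icc 0 (τ (p.K + p.K')) := ⟨hw.1.le, hw.2.trans huT'.2⟩
      have h2 : 0 < ∫ s in (0 : ℝ)..w, (e.injS s - p.μ₃) := by
        refine intervalIntegral.integral_pos hw.1 ((E.control.continuous.mono
          (Icc_subset_Icc_right hwT.2)).sub continuousOn_const) (fun s hs => ?_) ⟨w, ⟨hw.1.le, le_rfl⟩, ?_⟩
        · linarith [hIu s ⟨hs.1.le, hs.2.trans hw.2⟩]
        · linarith [hIu w ⟨hw.1.le, hw.2⟩]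
      rw [intervalIntegral.integral_sub (intervalIntegrable_sub (S.injS_int E)
        ⟨le_rfl, S.course.TP_pos.le⟩ hwT) (by simp), intervalIntegral.integral_const] at h2
      change 0 < cumul e.injS w - _ at h2
      simp only [sub_zero, smul_eq_mul] at h2
      linarith
    exact ⟨hXu u ⟨hu0, le_rfl⟩, S.injS_eq E huT'.2 hpos u ⟨hu0, le_rfl⟩⟩

end Setting

/-! ### Arbitrary evolutions up to `TP`, and the phase table -/

theorem HasDerivAt.le_of_sub_le {φ : ℝ → ℝ} {φ' x a b m : ℝ} (hd : HasDerivAt φ φ' x)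
    (hx : x ∈ Ioo a b)
    (h : ∀ s ∈ Icc a b, ∀ t ∈ Icc a b, s ≤ t → φ t - φ s ≤ m * (t - s)) : φ' ≤ m := by
  have h1 : HasDerivWithinAt (fun t => m * t - φ t) (m * 1 - φ') (Icc a b) x :=
    (((hasDerivAt_id x).const_mul m).sub hd).hasDerivWithinAt
  have h2 := h1.nonneg_of_monotoneOn
    ((uniqueDiffOn_Icc (hx.1.trans hx.2)) x ⟨hx.1.le, hx.2.le⟩).accPt
    fun s hs t ht hst => by have := h s hs t ht hst; linarith
  linarith

/-- Lebesgue differentiation; it turns cumulative bounds into the required almost everywhere bounds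
on arrival rates. -/
theorem ae_le_of_cumul_sub_le {f : ℝ → ℝ} {T a b m : ℝ} (hf : IntervalIntegrable f volume 0 T)
    (ha : 0 ≤ a) (hb : b ≤ T)
    (h : ∀ s ∈ Icc a b, ∀ t ∈ Icc a b, s ≤ t → cumul f t - cumul f s ≤ m * (t - s)) :
    ∀ᵐ t ∂(volume.restrict (Ioo a b)), f t ≤ m := by
  rw [ae_restrict_iff' measurableSet_Ioo]
  filter_upwards [hf.ae_hasDerivAt_integral] with t ht htab
  have hT : 0 ≤ T := ha.trans ((htab.1.trans htab.2).le.trans hb)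
  have := ht (by rw [uIcc_of_le hT]; exact ⟨ha.trans htab.1.le, htab.2.le.trans hb⟩) 0 (by simp)
  exact HasDerivAt.le_of_sub_le this htab h

namespace Setting

variable {p : Params} {φ : ℝ → ℝ → ℝ} {g τ A D : ℝ → ℝ} {e : Evolution}
variable (S : Setting p φ g τ A D) (E : IsEvolution p φ (τ (p.K + p.K')) e)
include S E

theorem recirculated_of_le {u : ℝ} (hu : u ∈ Icc 0 ((p.K : ℝ) / (1 - p.μ₃))) :
    recirculated p e u = D u := by
  have hm := S.early_main E
  have hc := S.course.c_pos
  have h1 := S.course.lt_cumul_sub S.course.T₃_pos le_rfl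
  rw [cumul_zero] at h1
  obtain ⟨v, hv, hvu, hX⟩ := S.early_extend E ⟨S.course.T₃_pos.le, le_rfl⟩
    (fun t ht => (hm t ht).1) (fun t ht => (hm t ht).2) hu (by linarith [hu.2])
  have h2 := S.course.D_eta ((1 - p.μ₃) * v)
  rw [S.course.tau_lin _ (by have := hv.2; rwa [le_div_iff₀' hc] at this),
    mul_div_cancel_left₀ _ hc.ne'] at h2
  rw [hX, hvu, h2]

/-- The value `K - 1` is reached at `T₃` and is the maximum: one unit for each of the first `K - 1`
loops. -/
theorem recirculated_of_ge {u : ℝ} (hu : u ∈ Icc ((p.K : ℝ) / (1 - p.μ₃)) (τ (p.K + p.K'))) :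
    recirculated p e u = p.K - 1 := by
  have h0 := S.course.T₃_pos.le
  refine le_antisymm (S.recirculated_le E ⟨h0.trans hu.1, hu.2⟩) ?_
  rw [← S.course.D_T₃, ← S.recirculated_of_le E ⟨h0, le_rfl⟩]
  exact recirculated_mono E ⟨h0, S.course.T₃_lt.le⟩ ⟨h0.trans hu.1, hu.2⟩ hu.1

theorem one_add_recirculated {u : ℝ} (hu : u ∈ Icc 0 (τ (p.K + p.K'))) :
    1 + recirculated p e u = feed p.K D u := by
  rcases le_total u ((p.K : ℝ) / (1 - p.μ₃)) with h | h
  · rw [S.course.feed_of_le h, S.recirculated_of_le E ⟨hu.1, h⟩]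
  · rw [S.course.feed_of_ge h, S.recirculated_of_ge E ⟨h, hu.2⟩]; ring

theorem total_dep_zero_eq {t : ℝ} (ht : t ∈ Icc 0 (τ (p.K + p.K'))) :
    total (p.classesAt 0) e.dep t = min t (feed p.K D t) := by
  have hc := S.course.c_lt
  have hI : ∀ s ∈ Icc 0 t, p.serviceRate 0 * initialHeight 0 + total (p.classesAt 0) e.arr s
      = feed p.K D s := fun s hs => by
    have hsT : s ∈ Icc 0 (τ (p.K + p.K')) := ⟨hs.1, hs.2.trans ht.2⟩
    rw [S.total_arr_zero E hsT, ← S.one_add_recirculated E hsT]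
    simp [Params.serviceRate, initialHeight]
  have := (E.server 0).total_departure_eq_min (S.serverData E 0) (F := feed p.K D) ht
    (fun s hs => by
      have := S.course.feed_sub_le hs.2
      simp only [Params.serviceRate, Matrix.cons_val_zero]
      nlinarith [hs.2])
    (fun s hs => (hI s hs).le) fun s hs _ => hI s hs
  simpa [Params.serviceRate] using this

theorem total_dep_one_eq {t : ℝ} (ht : t ∈ Icc 0 (τ (p.K + p.K'))) :
    total (p.classesAt 1) e.dep t = min ((1 - p.μ₂) * t) (feed p.K D t) := by
  have hlt := S.μ₂_lt
  have hpos := S.μ₂_pos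
  have hI : ∀ s ∈ Icc 0 t, p.serviceRate 1 * initialHeight 1 + total (p.classesAt 1) e.arr s
      = min s (feed p.K D s) := fun s hs => by
    rw [total_arr_one, S.total_dep_zero_eq E ⟨hs.1, hs.2.trans ht.2⟩]
    simp [initialHeight]
  refine (E.server 1).total_departure_eq_min (S.serverData E 1) (F := feed p.K D) ht
    (fun s hs => ?_) (fun s hs => (hI s hs).trans_le (min_le_right _ _)) fun s hs hlt' => ?_
  · have := S.course.feed_sub_le hs.2
    change _ ≤ (1 - p.μ₂) * _
    nlinarith [hs.2]
  · rw [hI s hs] at hlt' ⊢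
    change _ < (1 - p.μ₂) * _ at hlt'
    -- An input `min s (feed s)` below the slower line `(1 - μ₂) s` cannot be the branch `s`.
    refine min_eq_right (le_of_not_gt fun h => ?_)
    rw [min_eq_left h.le] at hlt'
    nlinarith [hs.1]

theorem total_dep_two_eq {t : ℝ} (ht : t ∈ Icc 0 (τ (p.K + p.K'))) :
    total (p.classesAt 2) e.dep t = min ((1 - p.μ₃) * t) (feed p.K D t) := by
  have hlt := S.μ₂_lt
  have hI : ∀ s ∈ Icc 0 t, p.serviceRate 2 * initialHeight 2 + total (p.classesAt 2) e.arr s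
      = min ((1 - p.μ₂) * s) (feed p.K D s) := fun s hs => by
    rw [total_arr_two, S.total_dep_one_eq E ⟨hs.1, hs.2.trans ht.2⟩]
    simp [initialHeight]
  refine (E.server 2).total_departure_eq_min (S.serverData E 2) (F := feed p.K D) ht
    (fun s hs => S.course.feed_sub_le hs.2) (fun s hs => (hI s hs).trans_le (min_le_right _ _))
    fun s hs hlt' => ?_
  rw [hI s hs] at hlt' ⊢
  change _ < (1 - p.μ₃) * _ at hlt'
  refine min_eq_right (le_of_not_gt fun h => ?_)
  rw [min_eq_left h.le] at hlt'
  nlinarith [hs.1]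

theorem height_zero_eq {t : ℝ} (ht : t ∈ Icc 0 (τ (p.K + p.K'))) :
    e.h 0 t = feed p.K D t - min t (feed p.K D t) := by
  have := (E.server 0).conservation (S.serverData E 0) ht
  rw [S.total_dep_zero_eq E ht, S.total_arr_zero E ht] at this
  rw [← S.one_add_recirculated E ht] at this ⊢
  simpa [Params.serviceRate, initialHeight] using this

theorem height_one_eq {t : ℝ} (ht : t ∈ Icc 0 (τ (p.K + p.K'))) :
    (1 - p.μ₂) * e.h 1 t
      = min t (feed p.K D t) - min ((1 - p.μ₂) * t) (feed p.K D t) := by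
  have := (E.server 1).conservation (S.serverData E 1) ht
  rw [S.total_dep_one_eq E ht, total_arr_one, S.total_dep_zero_eq E ht] at this
  simpa [Params.serviceRate, initialHeight] using this

theorem height_two_eq {t : ℝ} (ht : t ∈ Icc 0 (τ (p.K + p.K'))) :
    (1 - p.μ₃) * e.h 2 t
      = min ((1 - p.μ₂) * t) (feed p.K D t) - min ((1 - p.μ₃) * t) (feed p.K D t) := by
  have := (E.server 2).conservation (S.serverData E 2) ht
  rw [S.total_dep_two_eq E ht, total_arr_two, S.total_dep_one_eq E ht] at this
  simpa [Params.serviceRate, initialHeight] using this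

/-- FIFO for all of `Q₄` minus FIFO for the simple class. -/
theorem horizontal_departure {v : ℝ} (h0 : v ∈ Icc 0 (τ (p.K + p.K')))
    (h1 : v + e.h 3 v ≤ τ (p.K + p.K')) :
    recirculated p e (v + e.h 3 v) + relooped p e (v + e.h 3 v)
        + cumul (e.dep (some (p.visits - 1))) (v + e.h 3 v)
      = total (p.classesAt 2) e.dep v + relooped p e v := by
  have h2 := (E.server 3).total_departure (S.serverData E 3) h0 h1
  rw [S.total_dep_three, S.total_arr_three, dep_none_three E h0 h1] at h2
  simp only [initialHeight, Matrix.cons_val, mul_zero, zero_add] at h2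
  linarith

theorem dep_none_le {u : ℝ} (hu : u ∈ Icc 0 (τ (p.K + p.K'))) :
    cumul (e.dep none) u ≤ cumul e.injS u := by
  have := (E.server 3).cumul_departure_le (S.serverData E 3) (none_mem_classesAt p) hu
  rw [cumul_initialDensity] at this
  simpa [Evolution.arr] using this

/-- The evolution until the fluid has been through `m` small loops. -/
theorem evolution_until {m : ℕ} (hm : m ≤ p.K') :
    (∀ t ∈ Icc 0 (τ (p.K + m)), total (p.classesAt 2) e.dep t + relooped p e t = A t ∧
      e.injS t = g t ∧ t + e.h 3 t = A t + cumul g t) ∧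
    cumul (e.dep (some (4 * p.K - 2 + m))) (τ (p.K + m)) = 1 ∧
    cumul (e.dep (some (4 * p.K - 1 + m))) (τ (p.K + m)) = 0 := by
  have C := S.course
  have hK := C.two_le
  have hK' := C.one_le
  have hv := visits_eq p
  have hT3 := C.T₃_pos.le
  have hT3' := C.T₃_lt.le
  induction m with
  | zero =>
    have hm := S.early_main E
    have he := S.early E ⟨hT3, le_rfl⟩ (fun t ht => (hm t ht).1) (fun t ht => (hm t ht).2)
    simp only [Nat.cast_zero, add_zero, C.tau_K]
    refine ⟨fun t ht => ?_, ?_, (he _ ⟨hT3, le_rfl⟩).2.1⟩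
    · obtain ⟨h1, h2, h3⟩ := he t ht
      have htT : t ∈ Icc 0 (τ (p.K + p.K')) := ⟨ht.1, ht.2.trans hT3'⟩
      have hrel : relooped p e t = 0 := by
        refine le_antisymm ?_ (S.relooped_nonneg E htT)
        refine Finset.sum_nonpos fun i hi => ?_
        have := Finset.mem_range.1 hi
        rw [← h2]
        exact S.dep_antitone E (by omega) (by omega) htT
      rw [C.A_of_le ht.2, h1, hrel]
      exact ⟨add_zero _, (hm t ht).2, h3⟩
    · have htT : (p.K : ℝ) / (1 - p.μ₃) ∈ Icc 0 (τ (p.K + p.K')) := ⟨hT3, hT3'⟩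
      have h1 := (he _ ⟨hT3, le_rfl⟩).1
      rw [mul_div_cancel₀ _ C.c_pos.ne', total_dep_of_lt p e 2 (by decide)] at h1
      refine le_antisymm (S.dep_le_one E (by omega) htT) ?_
      obtain ⟨n, hn⟩ : ∃ n, p.K = n + 1 := ⟨p.K - 1, by omega⟩
      rw [hn, Finset.sum_range_succ, ← hn] at h1
      have h2 : ∑ k ∈ Finset.range n, cumul (e.dep (some (4 * k + ((2 : Fin 4) : ℕ))))
          ((p.K : ℝ) / (1 - p.μ₃)) ≤ n := by
        calc _ ≤ ∑ _k ∈ Finset.range n, (1 : ℝ) := Finset.sum_le_sum fun k hk => by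
              have hk' := Finset.mem_range.1 hk
              change cumul (e.dep (some (4 * k + 2))) _ ≤ _
              exact S.dep_le_one E (by omega) htT
          _ = n := by simp
      have h3 : 4 * p.K - 2 = 4 * n + 2 := by omega
      rw [h3]
      change _ + cumul (e.dep (some (4 * n + 2))) _ = _ at h1
      have h4 : (p.K : ℝ) = n + 1 := by rw [hn]; push_cast; ring
      linarith
  | succ m ih =>
    obtain ⟨ih1, ih2, ih3⟩ := ih (by omega)
    have hmK : (m : ℝ) + 1 ≤ p.K' := by exact_mod_cast hm
    have hm0 : (0 : ℝ) ≤ m := Nat.cast_nonneg m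
    push_cast
    set w := τ (p.K + m) with hw
    set w' := τ (p.K + (m + 1)) with hw'
    have hw0 : 0 ≤ w := by
      rw [← C.tau_zero]; exact C.tau_strictMono.monotone (by positivity)
    have hww : w ≤ w' := C.tau_strictMono.monotone (by linarith)
    have hwT : w' ≤ τ (p.K + p.K') := C.tau_strictMono.monotone (by linarith)
    have hwm : w ∈ Icc 0 (τ (p.K + p.K')) := ⟨hw0, hww.trans hwT⟩
    have hwm' : w' ∈ Icc 0 (τ (p.K + p.K')) := ⟨hw0.trans hww, hwT⟩
    have hstep : w + e.h 3 w = w' := by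
      rw [(ih1 w ⟨hw0, le_rfl⟩).2.2, hw, C.A_tau, hw', ← add_assoc]
      exact (C.tau_step _ (by linarith) (by linarith)).symm
    have hstep' : w + e.h 3 w ≤ τ (p.K + p.K') := hstep.le.trans hwT
    -- Stop `4 * K - 2` is the last one at `Q₃`, and all later stops are at `Q₄`. At each time `τ (K
    -- + m)` the whole unit has left stop `4 * K - 2 + m` and none of it has left the next one, so
    -- the delay of `Q₄` advances it by one stop.
    have hone : cumul (e.dep (some (4 * p.K - 2 + (m + 1)))) w' = 1 := by
      rw [← hstep, ← add_assoc, dep_succ_three E (mem_three p (by omega) (by omega) (by omega))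
        hwm hstep', ih2]
    have hzero : cumul (e.dep (some (4 * p.K - 1 + (m + 1)))) w' = 0 := by
      rw [← hstep, ← add_assoc, dep_succ_three E (mem_three p (by omega) (by omega) (by omega))
        hwm hstep', ih3]
    have hwT3 : (p.K : ℝ) / (1 - p.μ₃) ≤ w := by
      rw [← C.tau_K]; exact C.tau_strictMono.monotone (by linarith)
    -- the fluid that leaves `Q₄` at time `u ∈ [w, w']`
    have hdep : ∀ u ∈ Icc w w', ∃ v ∈ Icc 0 w, v ≤ u ∧ v + e.h 3 v = u ∧ A v = D u := by
      intro u hu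
      have hDu : D u ≤ p.K + m := by
        have h1 := C.D_mono _ _ hu.2
        rw [hw', C.D_tau (by linarith) (by linarith)] at h1
        linarith
      have hv0 : 0 ≤ τ (D u) := by
        rw [← C.tau_zero]
        exact C.tau_strictMono.monotone (C.D_nonneg (hw0.trans hu.1))
      have hvw : τ (D u) ≤ w := C.tau_strictMono.monotone hDu
      refine ⟨τ (D u), ⟨hv0, hvw⟩, hvw.trans hu.1, ?_, C.A_tau _⟩
      rw [(ih1 _ ⟨hv0, hvw⟩).2.2, C.A_tau, C.eta_D]
    have hlate : ∀ u ∈ Icc w w', total (p.classesAt 2) e.dep u + relooped p e u = A u ∧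
        recirculated p e u + relooped p e u + cumul (e.dep (some (p.visits - 1))) u = D u := by
      intro u hu
      obtain ⟨v, hv, hvu', hvu, hAv⟩ := hdep u hu
      have huT : u ∈ Icc 0 (τ (p.K + p.K')) := ⟨hw0.trans hu.1, hu.2.trans hwT⟩
      have hvT : v ∈ Icc 0 (τ (p.K + p.K')) := ⟨hv.1, hvu'.trans huT.2⟩
      have h1 := S.horizontal_departure E hvT (hvu.le.trans huT.2)
      rw [hvu, (ih1 v hv).1, hAv] at h1
      refine ⟨?_, h1⟩
      -- The last stop is not before stop `4 * K - 1 + (m + 1)`, which no fluid has left by `w'`; so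
      -- nothing has left the gadget for good.
      have h2 : cumul (e.dep (some (p.visits - 1))) u = 0 := by
        refine le_antisymm ?_ (dep_nonneg' E (by omega) huT)
        calc _ ≤ cumul (e.dep (some (p.visits - 1))) w' := mono_dep E (by omega) huT hwm' hu.2
          _ ≤ cumul (e.dep (some (4 * p.K - 1 + (m + 1)))) w' :=
            S.dep_antitone E (by omega) (by omega) hwm'
          _ = 0 := hzero
      rw [h2, S.recirculated_of_ge E ⟨hwT3.trans hu.1, huT.2⟩] at h1
      rw [S.total_dep_two_eq E huT, C.min_line_feed' (hwT3.trans hu.1),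
        C.A_of_ge (hwT3.trans hu.1) huT.2]
      linarith
    have hpos : ∀ u ∈ Ioc 0 w', 0 < e.h 3 u := by
      intro u hu
      have huT : u ∈ Icc 0 (τ (p.K + p.K')) := ⟨hu.1.le, hu.2.trans hwT⟩
      rcases le_total u w with h | h
      · have h1 := (ih1 u ⟨hu.1.le, h⟩).2.2
        have h2 := C.height₄_pos hu.1 huT.2
        linarith
      · obtain ⟨h1, h2⟩ := hlate u ⟨h, hu.2⟩
        have h3 := S.height_three_eq E huT
        rw [S.total_dep_three, h1, h2] at h3
        have h4 := S.dep_none_le E huT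
        have h5 := C.D_lt_A hu.1 huT.2
        linarith
    have hinj := S.injS_eq E hwT hpos
    refine ⟨fun t ht => ?_, hone, hzero⟩
    rcases le_total t w with h | h
    · exact ih1 t ⟨ht.1, h⟩
    · have htT : t ∈ Icc 0 (τ (p.K + p.K')) := ⟨ht.1, ht.2.trans hwT⟩
      obtain ⟨h1, h2⟩ := hlate t ⟨h, ht.2⟩
      refine ⟨h1, hinj t ht, ?_⟩
      rw [S.height_three_eq E htT, h1,
        S.total_dep_three_eq E htT fun u hu => hpos u ⟨hu.1, hu.2.le.trans ht.2⟩,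
        cumul_congr ht.1 fun u hu => hinj u ⟨hu.1, hu.2.trans ht.2⟩]
      ring

theorem evolution_eq {t : ℝ} (ht : t ∈ Icc 0 (τ (p.K + p.K'))) :
    e.injS t = g t ∧ e.h 3 t = A t + cumul g t - t := by
  obtain ⟨-, h1, h2⟩ := (S.evolution_until E le_rfl).1 t ht
  exact ⟨h1, by linarith⟩

theorem end_stored {c : Option ℕ} (hc : c ∈ p.classes) :
    e.stored p c (τ (p.K + p.K')) = if c = some (p.visits - 1) then 1 else 0 := by
  have C := S.course
  have hK := C.two_le
  have hK' := C.one_le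
  have hK'c := C.one_le_cast
  have hKc := C.two_le_cast
  have hv := visits_eq p
  have hT : τ (p.K + p.K') ∈ Icc 0 (τ (p.K + p.K')) := ⟨C.TP_pos.le, le_rfl⟩
  obtain ⟨h1, h2, h3⟩ := S.evolution_until E le_rfl
  have hdone : ∀ j, j + 1 < p.visits → cumul (e.dep (some j)) (τ (p.K + p.K')) = 1 := fun j hj => by
    refine le_antisymm (S.dep_le_one E (by omega) hT) ?_
    rw [← h2]
    exact S.dep_antitone E (by omega) (by omega) hT
  rcases c with _ | j
  · rw [stored_none]
    -- Simple fluid injected before `v` has left by the end, and `g` is zero from `v` on.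
    set v := τ (p.K + p.K' - 1) with hv'
    have hv0 : 0 ≤ v := by
      rw [← C.tau_zero]; exact C.tau_strictMono.monotone (by linarith)
    have hvT : v ≤ τ (p.K + p.K') := C.tau_strictMono.monotone (by linarith)
    have hstep : v + e.h 3 v = τ (p.K + p.K') := by
      rw [(h1 v ⟨hv0, hvT⟩).2.2, hv', C.A_tau, ← C.tau_step _ (by linarith) le_rfl,
        sub_add_cancel]
    have h4 := dep_none_three E ⟨hv0, hvT⟩ hstep.le
    rw [hstep] at h4
    rw [h4, cumul_congr hT.1 fun u hu => (h1 u hu).2.1,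
      cumul_congr hv0 fun u hu => (h1 u ⟨hu.1, hu.2.trans hvT⟩).2.1,
      cumul_eq_of_antitone C.g_cont C.g_anti C.g_nonneg hvT C.g_zero]
    simp
  · rw [mem_classes] at hc
    have h0 := cumul_initialDensity (some j) (initialHeight (p.serverOf (some j)))
    change cumul (initialDensity (some j)) _ + cumul (e.arr (some j)) _ - cumul (e.dep (some j)) _ = _
    have harr : cumul (initialDensity (some j)) (initialHeight (p.serverOf (some j)))
        + cumul (e.arr (some j)) (τ (p.K + p.K')) = 1 := by
      rw [h0]
      rcases j with _ | j
      · rw [cumul_injH E hT]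
        have h3 : p.serverOf (some 0) = 0 := by
          unfold Params.serverOf
          dsimp only
          rw [if_pos (by omega)]; rfl
        rw [h3]; simp [initialHeight]
      · simpa [Evolution.arr] using hdone j hc
    rw [harr]
    by_cases hj : j = p.visits - 1
    · have h5 : 4 * p.K - 1 + p.K' = p.visits - 1 := by omega
      rw [h5] at h3
      rw [hj, h3]; simp
    · rw [hdone j (by omega)]
      simp [hj]

theorem phaseTable {T₁ T₂ : ℝ} (h1 : 0 < T₁) (h12 : T₁ < T₂) (h23 : T₂ < p.K / (1 - p.μ₃))
    (hT1 : ∀ t, t ≤ T₁ → t ≤ feed p.K D t) (hT1' : ∀ t, T₁ ≤ t → feed p.K D t ≤ t)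
    (hT2 : ∀ t, t ≤ T₂ → (1 - p.μ₂) * t ≤ feed p.K D t)
    (hT2' : ∀ t, T₂ ≤ t → feed p.K D t ≤ (1 - p.μ₂) * t) :
    PhaseTable p T₁ T₂ (p.K / (1 - p.μ₃)) (τ (p.K + p.K')) e := by
  have C := S.course
  have hlt := S.μ₂_lt
  have hpos := S.μ₂_pos
  have hc := C.c_pos
  have hc2 : 0 < 1 - p.μ₂ := by linarith
  have h3P := C.T₃_lt
  have hT0 : (0 : ℝ) ∈ Icc 0 (τ (p.K + p.K')) := ⟨le_rfl, C.TP_pos.le⟩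
  have hmem : ∀ {a b t : ℝ}, 0 ≤ a → b ≤ p.K / (1 - p.μ₃) → t ∈ Icc a b →
      t ∈ Icc 0 (τ (p.K + p.K')) := fun ha hb ht =>
    ⟨ha.trans ht.1, ht.2.trans (hb.trans h3P.le)⟩
  have e0 : ∀ t ∈ Icc 0 (τ (p.K + p.K')), t ≤ T₁ → e.h 0 t = feed p.K D t - t := fun t ht h => by
    rw [S.height_zero_eq E ht, min_eq_left (hT1 t h)]
  have e0' : ∀ t ∈ Icc 0 (τ (p.K + p.K')), T₁ ≤ t → e.h 0 t = 0 := fun t ht h => by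
    rw [S.height_zero_eq E ht, min_eq_right (hT1' t h), sub_self]
  have e1 : ∀ t ∈ Icc 0 (τ (p.K + p.K')), t ≤ T₁ → (1 - p.μ₂) * e.h 1 t = p.μ₂ * t :=
    fun t ht h => by
      rw [S.height_one_eq E ht, min_eq_left (hT1 t h), min_eq_left (hT2 t (h.trans h12.le))]; ring
  have e1' : ∀ t ∈ Icc 0 (τ (p.K + p.K')), T₁ ≤ t → t ≤ T₂ →
      (1 - p.μ₂) * e.h 1 t = feed p.K D t - (1 - p.μ₂) * t := fun t ht h h' => by
    rw [S.height_one_eq E ht, min_eq_right (hT1' t h), min_eq_left (hT2 t h')]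
  have e1'' : ∀ t ∈ Icc 0 (τ (p.K + p.K')), T₂ ≤ t → e.h 1 t = 0 := fun t ht h => by
    have := S.height_one_eq E ht
    rw [min_eq_right (hT1' t (h12.le.trans h)), min_eq_right (hT2' t h), sub_self] at this
    exact (mul_eq_zero.1 this).resolve_left hc2.ne'
  have e2 : ∀ t ∈ Icc 0 (τ (p.K + p.K')), t ≤ T₂ → (1 - p.μ₃) * e.h 2 t = (p.μ₃ - p.μ₂) * t :=
    fun t ht h => by
      rw [S.height_two_eq E ht, min_eq_left (hT2 t h), C.min_line_feed (h.trans h23.le)]; ring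
  have e2' : ∀ t ∈ Icc 0 (τ (p.K + p.K')), T₂ ≤ t → t ≤ p.K / (1 - p.μ₃) →
      (1 - p.μ₃) * e.h 2 t = feed p.K D t - (1 - p.μ₃) * t := fun t ht h h' => by
    rw [S.height_two_eq E ht, min_eq_right (hT2' t h), C.min_line_feed h']
  have e2'' : ∀ t ∈ Icc 0 (τ (p.K + p.K')), p.K / (1 - p.μ₃) ≤ t → e.h 2 t = 0 := fun t ht h => by
    have := S.height_two_eq E ht
    rw [min_eq_right (hT2' t (h23.le.trans h)), C.min_line_feed' h, C.feed_of_ge h, sub_self] at this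
    exact (mul_eq_zero.1 this).resolve_left hc.ne'
  have e3 : StrictMonoOn (e.h 3) (Icc 0 (p.K / (1 - p.μ₃))) := fun s hs t ht hst => by
    rw [(S.evolution_eq E (hmem le_rfl le_rfl hs)).2, (S.evolution_eq E (hmem le_rfl le_rfl ht)).2,
      C.height₄_of_le hs.2, C.height₄_of_le ht.2]
    have := C.lt_cumul_sub hst ht.2
    linarith
  have hTT : τ (p.K + p.K') ∈ Icc 0 (τ (p.K + p.K')) := ⟨C.TP_pos.le, le_rfl⟩
  have m0 : ∀ {t}, t ∈ Icc 0 T₁ → t ∈ Icc 0 (τ (p.K + p.K')) := hmem le_rfl (h12.trans h23).le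
  have m1 : ∀ {t}, t ∈ Icc T₁ T₂ → t ∈ Icc 0 (τ (p.K + p.K')) := hmem h1.le h23.le
  have m2 : ∀ {t}, t ∈ Icc T₂ (p.K / (1 - p.μ₃)) → t ∈ Icc 0 (τ (p.K + p.K')) :=
    hmem (h1.trans h12).le le_rfl
  have m3 : ∀ {t}, t ∈ Icc (p.K / (1 - p.μ₃)) (τ (p.K + p.K')) → t ∈ Icc 0 (τ (p.K + p.K')) :=
    fun ht => ⟨C.T₃_pos.le.trans ht.1, ht.2⟩
  -- From `T₁` on `Q₁` is empty, so `Q₂` receives exactly what enters `Q₁`.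
  have harr : ∀ t ∈ Icc T₁ (τ (p.K + p.K')),
      cumul (fun t => ∑ c ∈ p.classesAt 1, e.arr c t) t = feed p.K D t := fun t ht => by
    have htT : t ∈ Icc 0 (τ (p.K + p.K')) := ⟨h1.le.trans ht.1, ht.2⟩
    have h4 := IsFIFOServer.total_sub (S.serverData E 1) hT0 htT
    rw [total_arr_one, total_arr_one, S.total_dep_zero_eq E htT, S.total_dep_zero_eq E hT0,
      min_eq_right (hT1' t ht.1), min_eq_left (hT1 0 h1.le), sub_zero] at h4
    exact h4.symm
  have hint := IsFIFOServer.total_int (S.serverData E 1)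
  constructor
  · exact fun q => (E.server q).height_zero (S.serverData E q)
  · intro c hc
    have h0 := cumul_initialDensity c (initialHeight (p.serverOf c))
    change cumul (initialDensity c) _ + cumul (e.arr c) 0 - cumul (e.dep c) 0 = _
    rw [h0, cumul_zero, cumul_zero, add_zero, sub_zero]
    split_ifs with h
    · subst h
      have h3 : p.serverOf (some 0) = 0 := by
        unfold Params.serverOf
        dsimp only
        rw [if_pos (by have := C.two_le; omega)]; rfl
      rw [h3]; simp [initialHeight]
    · rfl
  · exact E.control.initial
  · intro s hs t ht hst
    rw [e0 s (m0 hs) hs.2, e0 t (m0 ht) ht.2]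
    have := C.feed_sub_le hst.le
    have := C.c_lt
    nlinarith
  · intro s hs t ht hst
    have := e1 s (m0 hs) hs.2
    have := e1 t (m0 ht) ht.2
    refine lt_of_mul_lt_mul_left ?_ hc2.le
    nlinarith
  · intro s hs t ht hst
    have := e2 s (m0 hs) (hs.2.trans h12.le)
    have := e2 t (m0 ht) (ht.2.trans h12.le)
    refine lt_of_mul_lt_mul_left ?_ hc.le
    nlinarith
  · exact e3.mono (Icc_subset_Icc_right (h12.trans h23).le)
  · exact fun t ht => e0' t (m1 ht) ht.1
  · intro s hs t ht hst
    have h5 := e1' s (m1 hs) hs.1 hs.2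
    have h6 := e1' t (m1 ht) ht.1 ht.2
    have := C.feed_sub_le hst.le
    refine lt_of_mul_lt_mul_left ?_ hc2.le
    nlinarith
  · intro s hs t ht hst
    have := e2 s (m1 hs) hs.2
    have := e2 t (m1 ht) ht.2
    refine lt_of_mul_lt_mul_left ?_ hc.le
    nlinarith
  · exact e3.mono (Icc_subset_Icc h1.le h23.le)
  · exact fun t ht => e0' t (m2 ht) (h12.le.trans ht.1)
  · exact fun t ht => e1'' t (m2 ht) ht.1
  · intro s hs t ht hst
    have h5 := e2' s (m2 hs) hs.1 hs.2
    have h6 := e2' t (m2 ht) ht.1 ht.2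
    have := C.feed_sub_lt hst ht.2
    refine lt_of_mul_lt_mul_left ?_ hc.le
    linarith
  · exact e3.mono (Icc_subset_Icc_left (h1.trans h12).le)
  · rw [(S.evolution_eq E ⟨C.T₃_pos.le, h3P.le⟩).1]
    exact S.rate
  · exact fun t ht => e0' t (m3 ht) ((h12.trans h23).le.trans ht.1)
  · exact fun t ht => e1'' t (m3 ht) (h23.le.trans ht.1)
  · exact fun t ht => e2'' t (m3 ht) ht.1
  · intro t ht
    rw [(S.evolution_eq E (m3 ht)).2]
    exact C.one_le_height₄ ht.1 ht.2
  · rw [(S.evolution_eq E hTT).2]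
    exact C.height₄_TP
  · exact fun c hc => S.end_stored E hc
  · rw [(S.evolution_eq E hTT).1]
    exact C.g_TP
  · refine ae_le_of_cumul_sub_le hint h1.le h3P.le fun s hs t ht hst => ?_
    rw [harr s ⟨hs.1, hs.2.trans h3P.le⟩, harr t ⟨ht.1, ht.2.trans h3P.le⟩]
    exact C.feed_sub_le hst
  · have h13 := (h12.trans h23).le
    have h4 : ∀ᵐ t ∂(volume.restrict (Ioo (p.K / (1 - p.μ₃)) (τ (p.K + p.K')))),
        ∑ c ∈ p.classesAt 1, e.arr c t ≤ 0 := by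
      refine ae_le_of_cumul_sub_le hint C.T₃_pos.le le_rfl fun s hs t ht hst => ?_
      rw [harr s ⟨h13.trans hs.1, hs.2⟩, harr t ⟨h13.trans ht.1, ht.2⟩, C.feed_of_ge hs.1,
        C.feed_of_ge ht.1]
      simp
    filter_upwards [h4, ae_restrict_mem measurableSet_Ioo] with t ht htm
    exact le_antisymm ht (Finset.sum_nonneg fun c hc =>
      (S.serverData E 1).a_nonneg c hc t (m3 ⟨htm.1.le, htm.2.le⟩))

end Setting

/-! ### Existence: the evolution built from cumulative flows -/

/-- A cumulative flow of rate at most one. -/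
structure IsFlow (f : ℝ → ℝ) : Prop where
  mono : ∀ s t, s ≤ t → 0 ≤ f t - f s
  slow : ∀ s t, s ≤ t → f t - f s ≤ t - s

namespace IsFlow

variable {f f₂ : ℝ → ℝ}

theorem lipschitz (h : IsFlow f) : LipschitzWith 1 f := Course.lipschitz_of_sub h.mono h.slow

theorem monotone (h : IsFlow f) : Monotone f := fun s t hst => sub_nonneg.1 (h.mono s t hst)

theorem absolutelyContinuous (h : IsFlow f) (a b : ℝ) : AbsolutelyContinuousOnInterval f a b :=
  (h.lipschitz.lipschitzOnWith (s := uIcc a b)).absolutelyContinuousOnInterval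

/-- Lipschitz functions are absolutely continuous, so departure rates may be defined as `deriv` of
cumulative departures without loss. -/
theorem cumul_deriv (h : IsFlow f) (t : ℝ) : cumul (deriv f) t = f t - f 0 :=
  (h.absolutelyContinuous 0 t).integral_deriv_eq_sub

theorem ae_hasDerivAt (h : IsFlow f) : ∀ᵐ t, HasDerivAt f (deriv f t) t := by
  filter_upwards [h.lipschitz.ae_differentiableAt_real] with t ht using ht.hasDerivAt

theorem min (h : IsFlow f) (h₂ : IsFlow f₂) : IsFlow fun t => min (f t) (f₂ t) := by
  constructor
  · intro s t hst
    exact sub_nonneg.2 (min_le_min (h.monotone hst) (h₂.monotone hst))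
  · intro s t hst
    have h1 := h.slow s t hst
    have h2 := h₂.slow s t hst
    rcases min_choice (f s) (f₂ s) with h3 | h3 <;> rw [h3]
    · linarith [min_le_left (f t) (f₂ t)]
    · linarith [min_le_right (f t) (f₂ t)]

theorem mul_id {c : ℝ} (h0 : 0 ≤ c) (h1 : c ≤ 1) : IsFlow fun t => c * t :=
  ⟨fun s t hst => by nlinarith, fun s t hst => by nlinarith⟩

theorem const (c : ℝ) : IsFlow fun _ => c :=
  ⟨fun s t _ => by simp, fun s t hst => by simpa using hst⟩

theorem level (h : IsFlow f) (k : ℕ) : IsFlow fun t => level k (f t) := by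
  constructor
  · intro s t hst
    have := h.monotone hst
    exact sub_nonneg.2 (max_le_max le_rfl (min_le_min le_rfl (by linarith)))
  · intro s t hst
    have h1 := h.slow s t hst
    have h2 := h.monotone hst
    unfold BasicGadget.level
    rcases le_total (f s - k) 0 with h3 | h3
    · rw [max_eq_left (a := 0) (b := Min.min 1 (f s - k)) ((min_le_right _ _).trans h3), sub_zero]
      exact max_le (by linarith) ((min_le_right _ _).trans (by linarith))
    · rcases le_total 1 (f s - k) with h4 | h4
      · rw [min_eq_left h4, min_eq_left (by linarith)]; linarith
      · rw [min_eq_right h4, max_eq_right h3]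
        have h5 : max 0 (Min.min 1 (f t - k)) ≤ f t - k :=
          max_le (by linarith) (min_le_right _ _)
        linarith

end IsFlow

theorem level_add_one (k : ℕ) (x : ℝ) : level (k + 1) (1 + x) = level k x := by
  unfold level; push_cast; ring_nf

theorem level_of_ge {k : ℕ} {x : ℝ} (h : k + 1 ≤ x) : level k x = 1 := by
  unfold level; rw [min_eq_left (by linarith), max_eq_right zero_le_one]

theorem level_of_le {k : ℕ} {x : ℝ} (h : x ≤ k) : level k x = 0 := by
  unfold level; exact max_eq_left ((min_le_right _ _).trans (by linarith))

theorem level_min {k K : ℕ} (h : k < K) (x : ℝ) : level k (min x K) = level k x := by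
  have h1 : (k : ℝ) + 1 ≤ K := by exact_mod_cast h
  rcases le_total x K with h2 | h2
  · rw [min_eq_left h2]
  · rw [min_eq_right h2, level_of_ge h1, level_of_ge (h1.trans h2)]

theorem sum_level {x : ℝ} (hx : 0 ≤ x) (n : ℕ) : ∑ k ∈ Finset.range n, level k x = min x n := by
  induction n with
  | zero => simp [hx]
  | succ n ih =>
    rw [Finset.sum_range_succ, ih]
    push_cast
    rcases le_total x n with h | h
    · rw [level_of_le h, min_eq_left h, min_eq_left (by linarith)]; ring
    · rw [min_eq_right h]
      rcases le_total x (n + 1) with h1 | h1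
      · rw [min_eq_left h1]
        unfold level
        rw [min_eq_right (by linarith), max_eq_right (by linarith)]; ring
      · rw [min_eq_right h1, level_of_ge h1]

/-- A height that satisfies the conservation law and an output at full rate whenever the server
is not empty solve the equation of motion. -/
theorem height_of_conservation {μ T : ℝ} (hμ : 0 < μ) {h I O a : ℝ → ℝ}
    (hac : AbsolutelyContinuousOnInterval h 0 T) (hn : ∀ t ∈ Icc 0 T, 0 ≤ h t)
    (hcons : ∀ t ∈ Ioo 0 T, μ * h t = I t - O t)
    (hI : ∀ᵐ t, HasDerivAt I (a t) t)
    (hO : ∀ s ∈ Icc 0 T, ∀ t ∈ Icc 0 T, s ≤ t → O t - O s ≤ μ * (t - s))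
    (hbusy : ∀ t ∈ Ioo 0 T, 0 < h t → ∀ᶠ s in nhds t, O s = μ * s) :
    ∀ t ∈ Icc 0 T, h t = h 0 + ∫ s in (0 : ℝ)..t, heightRate μ (h s) (a s) := by
  intro t ht
  have hT : 0 ≤ T := ht.1.trans ht.2
  have hsub : uIcc 0 t ⊆ uIcc 0 T := by
    rw [uIcc_of_le ht.1, uIcc_of_le hT]; exact Icc_subset_Icc_right ht.2
  have hftc := (hac.mono hsub).integral_deriv_eq_sub
  rw [eq_comm, ← eq_sub_iff_add_eq', ← hftc]
  refine intervalIntegral.integral_congr_ae ?_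
  have hne : ∀ᵐ u : ℝ, u ≠ T := by simp [ae_iff, measure_singleton]
  filter_upwards [hac.ae_differentiableAt, hI, hne] with u hu hIu huT hmem
  rw [uIoc_of_le ht.1] at hmem
  have huo : u ∈ Ioo 0 T := ⟨hmem.1, (hmem.2.trans ht.2).lt_of_ne huT⟩
  have hd := (hu (by rw [uIcc_of_le hT]; exact ⟨huo.1.le, huo.2.le⟩)).hasDerivAt
  have hOd : HasDerivAt O (a u - μ * deriv h u) u := by
    refine (hIu.sub (hd.const_mul μ)).congr_of_eventuallyEq ?_
    filter_upwards [Ioo_mem_nhds huo.1 huo.2] with v hv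
    have := hcons v hv
    simp only [Pi.sub_apply]
    linarith
  have hle := HasDerivAt.le_of_sub_le hOd huo hO
  unfold heightRate
  split_ifs with hpos
  · have h1 : HasDerivAt O (μ * 1) u :=
      ((hasDerivAt_id u).const_mul μ).congr_of_eventuallyEq (hbusy u huo hpos)
    have h2 := hOd.unique h1
    field_simp
    linarith
  · have h0 : h u = 0 := le_antisymm (not_lt.1 hpos) (hn u ⟨huo.1.le, huo.2.le⟩)
    -- At an empty time `h` is minimal, so `h' = 0` and the output rate equals `a u`. It is at most
    -- `μ`, hence the truncated rate is `0` as well.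
    have hmin : IsLocalMin h u := by
      filter_upwards [Ioo_mem_nhds huo.1 huo.2] with v hv
      rw [h0]; exact hn v ⟨hv.1.le, hv.2.le⟩
    have h1 := hmin.hasDerivAt_eq_zero hd
    rw [h1] at hle ⊢
    refine max_eq_right ?_
    rw [sub_nonpos, div_le_one hμ]; linarith

/-- Horizontal fluid that has departed from the servers, counting every visit. -/
noncomputable def passed (p : Params) (D : ℝ → ℝ) (q : ℕ) (t : ℝ) : ℝ :=
  match q with
  | 0 => min (1 * t) (feed p.K D t)
  | 1 => min ((1 - p.μ₂) * t) (feed p.K D t)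
  | 2 => min ((1 - p.μ₃) * t) (feed p.K D t)
  | _ => D t

/-- Cumulative departures of the classes. -/
noncomputable def departed (p : Params) (D : ℝ → ℝ) : Option ℕ → ℝ → ℝ
  -- `Q₄` has rate one and is always busy, so the simple session gets what the horizontal fluid
  -- leaves.
  | none, t => t - D t
  | some j, t => if j < 4 * p.K then level (j / 4) (passed p D (j % 4) t)
      else level (j - 3 * p.K) (D t)

/-- Cumulative arrivals of the classes. -/
noncomputable def arrived (p : Params) (g D : ℝ → ℝ) : Option ℕ → ℝ → ℝ
  | none => cumul g
  | some 0 => fun _ => 0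
  | some (j + 1) => departed p D (some j)

/-- The evolution that belongs to a course of events. -/
noncomputable def canonical (p : Params) (g A D : ℝ → ℝ) : Evolution where
  h := ![fun t => (feed p.K D t - passed p D 0 t) / 1,
    fun t => (passed p D 0 t - passed p D 1 t) / (1 - p.μ₂),
    fun t => (passed p D 1 t - passed p D 2 t) / (1 - p.μ₃),
    fun t => A t + cumul g t - t]
  dep c := deriv (departed p D c)
  injH _ := 0
  injS := g

namespace Setting

variable {p : Params} {φ : ℝ → ℝ → ℝ} {g τ A D : ℝ → ℝ}

theorem D_flow (S : Setting p φ g τ A D) : IsFlow D := ⟨S.course.D_mono, S.course.D_lip⟩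

theorem A_flow (S : Setting p φ g τ A D) : IsFlow A := ⟨S.course.A_mono, S.course.A_lip⟩

theorem feed_flow (S : Setting p φ g τ A D) : IsFlow (feed p.K D) := by
  have h : IsFlow fun t => 1 + D t := ⟨fun s t hst => by linarith [S.course.D_mono s t hst],
    fun s t hst => by linarith [S.course.D_lip s t hst]⟩
  exact h.min (IsFlow.const _)

theorem passed_flow (S : Setting p φ g τ A D) (q : ℕ) : IsFlow (passed p D q) := by
  have h1 := S.μ₂_pos
  have h2 := S.μ₂_lt
  have h3 := S.course.c_pos
  match q with
  | 0 => exact (IsFlow.mul_id zero_le_one le_rfl).min S.feed_flow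
  | 1 => exact (IsFlow.mul_id (by linarith) (by linarith)).min S.feed_flow
  | 2 => exact (IsFlow.mul_id (by linarith) (by linarith)).min S.feed_flow
  | _ + 3 => exact S.D_flow

theorem departed_flow (S : Setting p φ g τ A D) (c : Option ℕ) : IsFlow (departed p D c) := by
  rcases c with _ | j
  · exact ⟨fun s t hst => by simp only [departed]; linarith [S.course.D_lip s t hst],
      fun s t hst => by simp only [departed]; linarith [S.course.D_mono s t hst]⟩
  · by_cases h : j < 4 * p.K
    · rw [show departed p D (some j) = fun t => BasicGadget.level (j / 4) (passed p D (j % 4) t) by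
        ext t; simp [departed, h]]
      exact (S.passed_flow _).level _
    · rw [show departed p D (some j) = fun t => BasicGadget.level (j - 3 * p.K) (D t) by
        ext t; simp [departed, h]]
      exact S.D_flow.level _

theorem passed_zero (S : Setting p φ g τ A D) (q : ℕ) : passed p D q 0 = 0 := by
  match q with
  | 0 => simp [passed, S.course.feed_zero]
  | 1 => simp [passed, S.course.feed_zero]
  | 2 => simp [passed, S.course.feed_zero]
  | _ + 3 => exact S.course.D_zero

theorem departed_zero (S : Setting p φ g τ A D) (c : Option ℕ) : departed p D c 0 = 0 := by
  rcases c with _ | j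
  · simp [departed, S.course.D_zero]
  · simp only [departed]
    split_ifs
    · rw [S.passed_zero]; exact level_of_le (Nat.cast_nonneg _)
    · rw [S.course.D_zero]; exact level_of_le (Nat.cast_nonneg _)

theorem cumul_dep (S : Setting p φ g τ A D) (c : Option ℕ) (t : ℝ) :
    cumul ((canonical p g A D).dep c) t = departed p D c t := by
  change cumul (deriv (departed p D c)) t = _
  rw [(S.departed_flow c).cumul_deriv, S.departed_zero, sub_zero]

theorem cumul_arr (S : Setting p φ g τ A D) (c : Option ℕ) (t : ℝ) :
    cumul ((canonical p g A D).arr c) t = arrived p g D c t := by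
  rcases c with _ | _ | j
  · rfl
  · change cumul (fun _ => 0) t = 0
    simp [cumul]
  · exact S.cumul_dep _ _

theorem arrived_hasDerivAt (S : Setting p φ g τ A D) :
    ∀ᵐ t, ∀ c, HasDerivAt (arrived p g D c) ((canonical p g A D).arr c t) t := by
  rw [ae_all_iff]
  intro c
  rcases c with _ | _ | j
  · exact Filter.Eventually.of_forall fun t => cumul_hasDerivAt S.course.g_cont t
  · exact Filter.Eventually.of_forall fun t => hasDerivAt_const t (0 : ℝ)
  · exact (S.departed_flow (some j)).ae_hasDerivAt

theorem departed_of_lt (p : Params) (D : ℝ → ℝ) {k q : ℕ} (hk : k < p.K) (hq : q < 4) :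
    departed p D (some (4 * k + q)) = fun t => level k (passed p D q t) := by
  ext t
  simp only [departed]
  rw [if_pos (by omega), show (4 * k + q) / 4 = k by omega, show (4 * k + q) % 4 = q by omega]

theorem departed_visit (p : Params) (D : ℝ → ℝ) (m : ℕ) :
    departed p D (some (visit p.K m)) = fun t => level m (D t) := by
  unfold visit
  split_ifs with h
  · rw [departed_of_lt p D h (by norm_num)]; rfl
  · ext t
    simp only [departed]
    rw [if_neg (by omega), show 3 * p.K + m - 3 * p.K = m by omega]

/-- The equations of the first three servers. -/
theorem isFIFOServer_of_lt (S : Setting p φ g τ A D) (q : Fin 4) (hq : q < 3) {I : ℝ → ℝ}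
    (hI : IsFlow I) (hI0 : I 0 = initialHeight q) (hIF : ∀ t, 0 ≤ t → I t ≤ feed p.K D t)
    (hIeq : ∀ t, 0 ≤ t → I t < p.serviceRate q * t → I t = feed p.K D t)
    (hrate : 1 - p.μ₃ ≤ p.serviceRate q)
    (hO : passed p D q = fun t => min (p.serviceRate q * t) (feed p.K D t))
    (hh : (canonical p g A D).h q = fun t => (I t - passed p D q t) / p.serviceRate q)
    (harr : ∀ k < p.K, ∀ t, 0 ≤ t → cumul (initialDensity (some (4 * k + (q : ℕ)))) (initialHeight q)
      + arrived p g D (some (4 * k + q)) t = level k (I t)) :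
    IsFIFOServer (p.classesAt q) (p.serviceRate q) (initialHeight q) (τ (p.K + p.K'))
      initialDensity (canonical p g A D).arr (canonical p g A D).dep ((canonical p g A D).h q) := by
  have C := S.course
  have hμ := S.serviceRate_pos q
  have hT := C.TP_pos.le
  have hq3 : (q : ℕ) < 3 := hq
  have hF := S.feed_flow
  have hOle : ∀ t, 0 ≤ t → passed p D q t ≤ I t := fun t ht => by
    rw [hO]
    by_cases h : I t < p.serviceRate q * t
    · rw [hIeq t ht h]; exact min_le_right _ _
    · exact (min_le_left _ _).trans (not_lt.1 h)
  have hn : ∀ t, 0 ≤ t → 0 ≤ (canonical p g A D).h q t := fun t ht => by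
    rw [hh]; exact div_nonneg (sub_nonneg.2 (hOle t ht)) hμ.le
  have hlip : LipschitzWith (Real.toNNReal (1 / p.serviceRate q)) ((canonical p g A D).h q) := by
    refine LipschitzWith.of_dist_le_mul fun x y => ?_
    rw [Real.coe_toNNReal _ (by positivity), hh, Real.dist_eq, Real.dist_eq, ← sub_div, abs_div,
      abs_of_pos hμ, div_mul_eq_mul_div, one_mul]
    refine div_le_div_of_nonneg_right ?_ hμ.le
    have hOq := S.passed_flow q
    rcases le_total x y with h | h
    · have h1 := hI.mono _ _ h; have h2 := hI.slow _ _ h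
      have h3 := hOq.mono _ _ h; have h4 := hOq.slow _ _ h
      rw [abs_of_nonpos (sub_nonpos.2 h), abs_le]
      constructor <;> linarith
    · have h1 := hI.mono _ _ h; have h2 := hI.slow _ _ h
      have h3 := hOq.mono _ _ h; have h4 := hOq.slow _ _ h
      rw [abs_of_nonneg (sub_nonneg.2 h), abs_le]
      constructor <;> linarith
  have hh0 : (canonical p g A D).h q 0 = initialHeight q := by
    rw [hh]
    simp only
    rw [S.passed_zero, sub_zero, hI0]
    by_cases h0 : q = 0
    · subst h0; simp [Params.serviceRate]
    · rw [initialHeight_pos h0, zero_div]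
  have hmul : ∀ t, p.serviceRate q * (canonical p g A D).h q t = I t - passed p D q t := fun t => by
    rw [hh]; simp only; field_simp
  -- Either the input is behind the line and the server is empty, or the output is on the line at
  -- `t` and, as `I t` does not exceed `feed`, still at `t + h t`.
  have hdeparture : ∀ t, 0 ≤ t → passed p D q (t + (canonical p g A D).h q t) = I t := by
    intro t ht
    have h1 := hmul t
    have h2 := hn t ht
    set x := (canonical p g A D).h q t with hx
    by_cases hlt : I t < p.serviceRate q * t
    · have h3 := hIeq t ht hlt
      have h4 : passed p D q t = I t := by rw [hO]; simp only; rw [← h3]; exact min_eq_right hlt.le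
      rw [h4, sub_self] at h1
      have h5 : x = 0 := (mul_eq_zero.1 h1).resolve_left hμ.ne'
      rw [h5, add_zero, h4]
    · have h3 : passed p D q t = p.serviceRate q * t := by
        rw [hO]; exact min_eq_left ((not_lt.1 hlt).trans (hIF t ht))
      rw [h3] at h1
      have h5 : p.serviceRate q * (t + x) = I t := by rw [mul_add, h1]; ring
      rw [hO]
      simp only
      rw [h5]
      exact min_eq_left ((hIF t ht).trans (hF.monotone (by linarith)))
  have hclass : ∀ c ∈ p.classesAt q, ∃ k < p.K, c = some (4 * k + (q : ℕ)) := fun c hc => by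
    by_contra! hcon
    have h1 := sum_classesAt_of_lt p q hq fun c' => if c' = c then 1 else 0
    rw [Finset.sum_ite_eq' , if_pos hc, Finset.sum_eq_zero] at h1
    · exact one_ne_zero h1
    · intro k hk
      rw [if_neg]
      exact fun h => hcon k (Finset.mem_range.1 hk) h.symm
  have hIsum : ∀ t, 0 ≤ t → p.serviceRate q * initialHeight q +
      ∑ c ∈ p.classesAt q, arrived p g D c t = I t := fun t ht => by
    have h1 : ∑ c ∈ p.classesAt q, cumul (initialDensity c) (initialHeight q)
        = p.serviceRate q * initialHeight q := by
      rw [sum_classesAt_of_lt p q hq]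
      simp only [cumul_initialDensity]
      by_cases h0 : q = 0
      · subst h0
        rw [Finset.sum_eq_single_of_mem 0 (by simp; linarith [C.two_le])]
        · simp [Params.serviceRate]
        · intro k _ hk
          simp [hk]
      · rw [initialHeight_pos h0]; simp
    rw [← h1, ← Finset.sum_add_distrib, sum_classesAt_of_lt p q hq,
      Finset.sum_congr rfl fun k hk => harr k (Finset.mem_range.1 hk) t ht, sum_level]
    · exact min_eq_left ((hIF t ht).trans (min_le_right _ _))
    · have := hI.monotone ht
      rw [hI0] at this
      exact (initialHeight_nonneg q).trans this
  refine ⟨hlip.continuous.continuousOn, fun t ht => hn t ht.1, ?_, ?_, ?_⟩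
  · rw [← hh0]
    refine height_of_conservation hμ (O := passed p D q)
      (I := fun t => p.serviceRate q * initialHeight q + ∑ c ∈ p.classesAt q, arrived p g D c t)
      (hlip.lipschitzOnWith (s := uIcc _ _)).absolutelyContinuousOnInterval
      (fun t ht => hn t ht.1) (fun t ht => by rw [hIsum t ht.1.le]; exact hmul t) ?_ ?_ ?_
    · filter_upwards [S.arrived_hasDerivAt] with t ht
      exact (HasDerivAt.fun_sum fun c _ => ht c).const_add _
    · intro s hs t ht hst
      have h1 := C.feed_sub_le hst
      have h2 : (1 - p.μ₃) * (t - s) ≤ p.serviceRate q * (t - s) :=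
        mul_le_mul_of_nonneg_right hrate (by linarith)
      rw [hO]
      simp only
      rcases min_choice (p.serviceRate q * s) (feed p.K D s) with h3 | h3 <;> rw [h3]
      · linarith [min_le_left (p.serviceRate q * t) (feed p.K D t)]
      · linarith [min_le_right (p.serviceRate q * t) (feed p.K D t)]
    · intro t ht hpos
      have h1 : passed p D q t < feed p.K D t := by
        have := mul_pos hμ hpos
        rw [hmul] at this
        linarith [hIF t ht.1.le]
      have h2 : p.serviceRate q * t < feed p.K D t := by
        by_contra! hle
        rw [hO] at h1
        simp only [min_eq_right hle] at h1
        exact lt_irrefl _ h1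
      have hcont : Continuous fun s => feed p.K D s - p.serviceRate q * s :=
        C.feed_continuous.sub (by fun_prop)
      filter_upwards [(hcont.tendsto t).eventually_const_lt (sub_pos.2 h2)] with s hs
      rw [hO]
      exact min_eq_left (sub_pos.1 hs).le
  · intro c hc u hu hux
    obtain ⟨k, hk, rfl⟩ := hclass c hc
    change cumul ((canonical p g A D).dep _) u = cumul (initialDensity _) u
    rw [S.cumul_dep, departed_of_lt p D hk (by omega), cumul_initialDensity]
    simp only
    by_cases h0 : q = 0
    · subst h0
      have hu1 : u ≤ 1 := hux
      have hp : passed p D ((0 : Fin 4) : ℕ) u = u := by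
        change min (1 * u) _ = u
        rw [one_mul]
        exact min_eq_left (hu1.trans (C.one_le_feed hu.1))
      rw [hp]
      rcases Nat.eq_zero_or_pos k with rfl | hk0
      · simp [level, hu.1, hu1]
      · rw [level_of_le (hu1.trans (by exact_mod_cast hk0))]
        simp [hk0.ne']
    · rw [initialHeight_pos h0] at hux
      obtain rfl : u = 0 := le_antisymm hux hu.1
      rw [S.passed_zero, level_of_le (Nat.cast_nonneg _)]
      simp
  · intro c hc t ht htT
    obtain ⟨k, hk, rfl⟩ := hclass c hc
    change cumul ((canonical p g A D).dep _) _ = cumul (initialDensity _) _ +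
      cumul ((canonical p g A D).arr _) t
    rw [S.cumul_dep, S.cumul_arr, departed_of_lt p D hk (by omega), harr k hk t ht.1]
    simp only
    rw [hdeparture t ht.1]

theorem server_zero (S : Setting p φ g τ A D) :
    IsFIFOServer (p.classesAt 0) (p.serviceRate 0) (initialHeight 0) (τ (p.K + p.K'))
      initialDensity (canonical p g A D).arr (canonical p g A D).dep ((canonical p g A D).h 0) := by
  have C := S.course
  have hc := C.c_lt
  refine S.isFIFOServer_of_lt 0 (by decide) S.feed_flow C.feed_zero (fun _ _ => le_rfl)
    (fun _ _ _ => rfl) hc.le rfl rfl fun k hk t ht => ?_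
  rw [cumul_initialDensity]
  rcases k with _ | k
  · rw [level_of_ge (by simpa using C.one_le_feed ht)]
    simp [arrived, initialHeight]
  · change _ + departed p D (some (4 * k + 3)) t = _
    rw [departed_of_lt p D (by omega) (by norm_num), feed, level_min hk, level_add_one]
    simp [passed]

theorem server_one (S : Setting p φ g τ A D) :
    IsFIFOServer (p.classesAt 1) (p.serviceRate 1) (initialHeight 1) (τ (p.K + p.K'))
      initialDensity (canonical p g A D).arr (canonical p g A D).dep ((canonical p g A D).h 1) := by
  have h1 := S.μ₂_pos
  refine S.isFIFOServer_of_lt 1 (by decide) (S.passed_flow 0) (S.passed_zero 0)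
    (fun _ _ => min_le_right _ _) (fun t ht hlt => ?_) ?_ rfl rfl fun k hk t ht => ?_
  · change min (1 * t) _ < (1 - p.μ₂) * t at hlt
    refine min_eq_right (le_of_not_gt fun h => ?_)
    rw [min_eq_left h.le] at hlt
    nlinarith
  · change 1 - p.μ₃ ≤ 1 - p.μ₂
    linarith [S.μ₂_lt]
  · rw [cumul_initialDensity]
    change _ + departed p D (some (4 * k + 0)) t = _
    rw [departed_of_lt p D hk (by norm_num)]
    simp

theorem server_two (S : Setting p φ g τ A D) :
    IsFIFOServer (p.classesAt 2) (p.serviceRate 2) (initialHeight 2) (τ (p.K + p.K'))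
      initialDensity (canonical p g A D).arr (canonical p g A D).dep ((canonical p g A D).h 2) := by
  have h1 := S.μ₂_lt
  refine S.isFIFOServer_of_lt 2 (by decide) (S.passed_flow 1) (S.passed_zero 1)
    (fun _ _ => min_le_right _ _) (fun t ht hlt => ?_) le_rfl rfl rfl fun k hk t ht => ?_
  · change min ((1 - p.μ₂) * t) _ < (1 - p.μ₃) * t at hlt
    refine min_eq_right (le_of_not_gt fun h => ?_)
    rw [min_eq_left h.le] at hlt
    nlinarith
  · rw [cumul_initialDensity]
    change _ + departed p D (some (4 * k + 1)) t = _
    rw [departed_of_lt p D hk (by norm_num)]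
    simp

/-- Visit `m` to `Q₄` comprises the positions between `m` and `m + 1`. Before `T₃` the arrivals are
the output of `Q₃`; afterwards `A = 1 + D` shifts departures of one visit to arrivals of the next.
-/
theorem arrived_visit (S : Setting p φ g τ A D) (m : ℕ) {t : ℝ}
    (ht : t ∈ Icc 0 (τ (p.K + p.K'))) :
    arrived p g D (some (visit p.K m)) t = level m (A t) := by
  have C := S.course
  have hK := C.two_le
  by_cases hm : m < p.K
  · have hm' : (m : ℝ) + 1 ≤ p.K := by exact_mod_cast hm
    rw [visit, if_pos hm]
    change departed p D (some (4 * m + 2)) t = _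
    rw [departed_of_lt p D hm (by norm_num)]
    simp only [passed]
    rcases le_total t ((p.K : ℝ) / (1 - p.μ₃)) with h | h
    · rw [C.min_line_feed h, C.A_of_le h]
    · rw [C.min_line_feed' h, level_of_ge hm', level_of_ge]
      linarith [C.A_of_ge h ht.2, C.le_D_of_le h]
  · obtain ⟨n, rfl⟩ : ∃ n, m = n + 1 := ⟨m - 1, by omega⟩
    have hv : visit p.K (n + 1) = visit p.K n + 1 := by
      unfold visit; split_ifs <;> omega
    rw [hv]
    change departed p D (some (visit p.K n)) t = _
    rw [departed_visit]
    simp only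
    rcases le_total t ((p.K : ℝ) / (1 - p.μ₃)) with h | h
    · have hn : (p.K : ℝ) ≤ n + 1 := by exact_mod_cast not_lt.1 hm
      have h1 : (1 - p.μ₃) * t ≤ p.K := by rwa [le_div_iff₀' C.c_pos] at h
      rw [C.A_of_le h, level_of_le (by linarith [C.D_le_of_le h]),
        level_of_le (by push_cast; linarith)]
    · rw [C.A_of_ge h ht.2, level_add_one]

theorem server_three (S : Setting p φ g τ A D) :
    IsFIFOServer (p.classesAt 3) (p.serviceRate 3) (initialHeight 3) (τ (p.K + p.K'))
      initialDensity (canonical p g A D).arr (canonical p g A D).dep ((canonical p g A D).h 3) := by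
  have C := S.course
  have hS := cumul_continuous C.g_cont
  have hh : (canonical p g A D).h 3 = fun t => A t + cumul g t - t := rfl
  have hclass : ∀ c ∈ p.classesAt 3, c = none ∨ ∃ m, c = some (visit p.K m) := fun c hc => by
    by_cases h : c = none
    · exact Or.inl h
    · have h1 := Finset.mem_erase.2 ⟨h, hc⟩
      rw [classesAt_three, Finset.mem_image] at h1
      obtain ⟨m, -, hm⟩ := h1
      exact Or.inr ⟨m, hm.symm⟩
  have hn : ∀ t ∈ Icc 0 (τ (p.K + p.K')), 0 ≤ (canonical p g A D).h 3 t := fun t ht => by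
    rw [hh]
    rcases ht.1.eq_or_lt with h | h
    · rw [← h]; exact C.height₄_zero.ge
    · exact (C.height₄_pos h ht.2).le
  refine ⟨?_, hn, ?_, ?_, ?_⟩
  · rw [hh]
    exact ((C.A_lipschitz.continuous.add hS).sub continuous_id).continuousOn
  · have h0 : (canonical p g A D).h 3 0 = initialHeight 3 := C.height₄_zero
    rw [← h0]
    -- `Q₄` never idles, so its total output is `t` and both conditions on the output are immediate.
    refine height_of_conservation (S.serviceRate_pos 3) (O := fun t => t)
      (I := fun t => ∑ c ∈ p.classesAt 3, arrived p g D c t) ?_ hn ?_ ?_ ?_ ?_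
    · rw [hh]
      have h1 := S.A_flow.absolutelyContinuous 0 (τ (p.K + p.K'))
      have h2 := (C.g_cont.intervalIntegrable (μ := volume) 0
        (τ (p.K + p.K'))).absolutelyContinuousOnInterval_intervalIntegral (c := 0) (by simp)
      have h3 := (IsFlow.mul_id zero_le_one le_rfl).absolutelyContinuous 0 (τ (p.K + p.K'))
      simp only [one_mul] at h3
      exact (h1.add h2).sub h3
    · intro t ht
      have htT : t ∈ Icc 0 (τ (p.K + p.K')) := ⟨ht.1.le, ht.2.le⟩
      rw [sum_classesAt_three, Finset.sum_congr rfl fun m _ => S.arrived_visit m htT,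
        sum_level (C.A_nonneg htT.1), min_eq_left (by push_cast; exact C.A_le htT.2), hh]
      simp only [arrived, Params.serviceRate, Matrix.cons_val]
      ring
    · filter_upwards [S.arrived_hasDerivAt] with t ht
      exact HasDerivAt.fun_sum fun c _ => ht c
    · intro s _ t _ _
      simp [Params.serviceRate]
    · intro t _ _
      simp [Params.serviceRate]
  · intro c hc u hu hux
    obtain rfl : u = 0 := le_antisymm hux hu.1
    simp
  · intro c hc t ht htT
    change cumul ((canonical p g A D).dep _) _ = cumul (initialDensity _) _ +
      cumul ((canonical p g A D).arr _) t
    rw [S.cumul_dep, S.cumul_arr, cumul_initialDensity, hh]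
    simp only [add_sub_cancel]
    have hz : (if c = some 0 then initialHeight 3 else 0) = 0 := by
      split_ifs <;> rfl
    rw [hz, zero_add]
    rcases hclass c hc with rfl | ⟨m, rfl⟩
    · simp only [departed, arrived]
      rw [C.D_departure]; ring
    · rw [departed_visit, S.arrived_visit m ht]
      simp only
      rw [C.D_departure]

theorem canonical_stored_none (S : Setting p φ g τ A D) (t : ℝ) :
    (canonical p g A D).stored p none t = cumul g t - cumul g (τ (D t)) := by
  rw [stored_none, S.cumul_dep]
  change cumul g t - (t - D t) = _
  linarith [S.course.eta_D t]

/-- The simple session is blocked exactly as long as its departing fluid was injected at a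
positive rate. -/
theorem canonical_blocked_iff (S : Setting p φ g τ A D) {t : ℝ} (h0 : 0 < t)
    (ht : t ≤ τ (p.K + p.K')) : (canonical p g A D).Blocked p t ↔ 0 < g (τ (D t)) := by
  have C := S.course
  have hlt := C.tau_D_lt h0 ht
  rw [Evolution.Blocked, S.canonical_stored_none, sub_pos]
  constructor
  · intro h
    refine (C.g_nonneg _).lt_of_ne' fun h' => ?_
    rw [cumul_eq_of_antitone C.g_cont C.g_anti C.g_nonneg hlt.le h'] at h
    exact lt_irrefl _ h
  · exact cumul_lt_of_pos C.g_cont C.g_nonneg hlt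

/-- If `g a > 0`, then `g` is positive just after `a`, and also at the earlier times `τ (D t)`, so
the session would be blocked there. Hence `g a = 0`, and `g` stays zero. -/
theorem canonical_constant (S : Setting p φ g τ A D) {a b : ℝ} (ha : 0 ≤ a) (hab : a < b)
    (hb : b ≤ τ (p.K + p.K'))
    (h : ∀ᵐ t ∂(volume.restrict (Ioo a b)), ¬ (canonical p g A D).Blocked p t) :
    ∀ t ∈ Icc a b, g t = g a := by
  have C := S.course
  have hga : g a = 0 := by
    by_contra hne
    have hpos : 0 < g a := (C.g_nonneg a).lt_of_ne' hne
    obtain ⟨ε, hε, hball⟩ := Metric.eventually_nhds_iff.1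
      (C.g_cont.continuousAt.eventually_const_lt hpos)
    have hsub : Ioo a (min b (a + ε)) ⊆ Ioo a b := Ioo_subset_Ioo_right (min_le_left _ _)
    have h1 := ae_restrict_of_ae_restrict_of_subset hsub h
    have h2 : ∃ t ∈ Ioo a (min b (a + ε)), ¬ (canonical p g A D).Blocked p t := by
      by_contra! hcon
      rw [ae_restrict_iff' measurableSet_Ioo] at h1
      have h3 : volume (Ioo a (min b (a + ε))) = 0 := by
        refine measure_mono_null (fun t ht => ?_) (ae_iff.1 h1)
        simp only [mem_ofPred_eq, Classical.not_imp, not_not]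
        exact ⟨ht, hcon t ht⟩
      rw [Real.volume_Ioo, ENNReal.ofReal_eq_zero] at h3
      have : a < min b (a + ε) := lt_min hab (by linarith)
      linarith
    obtain ⟨t, ht, hnb⟩ := h2
    have ht0 : 0 < t := ha.trans_lt ht.1
    have htT : t ≤ τ (p.K + p.K') := (hsub ht).2.le.trans hb
    rw [S.canonical_blocked_iff ht0 htT, not_lt] at hnb
    have h4 := C.g_anti (C.tau_D_lt ht0 htT).le
    have h5 : 0 < g t := hball (by
      rw [Real.dist_eq, abs_of_pos (sub_pos.2 ht.1)]
      linarith [ht.2.trans_le (min_le_right b (a + ε))])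
    linarith
  intro t ht
  have := C.g_anti ht.1
  rw [hga] at this ⊢
  exact le_antisymm this (C.g_nonneg t)

theorem canonical_control (S : Setting p φ g τ A D) :
    (canonical p g A D).FlowControl p φ (τ (p.K + p.K')) := by
  have C := S.course
  refine ⟨C.g_cont.continuousOn, S.g_zero, fun t ht => ⟨C.g_nonneg t, ?_⟩, ?_, ?_, ?_⟩
  · rw [← S.g_zero]; exact C.g_anti ht.1
  · intro a b ha hab hb hna hbl t ht
    rcases ha.eq_or_lt with h | h
    · subst h
      change g t = φ (g 0) (t - 0)
      rw [S.g_zero, sub_zero, S.g_eq t ht.1]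
    -- Being unblocked at `a > 0` means that `g` vanishes at `τ (D a)`, hence later too; so no
    -- blocked period starts after time `0`.
    · exfalso
      rw [S.canonical_blocked_iff h (hab.le.trans hb), not_lt] at hna
      have hm := hbl ((a + b) / 2) ⟨by linarith, by linarith⟩
      rw [S.canonical_blocked_iff (by linarith) (by linarith)] at hm
      have h1 : D a ≤ D ((a + b) / 2) := S.D_flow.monotone (by linarith)
      have := C.g_anti (C.tau_strictMono.monotone h1)
      linarith
  · intro a b ha hab hb h
    refine S.canonical_constant ha hab hb ?_
    filter_upwards [h] with t ht using ht.1
  · intro a b ha hab hb h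
    have hc := S.canonical_constant ha hab hb (by filter_upwards [h] with t ht using ht.1)
    intro s hs t ht _
    change g s ≤ g t
    rw [hc s hs, hc t ht]

theorem canonical_isEvolution (S : Setting p φ g τ A D) :
    IsEvolution p φ (τ (p.K + p.K')) (canonical p g A D) := by
  refine ⟨fun c _ t _ => (S.departed_flow c).monotone.deriv_nonneg,
    fun c _ => ((S.departed_flow c).absolutelyContinuous _ _).intervalIntegrable_deriv,
    fun _ _ => rfl, fun q => ?_, S.canonical_control⟩
  fin_cases q
  · exact S.server_zero
  · exact S.server_one
  · exact S.server_two
  · exact S.server_three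

end Setting

/-! ### Choice of the injection rate and the damping parameter -/

namespace IsFlowDecrease

variable {Sdel : Set ℝ} {f : ℝ → ℝ → ℝ → ℝ} {δ : ℝ}

theorem le_rate (hf : IsFlowDecrease Sdel f) (hδ : δ ∈ Sdel) {ε t : ℝ} (hε : 0 ≤ ε) (ht : 0 ≤ t) :
    f δ ε t ≤ ε := by
  have := hf.anti_time δ hδ ε hε (mem_Ici.2 le_rfl) (mem_Ici.2 ht) ht
  simpa [hf.initial δ hδ ε hε] using this

theorem nonneg (hf : IsFlowDecrease Sdel f) (hδ : δ ∈ Sdel) {ε t : ℝ} (hε : 0 ≤ ε) (ht : 0 ≤ t) :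
    0 ≤ f δ ε t := by
  obtain ⟨t₀, ht₀, hz⟩ := hf.decrease δ hδ ε hε
  have h := hf.anti_time δ hδ ε hε (mem_Ici.2 ht) (mem_Ici.2 (ht.trans (le_max_left t t₀)))
    (le_max_left t t₀)
  simpa [hz _ (le_max_right t t₀)] using h

/-- Clamping at zero gives an everywhere continuous function, as the intermediate value argument and
the course of events require. -/
theorem continuous_extension (hf : IsFlowDecrease Sdel f) (hδ : δ ∈ Sdel) :
    Continuous fun x : ℝ × ℝ => f δ (max x.1 0) (max x.2 0) :=
  (hf.continuity δ hδ).comp_continuous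
    (f := fun x : ℝ × ℝ => ((max x.1 0, max x.2 0) : ℝ × ℝ)) (by fun_prop)
    fun x => ⟨le_max_right x.1 0, le_max_right x.2 0⟩

/-- A damping parameter for which the rates `a` and `b` hardly decrease up to time `t`. -/
theorem exists_slow (hf : IsFlowDecrease Sdel f) {a b t : ℝ} (ha : 0 < a) (hb : 0 < b)
    (ht : 0 < t) : ∃ δ ∈ Sdel, 9 / 10 * a < f δ a t ∧ 9 / 10 * b < f δ b t := by
  obtain ⟨δ₁, h₁, h₁'⟩ := (hf.damping (9 / 10 * a) a t (by positivity) (by linarith) ht).1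
  obtain ⟨δ₂, h₂, h₂'⟩ := (hf.damping (9 / 10 * b) b t (by positivity) (by linarith) ht).1
  -- The smaller parameter serves both rates, because `f` is antitone in `δ`.
  rcases le_total δ₁ δ₂ with h | h
  · exact ⟨δ₁, h₁, h₁', h₂'.trans_le (hf.anti_damping b hb.le t ht.le h₁ h₂ h)⟩
  · exact ⟨δ₂, h₂, h₁'.trans_le (hf.anti_damping a ha.le t ht.le h₂ h₁ h), h₂'⟩

/-- A maximal rate and a damping parameter for which exactly `K - 1` units of horizontal fluid
have left `Q₄` when the last fluid arrives there from `Q₃`. -/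
theorem exists_balance (hf : IsFlowDecrease Sdel f) {K : ℕ} (hK : 20 ≤ K) :
    ∃ ε ∈ Icc (5 / (3 * ((K : ℝ) - 1))) (3 / 2 * (5 / (3 * ((K : ℝ) - 1)))), ∃ δ ∈ Sdel,
      ε / 2 ≤ f δ ε (K / (1 - 2 * ε / 5)) ∧
      (K - 1 : ℝ) + cumul (fun t => f δ (max ε 0) (max t 0)) ((K - 1 : ℝ) / (1 - 2 * ε / 5))
        = K / (1 - 2 * ε / 5) := by
  have hK' : (20 : ℝ) ≤ K := by exact_mod_cast hK
  -- `lo` is the rate that solves the balance equation without damping, `(K - 1) * (c + ε) = K` with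
  -- `c = 1 - 2 * ε / 5`. At `3 / 2 * lo` a tenth of the rate can be lost and the left side of the
  -- balance still dominates.
  set lo : ℝ := 5 / (3 * ((K : ℝ) - 1)) with hlo
  have hK1 : (0 : ℝ) < K - 1 := by linarith
  have hlo0 : 0 < lo := by positivity
  have hloK : ((K : ℝ) - 1) * lo = 5 / 3 := by rw [hlo]; field_simp
  have hlo1 : lo ≤ 1 / 10 := by nlinarith
  -- The horizon `2 * K` covers `K / c` because `c ≥ 1 / 2`.
  obtain ⟨δ, hδ, h1, h2⟩ := hf.exists_slow (t := 2 * K) hlo0 (show 0 < 3 / 2 * lo by positivity)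
    (by positivity)
  have hG := hf.continuous_extension hδ
  -- The clamp keeps division by `c x` continuous everywhere; it is inactive on the interval in
  -- question.
  set c : ℝ → ℝ := fun x => max (1 - 2 * x / 5) (1 / 2) with hc
  have hcc : Continuous c := by fun_prop
  have hc0 : ∀ x, 1 / 2 ≤ c x := fun x => le_max_right _ _
  have hc0' : ∀ x, c x ≠ 0 := fun x => by have := hc0 x; positivity
  have hce : ∀ x ≤ 3 / 2 * lo, c x = 1 - 2 * x / 5 := fun x hx => max_eq_left (by linarith)
  have hs : ∀ (x y : ℝ), 0 ≤ y → y / c x ≤ 2 * y := fun x y hy => by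
    rw [div_le_iff₀ (by linarith [hc0 x])]; nlinarith [hc0 x]
  have hcont : Continuous fun x => (K - 1 : ℝ) +
      (∫ t in (0 : ℝ)..((K - 1 : ℝ) / c x), f δ (max x 0) (max t 0)) - K / c x := by
    refine (continuous_const.add ?_).sub (continuous_const.div hcc hc0')
    exact intervalIntegral.continuous_parametric_intervalIntegral_of_continuous
      (f := fun x t => f δ (max x 0) (max t 0)) hG (continuous_const.div hcc hc0')
  have hGx : ∀ x, Continuous fun t => f δ (max x 0) (max t 0) := fun x =>
    hG.comp (by fun_prop : Continuous fun t : ℝ => ((x, t) : ℝ × ℝ))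
  have hle : lo ≤ 3 / 2 * lo := by linarith
  obtain ⟨ε, hε, hbal⟩ := intermediate_value_Icc hle hcont.continuousOn (show (0 : ℝ) ∈ _ from by
    constructor
    · have hcl := hc0 lo
      have h3 : ∫ t in (0 : ℝ)..((K - 1 : ℝ) / c lo), f δ (max lo 0) (max t 0)
          ≤ ∫ _t in (0 : ℝ)..((K - 1 : ℝ) / c lo), lo := by
        refine intervalIntegral.integral_mono_on (by positivity) ((hGx lo).intervalIntegrable _ _)
          (by simp) fun t ht => ?_
        rw [max_eq_left hlo0.le]
        exact hf.le_rate hδ hlo0.le (le_max_right _ _)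
      rw [intervalIntegral.integral_const, sub_zero, smul_eq_mul] at h3
      have h4 : (K - 1 : ℝ) + (K - 1) / c lo * lo - K / c lo = 0 := by
        have h5 := hce lo hle
        field_simp [hc0' lo]
        rw [h5]; linarith
      linarith
    · have hcl := hc0 (3 / 2 * lo)
      have h3 := le_cumul_sub (hGx (3 / 2 * lo)) (s := 0) (t := (K - 1 : ℝ) / c (3 / 2 * lo))
        (m := 9 / 10 * (3 / 2 * lo)) (by positivity) fun t ht => by
          rw [max_eq_left (by positivity), max_eq_left ht.1]
          refine h2.le.trans (hf.anti_time δ hδ _ (by positivity) (mem_Ici.2 ht.1)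
            (mem_Ici.2 (by positivity)) ?_)
          have := hs (3 / 2 * lo) ((K : ℝ) - 1) hK1.le
          linarith [ht.2]
      rw [cumul_zero, sub_zero, sub_zero] at h3
      have h4 : 0 ≤ (K - 1 : ℝ) + 9 / 10 * (3 / 2 * lo) * ((K - 1) / c (3 / 2 * lo))
          - K / c (3 / 2 * lo) := by
        have h6 : (K - 1 : ℝ) + 9 / 10 * (3 / 2 * lo) * ((K - 1) / c (3 / 2 * lo))
          - K / c (3 / 2 * lo) = ((K - 1 : ℝ) * c (3 / 2 * lo)
            + 9 / 10 * (3 / 2 * lo) * (K - 1) - K) / c (3 / 2 * lo) := by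
          have h7 := hc0' (3 / 2 * lo)
          generalize c (3 / 2 * lo) = d at h7 ⊢
          field_simp
        rw [h6]
        -- The numerator is `(K - 1) * (c + 9 / 10 * ε) - K = 1 / 4` at `ε = 3 / 2 * lo`.
        refine div_nonneg ?_ (by linarith)
        rw [hce _ le_rfl]
        nlinarith
      unfold cumul at h3
      linarith)
  have hε0 : 0 < ε := hlo0.trans_le hε.1
  have hbal : (K - 1 : ℝ) + (∫ t in (0 : ℝ)..((K - 1 : ℝ) / c ε), f δ (max ε 0) (max t 0))
      - K / c ε = 0 := hbal
  refine ⟨ε, hε, δ, hδ, ?_, ?_⟩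
  · rw [← hce ε hε.2]
    have hKc : 0 ≤ (K : ℝ) / c ε := div_nonneg (by linarith) (by linarith [hc0 ε])
    -- The rate at `K / c` is at least `f δ lo (2 * K) > 9 / 10 * lo`, whereas `ε / 2 ≤ 3 / 4 * lo`.
    have h3 := hf.anti_time δ hδ ε hε0.le (mem_Ici.2 hKc) (mem_Ici.2 (by positivity))
      (hs ε K (by linarith))
    have h4 := hf.mono_rate δ hδ (2 * K) (by positivity) (mem_Ici.2 hlo0.le) (mem_Ici.2 hε0.le) hε.1
    simp only at h3 h4
    linarith [hε.2]
  · rw [← hce ε hε.2]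
    unfold cumul
    linarith

end IsFlowDecrease

end BasicGadget

/-! ### Assembly -/

theorem lemma1 (Sdel : Set ℝ) (f : ℝ → ℝ → ℝ → ℝ) (hf : IsFlowDecrease Sdel f)
    (K : ℕ) (hK : 20 ≤ K) :
    ∃ εs δs μ₂ μ₃ : ℝ, ∃ K' : ℕ, ∃ T₁ T₂ T₃ TP : ℝ,
      εs ∈ Set.Ioo (5 / (3 * (K : ℝ))) (20 / (K : ℝ)) ∧ εs < 1 ∧
      δs ∈ Sdel ∧
      0 < μ₂ ∧ μ₂ < μ₃ ∧ μ₃ = 2 * εs / 5 ∧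
      0 < T₁ ∧ T₁ < T₂ ∧ T₂ < T₃ ∧ T₃ < TP ∧ T₃ = (K : ℝ) / (1 - μ₃) ∧
      (∃ e : Evolution, IsEvolution ⟨K, K', εs, μ₂, μ₃⟩ (f δs) TP e) ∧
      ∀ e : Evolution, IsEvolution ⟨K, K', εs, μ₂, μ₃⟩ (f δs) TP e →
        PhaseTable ⟨K, K', εs, μ₂, μ₃⟩ T₁ T₂ T₃ TP e := by
  obtain ⟨ε, hε, δ, hδ, hrate, hbal⟩ := hf.exists_balance hK
  have hK' : (20 : ℝ) ≤ K := by exact_mod_cast hK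
  have hK1 : (0 : ℝ) < 3 * ((K : ℝ) - 1) := by linarith
  have h1 : 5 / (3 * (K : ℝ)) < 5 / (3 * ((K : ℝ) - 1)) :=
    div_lt_div_of_pos_left (by norm_num) hK1 (by linarith)
  have h2 : 3 / 2 * (5 / (3 * ((K : ℝ) - 1))) < 20 / K := by
    rw [lt_div_iff₀ (by linarith), ← mul_div_assoc, div_mul_eq_mul_div, div_lt_iff₀ hK1]
    linarith
  have h3 : 20 / (K : ℝ) ≤ 1 := by rw [div_le_one (by linarith)]; exact hK'
  have hε0 : 0 < ε := (by positivity : (0 : ℝ) < 5 / (3 * ((K : ℝ) - 1))).trans_le hε.1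
  have hε1 : ε < 1 := hε.2.trans_lt (h2.trans_le h3)
  have hc : 0 < 1 - 2 * ε / 5 := by linarith
  set g : ℝ → ℝ := fun t => f δ (max ε 0) (max t 0) with hg
  have hgt : ∀ t, 0 ≤ t → g t = f δ ε t := fun t ht => by
    simp only [hg, max_eq_left ht, max_eq_left hε0.le]
  have hT3 : 0 ≤ (K : ℝ) / (1 - 2 * ε / 5) := by positivity
  have hg0 : g 0 = ε := by rw [hgt 0 le_rfl, hf.initial δ hδ ε hε0.le]
  obtain ⟨K', τ, A, D, C⟩ := exists_course (K := K) (c := 1 - 2 * ε / 5) (g := g) (by omega) hc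
    (by linarith)
    ((hf.continuous_extension hδ).comp (by fun_prop : Continuous fun t : ℝ => ((ε, t) : ℝ × ℝ)))
    (fun s t hst => hf.anti_time δ hδ _ (le_max_right _ _) (mem_Ici.2 (le_max_right _ _))
      (mem_Ici.2 (le_max_right _ _)) (max_le_max hst le_rfl))
    (fun t => hf.nonneg hδ (le_max_right _ _) (le_max_right _ _))
    -- The overload of `Q₄` comes from `μ₃ = 2 * ε / 5 < ε / 2`.
    (by rw [hgt _ hT3]; linarith)
    (by
      obtain ⟨t₀, ht₀, hz⟩ := hf.decrease δ hδ ε hε0.le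
      exact ⟨t₀, fun t ht => by rw [hgt t (ht₀.le.trans ht), hz t ht]⟩) hbal
  -- Any `μ₂` strictly between `0` and `μ₃` would do; half of `μ₃` is taken.
  have S : Setting ⟨K, K', ε, ε / 5, 2 * ε / 5⟩ (f δ) g τ A D :=
    ⟨C, by simp only; positivity, by simp only; linarith, hgt, fun x hx t ht => hf.le_rate hδ hx ht,
      hg0, by simp only; rw [hgt _ hT3]; exact hrate⟩
  obtain ⟨T₁, hT1, -, hT1e, hT1l, hT1r⟩ := C.exists_crossing (c' := 1) (by linarith)
  obtain ⟨T₂, hT2, hT23, hT2e, hT2l, hT2r⟩ := C.exists_crossing (c' := 1 - ε / 5) (by linarith)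
  have hT12 : T₁ < T₂ := by
    by_contra! h
    have := hT2r T₁ h
    rw [hT1e] at this
    nlinarith
  refine ⟨ε, δ, ε / 5, 2 * ε / 5, K', T₁, T₂, (K : ℝ) / (1 - 2 * ε / 5), τ (K + K'),
    ⟨h1.trans_le hε.1, hε.2.trans_lt h2⟩, hε1, hδ, by positivity, by linarith, rfl, hT1, hT12,
    hT23, C.T₃_lt, rfl, ⟨_, S.canonical_isEvolution⟩, fun e E => ?_⟩
  exact S.phaseTable E hT1 hT12 hT23 (fun t ht => by simpa using hT1l t ht)
    (fun t ht => by simpa using hT1r t ht) hT2l hT2r
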